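/- Let $\phi=\frac{1+\sqrt5}{2}$. The *golden L* is the translation surface made of the unit square $[0,1]^2$ and the rectangles $[1,\phi]\times[0,1]$ and $[0,1]\times[1,\phi]$, with opposite parallel sides of this L identified. The *double pentagon* is made of a regular pentagon $\Pi$ with a horizontal bottom side and diagonals of length $1$, and of $-\Pi$, with parallel sides identified. Trajectories are straight and bi-infinite and meet no vertex. The combinatorial period of a periodic trajectory on the double pentagon is the number of sides it crosses in one period; for a billiard trajectory in the table $\Pi$ it is the number of bounces before it returns to its starting point with its starting direction. Put $$P=\begin{pmatrix}1&\cos(\pi/5)\\0&\sin(\pi/5)\end{pmatrix},\quad \sigma_0=\begin{pmatrix}1&\phi\\0&1\end{pmatrix},\ \sigma_1=\begin{pmatrix}\phi&\phi\\1&\phi\end{pmatrix},\ \sigma_2=\begin{pmatrix}\phi&1\\\phi&\phi\end{pmatrix},\ \sigma_3=\begin{pmatrix}1&0\\\phi&1\end{pmatrix}.$$ A trajectory of the double pentagon in a given direction is *short* (*long*) if it is periodic and has least (greatest) length among the periodic trajectories in this direction; it is a *core* trajectory if it passes through the midpoint of a side. The billiard trajectory associated with a double pentagon trajectory that starts on the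 boundary of $\Pi$ and enters $\Pi$ is the billiard trajectory in $\Pi$ with the same initial point and direction (it is obtained by folding at each side crossed). Consider the graph with nodes $A,B,C,D,E,F$ in which, for $i=0,1,2,3$, the arrows labelled $\sigma_i$ lead from $A,B,C,D,E,F$ (in this order) to $\sigma_0: B,C,D,E,A,F$; $\ \sigma_1: B,D,F,A,C,E$; $\ \sigma_2: B,F,E,C,D,A$; $\ \sigma_3: B,E,A,D,F,C$. **Theorem.** Let $w=(w_1,w_2)$ with $w_1>0$, $w_2\ge0$ be the direction of a periodic trajectory on the golden L. Then there is a longest saddle connection vector $\mathbf v$ of the golden L that is a positive multiple of $w$ (the *long saddle connection vector*); $\mathbf v=[a+b\phi,\,c+d\phi]$ for some $a,b,c,d\in\mathbb N=\{0,1,2,\dots\}$, and there is a unique word $k_1k_2\cdots k_n$ in $\{0,1,2,3\}$ (the *tree word*; possibly empty) that does not start with $0$ and satisfies $\mathbf v=\sigma_{k_n}\cdots\sigma_{k_2}\sigma_{k_1}[1,0]$. On the double pentagon, every trajectory in direction $P\mathbf v$ is periodic, and either short or long; short and long core trajectories that pass through $\Pi$ exist. Moreover: 1. Every short trajectory in direction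 $P\mathbf v$ has combinatorial period $2(a+b+c+d)$ and every long one has combinatorial period $2(a+2b+c+2d)$. 2. Every short trajectory in direction $P\mathbf v$ has Euclidean length $|P\mathbf v|$ and every long one has Euclidean length $\phi|P\mathbf v|$. Start at the node $A$ and follow backwards the arrows labelled $\sigma_{k_n},\dots,\sigma_{k_2},\sigma_{k_1}$, in this order. Let $\tau$ be a trajectory of the double pentagon in direction $P\mathbf v$, short or long, that enters $\Pi$ at its initial point. Then the associated billiard trajectory $\beta$ exists, and: 3. If the end node is $A$, $B$, $C$, $D$ or $E$, the path traced by $\beta$ is invariant under the rotations of the pentagon, and under its full symmetry group $D_5$ if $\tau$ is a core trajectory. The combinatorial period and the Euclidean length of $\beta$ are five times those of $\tau$, except that they are $2.5$ times those of $\tau$ if $\tau$ is a core trajectory and $P\mathbf v$ is parallel to a side of the table. 4. If the end node is $F$, the path traced by $\beta$ is invariant under no rotation of the pentagon except the identity; if $\tau$ is a core trajectory, then its only symmetries in $D_5$ are the identity and one reflection. The combinatorial period and the Euclidean length of $\beta$ are the same as those of $\tau$. -/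

import Mathlib

open Matrix

noncomputable section

namespace PentBilliard

/-! ### Translation surfaces glued from convex polygons, and straight-line trajectories -/

/-- Finitely many polygons in the plane `ℂ`, each with `n` sides, listed by their vertices in
counterclockwise order.  Side `i` of the polygon `f` runs from `vertex f i` to `vertex f (i + 1)`
(cyclically).  The sides are glued in pairs by translations: a side is glued to a parallel side of
the same length that runs in the opposite sense along the boundary. -/
structure GluedPolygons (F : Type) (n : ℕ) [NeZero n] where
  vertex : F → Fin n → ℂ
  glue : F × Fin n → F × Fin n
  glue_glue : ∀ e, glue (glue e) = e
  side_vector : ∀ e, vertex (glue e).1 ((glue e).2 + 1) - vertex (glue e).1 (glue e).2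
    = -(vertex e.1 (e.2 + 1) - vertex e.1 e.2)

namespace GluedPolygons

variable {F : Type} {n : ℕ} [NeZero n]

/-- The open side `i` of the polygon `f` (without its endpoints, the vertices). -/
def side (X : GluedPolygons F n) (e : F × Fin n) : Set ℂ :=
  openSegment ℝ (X.vertex e.1 e.2) (X.vertex e.1 (e.2 + 1))

/-- The translation that carries the side `e` onto the side it is glued to. -/
def shift (X : GluedPolygons F n) (e : F × Fin n) : ℂ :=
  X.vertex (X.glue e).1 (X.glue e).2 - X.vertex e.1 (e.2 + 1)

/-- A bi-infinite trajectory in direction `θ` that meets no vertex.  At its `k`-th step it enters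
the convex polygon `face k` at the point `pt k` of the open side `sideIn k`, crosses the polygon
along the segment from `pt k` to `pt k + time k • θ`, leaves through a different open side
`sideOut k`, and goes on from the corresponding point of the side glued to `sideOut k`. -/
structure Trajectory (X : GluedPolygons F n) (θ : ℂ) where
  face : ℤ → F
  sideIn : ℤ → Fin n
  sideOut : ℤ → Fin n
  pt : ℤ → ℂ
  time : ℤ → ℝ
  pt_mem : ∀ k, pt k ∈ X.side (face k, sideIn k)
  time_pos : ∀ k, 0 < time k
  side_ne : ∀ k, sideOut k ≠ sideIn k
  exit_mem : ∀ k, pt k + time k • θ ∈ X.side (face k, sideOut k)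
  next_side : ∀ k, (face (k + 1), sideIn (k + 1)) = X.glue (face k, sideOut k)
  next_pt : ∀ k, pt (k + 1) = pt k + time k • θ + X.shift (face k, sideOut k)

namespace Trajectory

variable {X : GluedPolygons F n} {θ : ℂ}

/-- `N` is the combinatorial period: the number of sides crossed before the trajectory first
returns to its starting point on the surface. -/
def HasCombPeriod (τ : X.Trajectory θ) (N : ℕ) : Prop :=
  IsLeast {p : ℕ | 0 < p ∧ ∀ k : ℤ, τ.face (k + p) = τ.face k ∧ τ.pt (k + p) = τ.pt k} N

def IsPeriodic (τ : X.Trajectory θ) : Prop := ∃ N, τ.HasCombPeriod N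

/-- The trajectory is periodic and `ℓ` is the Euclidean length of one period. -/
def HasLength (τ : X.Trajectory θ) (ℓ : ℝ) : Prop :=
  ∃ N, τ.HasCombPeriod N ∧ ℓ = ∑ k ∈ Finset.range N, τ.time k * ‖θ‖

/-- The trajectory is periodic, and of least length among the periodic trajectories in its
direction: it lies in a short cylinder. -/
def IsShort (τ : X.Trajectory θ) : Prop :=
  ∃ ℓ, τ.HasLength ℓ ∧ ∀ (τ' : X.Trajectory θ) (ℓ' : ℝ), τ'.HasLength ℓ' → ℓ ≤ ℓ'

/-- The trajectory is periodic, and of greatest length among the periodic trajectories in its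
direction: it lies in a long cylinder. -/
def IsLong (τ : X.Trajectory θ) : Prop :=
  ∃ ℓ, τ.HasLength ℓ ∧ ∀ (τ' : X.Trajectory θ) (ℓ' : ℝ), τ'.HasLength ℓ' → ℓ' ≤ ℓ

/-- The trajectory passes through the midpoint of a side.  On the double pentagon these are the
core curves of the cylinders. -/
def ThroughMidpoint (τ : X.Trajectory θ) : Prop :=
  ∃ k, τ.pt k = midpoint ℝ (X.vertex (τ.face k) (τ.sideIn k))
    (X.vertex (τ.face k) (τ.sideIn k + 1))

end Trajectory

/-- `θ` is the direction of a periodic trajectory. -/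
def IsPeriodicDirection (X : GluedPolygons F n) (θ : ℂ) : Prop :=
  ∃ τ : X.Trajectory θ, τ.IsPeriodic

/-- `v` is the holonomy vector of a straight segment on the surface that starts at a vertex, ends at
a vertex and meets no vertex in between.  The segment is cut into `m + 1` pieces, the `k`-th one
in the polygon `f k`, starting at `x k` and ending at `x k + t k • v`. (On the golden L all
vertices are identified to one cone point, of angle `6π`, so that these are exactly its saddle
connection vectors.) -/
def IsSaddleVector (X : GluedPolygons F n) (v : ℂ) : Prop :=
  v ≠ 0 ∧ ∃ (m : ℕ) (f : ℕ → F) (x : ℕ → ℂ) (t : ℕ → ℝ),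
    (∃ i, x 0 = X.vertex (f 0) i) ∧
    (∀ k ≤ m, 0 < t k) ∧
    (∀ k < m, ∃ i, x k + t k • v ∈ X.side (f k, i) ∧ f (k + 1) = (X.glue (f k, i)).1 ∧
      x (k + 1) = x k + t k • v + X.shift (f k, i)) ∧
    (∃ j, x m + t m • v = X.vertex (f m) j) ∧
    ∑ k ∈ Finset.range (m + 1), t k = 1

/-- `v` is the long saddle connection vector in the direction of `w`. -/
def IsLongSaddleVector (X : GluedPolygons F n) (w v : ℂ) : Prop :=
  X.IsSaddleVector v ∧ (∃ r : ℝ, 0 < r ∧ v = r • w) ∧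
    ∀ v', X.IsSaddleVector v' → (∃ r : ℝ, 0 < r ∧ v' = r • w) → ‖v'‖ ≤ ‖v‖

end GluedPolygons

/-! ### The golden L -/

/-- The corners of the unit square (`0`), of the rectangle `[1, φ] × [0, 1]` to its right (`1`)
and of the rectangle `[0, 1] × [1, φ]` on top of it (`2`); their thickness is `φ - 1 = 1/φ`.
Sides are numbered bottom, right, top, left. -/
def goldenLVertex : Fin 3 → Fin 4 → ℂ :=
  ![![⟨0, 0⟩, ⟨1, 0⟩, ⟨1, 1⟩, ⟨0, 1⟩],
    ![⟨1, 0⟩, ⟨Real.goldenRatio, 0⟩, ⟨Real.goldenRatio, 1⟩, ⟨1, 1⟩],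
    ![⟨0, 1⟩, ⟨1, 1⟩, ⟨1, Real.goldenRatio⟩, ⟨0, Real.goldenRatio⟩]]

def goldenLGlue : Fin 3 → Fin 4 → Fin 3 × Fin 4 :=
  ![![(2, 2), (1, 3), (2, 0), (1, 1)],
    ![(1, 2), (0, 3), (1, 0), (0, 1)],
    ![(0, 2), (2, 3), (0, 0), (2, 1)]]

/-- The golden L: the square and the two rectangles form an L, and parallel opposite sides of
the L are identified. -/
def goldenL : GluedPolygons (Fin 3) 4 where
  vertex := goldenLVertex
  glue e := goldenLGlue e.1 e.2
  glue_glue := by decide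
  side_vector := by
    rintro ⟨f, i⟩
    fin_cases f <;> fin_cases i <;> simp [goldenLVertex, goldenLGlue, Complex.ext_iff]

/-! ### The regular pentagon and the double pentagon -/

/-- The vertices of the regular pentagon, counterclockwise, centred at the origin, with a
horizontal bottom side and with diagonals of length `1`. -/
def pent (k : Fin 5) : ℂ :=
  ((2 * Real.sin (2 * Real.pi / 5))⁻¹ : ℝ) * Complex.I *
    Complex.exp (2 * Real.pi * Complex.I / 5) ^ (k : ℕ)

/-- The double pentagon: the pentagon (face `0`) and its image under `z ↦ -z` (face `1`), each side
of one being identified with the parallel side of the other. -/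
def doublePentagon : GluedPolygons (Fin 2) 5 where
  vertex f k := if f = 0 then pent k else -pent k
  glue e := (e.1 + 1, e.2)
  glue_glue := by decide
  side_vector := by
    rintro ⟨f, i⟩
    fin_cases f <;> simp <;> ring

/-! ### Billiards in the regular pentagon -/

/-- The open side `i` of the table. -/
def pentSide (i : Fin 5) : Set ℂ := openSegment ℝ (pent i) (pent (i + 1))

/-- Reflection of a direction in the line spanned by `e`. -/
def reflectDir (e u : ℂ) : ℂ := e / starRingEnd ℂ e * starRingEnd ℂ u

/-- A bi-infinite billiard trajectory in the pentagon that meets no vertex: `pt k` is the `k`-th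
bounce, on the open side `side k`, and `dir k` is the direction after this bounce. -/
structure BilliardTrajectory where
  side : ℤ → Fin 5
  pt : ℤ → ℂ
  dir : ℤ → ℂ
  time : ℤ → ℝ
  pt_mem : ∀ k, pt k ∈ pentSide (side k)
  time_pos : ∀ k, 0 < time k
  side_ne : ∀ k, side (k + 1) ≠ side k
  next_pt : ∀ k, pt (k + 1) = pt k + time k • dir k
  next_dir : ∀ k, dir (k + 1) =
    reflectDir (pent (side (k + 1) + 1) - pent (side (k + 1))) (dir k)

namespace BilliardTrajectory

/-- `N` is the combinatorial period: the number of bounces before the trajectory first returns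
to its starting point in its starting direction. -/
def HasCombPeriod (β : BilliardTrajectory) (N : ℕ) : Prop :=
  IsLeast {p : ℕ | 0 < p ∧ ∀ k : ℤ, β.pt (k + p) = β.pt k ∧ β.dir (k + p) = β.dir k} N

/-- The trajectory is periodic and `ℓ` is the Euclidean length of one period. -/
def HasLength (β : BilliardTrajectory) (ℓ : ℝ) : Prop :=
  ∃ N, β.HasCombPeriod N ∧ ℓ = ∑ k ∈ Finset.range N, β.time k * ‖β.dir k‖

/-- The subset of the table traced out by the trajectory. -/
def trace (β : BilliardTrajectory) : Set ℂ := ⋃ k : ℤ, segment ℝ (β.pt k) (β.pt (k + 1))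

end BilliardTrajectory

/-- `β` is the billiard trajectory associated with a double pentagon trajectory `τ` that is in
face `0` at step `0`.  Face `0` is the table; folding `τ` along each side that it crosses turns it
into the billiard trajectory with the same initial point, initial side and initial direction. -/
def IsAssociated {θ : ℂ} (τ : doublePentagon.Trajectory θ) (β : BilliardTrajectory) : Prop :=
  τ.face 0 = 0 ∧ β.pt 0 = τ.pt 0 ∧ β.side 0 = τ.sideIn 0 ∧ β.dir 0 = θ

/-- `θ` is parallel to a side of the table. -/
def ParallelToSide (θ : ℂ) : Prop := ∃ (i : Fin 5) (r : ℝ), θ = r • (pent (i + 1) - pent i)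

/-- The symmetries of the pentagon: `r k` is the rotation by `2πk/5`, and `sr k` is that rotation
followed by the reflection `x + iy ↦ -x + iy`. -/
def d5 : DihedralGroup 5 → ℂ → ℂ
  | .r k, z => Complex.exp (2 * Real.pi * Complex.I / 5) ^ k.val * z
  | .sr k, z => -starRingEnd ℂ (Complex.exp (2 * Real.pi * Complex.I / 5) ^ k.val * z)

/-- `S` has the full symmetry of the pentagon. -/
def FullSymmetry (S : Set ℂ) : Prop := ∀ g, d5 g '' S = S

/-- The rotations of the pentagon preserve `S`. -/
def RotationSymmetry (S : Set ℂ) : Prop := ∀ k, d5 (.r k) '' S = S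

/-- No rotation of the pentagon except the identity preserves `S`. -/
def NoRotationSymmetry (S : Set ℂ) : Prop := ∀ k, d5 (.r k) '' S = S → k = 0

/-- The only symmetries of the pentagon that preserve `S` are the identity and one reflection. -/
def OnlyBilateralSymmetry (S : Set ℂ) : Prop :=
  ∃ k, ∀ g, d5 g '' S = S ↔ g = 1 ∨ g = .sr k

/-! ### Vectors, matrices, tree words and the six-node graph -/

/-- The vector `[x, y]` as the point `x + iy` of the Euclidean plane. -/
def toPlane (v : Fin 2 → ℝ) : ℂ := ⟨v 0, v 1⟩

/-- The linear map that takes the golden L to the double pentagon. -/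
def P : Matrix (Fin 2) (Fin 2) ℝ :=
  !![1, Real.cos (Real.pi / 5); 0, Real.sin (Real.pi / 5)]

def sigma : Fin 4 → Matrix (Fin 2) (Fin 2) ℝ :=
  ![!![1, Real.goldenRatio; 0, 1],
    !![Real.goldenRatio, Real.goldenRatio; 1, Real.goldenRatio],
    !![Real.goldenRatio, 1; Real.goldenRatio, Real.goldenRatio],
    !![1, 0; Real.goldenRatio, 1]]

/-- The tree word `k₁ k₂ … kₙ` (in the order of application) of `v`:
`v = σ_{kₙ} ⋯ σ_{k₂} σ_{k₁} [1, 0]`, and the word does not start with `0`. -/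
def IsTreeWord (u : List (Fin 4)) (v : Fin 2 → ℝ) : Prop :=
  u.head? ≠ some 0 ∧ v = u.foldl (fun x k => sigma k *ᵥ x) ![1, 0]

/-- The six nodes of the graph. -/
inductive Node
  | A | B | C | D | E | F
  deriving DecidableEq

open Node in
/-- The arrow of the graph with label `σ_i` that starts at a given node leads to this node. -/
def arrow : Fin 4 → Node → Node
  | 0, A => B | 0, B => C | 0, C => D | 0, D => E | 0, E => A | 0, F => F
  | 1, A => B | 1, B => D | 1, C => F | 1, D => A | 1, E => C | 1, F => E
  | 2, A => B | 2, B => F | 2, C => E | 2, D => C | 2, E => D | 2, F => A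
  | 3, A => B | 3, B => E | 3, C => A | 3, D => D | 3, E => F | 3, F => C

open Node in
/-- Following the arrow with label `σ_i` that ends at a given node backwards. -/
def back : Fin 4 → Node → Node
  | 0, A => E | 0, B => A | 0, C => B | 0, D => C | 0, E => D | 0, F => F
  | 1, A => D | 1, B => A | 1, C => E | 1, D => B | 1, E => F | 1, F => C
  | 2, A => F | 2, B => A | 2, C => D | 2, D => E | 2, E => C | 2, F => B
  | 3, A => C | 3, B => A | 3, C => F | 3, D => D | 3, E => B | 3, F => E

theorem arrow_eq_iff (i : Fin 4) (X Y : Node) : arrow i X = Y ↔ X = back i Y := by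
  fin_cases i <;> cases X <;> cases Y <;> decide

/-- Start at `A` and follow the arrows backwards, according to the tree word read backwards. -/
def endNode (u : List (Fin 4)) : Node := u.foldr back .A

end PentBilliard

end

open PentBilliard

noncomputable section

namespace PentBilliard

/-! The proof combines a Euclidean algorithm on the golden L, a transfer of flow lines to the double
pentagon, and a turning number in ℤ/5 that governs folding into the table.

Euclidean algorithm. Each `σ_k` has determinant 1 and is the derivative of an affine automorphism of
the golden L, and the four images of the quadrant tile the quadrant (`exists_sector`,
`sector_unique`). A flow line is coded by its crossings with the antidiagonals of the three
rectangles. The map `emb k` carries states for the direction (x, y) to states for `σ_k (x, y)`. One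
step becomes a nonempty path, and its displacement is transformed by `σ_k` up to a coboundary that
cancels around closed paths (`step_lift`). Every infinite flow line in the new direction meets the
image of `emb k`. A finite set of states closed under a non-horizontal flow is never contained in
that image (`Flows.exists_emb`, `Flows.exists_not_emb`). Undoing `σ_k` therefore strictly decreases
the number of states, and a periodic direction descends to the horizontal one. The letters met on
the way form the tree word (`exists_word_of_flows`).

In the horizontal direction closed lines have displacement 1 or φ. Lifting along the word gives v or
φv (`Flows.exists_closed`), together with lines invariant under the hyperelliptic involution
(`exists_core`). Saddle connections lift and descend in the same way, and those in the direction of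
a nonempty tree word are v and (φ - 1)v, so v is the long one (`saddle_vec`).

Double pentagon. The matrix P takes the L to the double pentagon after cutting and pasting.
Combinatorially, `rep` sends steps to paths (`step_dPath`), and every flow line of the double
pentagon passes through states coming from the L. Hence it closes with holonomy v or φv. This is the
primitive period: a q-th part of the holonomy would lie in ℤ[φ]², the matrices are invertible over
ℤ[φ] and φ is a unit, so 1/q would lie in ℤ[φ]. The four integer coordinates of the holonomy, with
the equality of the numbers of entries into the two faces, determine how often each side is crossed
(`DSeq.exists_period`). This yields the combinatorial periods, and the lengths are those of v and
φv.

Folding. A billiard trajectory is the trajectory on the surface, folded, and each step carries a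
rotation r in ℤ/5 (`IsFolding`). The rotation r N gathered over one period is linear in the crossing
numbers. It is a nonzero multiple of (a + 3b) - (c + 3d) (`counts_of_holonomy`), which is the form p
- q applied to the reduction of v modulo √5, where φ becomes 3. The six nodes are the points of the
projective line of linear forms on 𝔽₅², going back along `σ_k` is composition with `σ_k`, A is p -
q, and F is the form that kills [1, 0]. So the end node is F exactly when r N = 0 (`exists_coef`,
`endNode_eq_F_iff`).

If r N ≠ 0, shifting by multiples of N realises all rotations, and five periods are needed to close
up. If r N = 0, one period suffices, and a rotation preserving the path is shown to be trivial
(`IsFolding.noRotationSymmetry`). A billiard path can close after an odd number of bounces only in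
the horizontal direction and only for core trajectories, which is the factor 2.5
(`IsFolding.horizontal_core`). Core trajectories are those fixed by the involution, and folding
turns the involution into a reflection of the path (`IsFolding.exists_reflection`). -/

/-! ### The golden ratio -/

/-- The golden ratio. -/
def φ : ℝ := Real.goldenRatio

theorem φ_mul_self : φ * φ = φ + 1 := by
  have := Real.goldenRatio_sq
  unfold φ; linarith [sq Real.goldenRatio]

theorem one_lt_φ : 1 < φ := Real.one_lt_goldenRatio

theorem φ_lt : φ < 1.7 := by
  nlinarith [φ_mul_self, one_lt_φ]

theorem lt_φ : 1.6 < φ := by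
  nlinarith [φ_mul_self, one_lt_φ]

/-- With these facts for both coordinates of a direction, `φ * x` and `φ * φ * x` can be treated as
atoms, and comparisons of transverse distances become tasks for `linarith`. -/
theorem φ_mul_facts {x : ℝ} (hx : 0 ≤ x) :
    φ * φ * x = φ * x + x ∧ 1.6 * x ≤ φ * x ∧ φ * x ≤ 1.7 * x := by
  refine ⟨by rw [φ_mul_self]; ring, ?_, ?_⟩
  · exact mul_le_mul_of_nonneg_right lt_φ.le hx
  · exact mul_le_mul_of_nonneg_right φ_lt.le hx

/-! ### The flow on the golden L, seen from the antidiagonals of its rectangles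

The state `(f, s)` is a flow line in direction `(x, y)` crossing the rectangle `f`, at transverse
distance `s` from the upper left corner of `f`. -/

/-- The three rectangles of the golden L: the square, the right and the top one. -/
inductive Rect
  | o | r | t

open Rect

/-- Width of a rectangle. -/
def Rect.wd : Rect → ℝ
  | o => 1 | r => φ - 1 | t => 1

/-- Height of a rectangle. -/
def Rect.ht : Rect → ℝ
  | o => 1 | r => 1 | t => φ - 1

/-- Transverse width of a rectangle in direction `(x, y)`. -/
def Rect.len (x y : ℝ) (f : Rect) : ℝ := f.wd * y + f.ht * x

/-- The flow in direction `(x, y)` passes from one rectangle to the next one; the last two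
arguments are the displacement of the lower left corner. -/
inductive Step (x y : ℝ) : Rect × ℝ → Rect × ℝ → ℝ → ℝ → Prop
  | u_o {s s'} : 0 < s → s < y → s' = s + (φ - 1) * x → Step x y (o, s) (t, s') 0 1
  | r_o {s s'} : y < s → s < x + y → s' = s - y → Step x y (o, s) (r, s') 1 0
  | u_r {s s'} : 0 < s → s < (φ - 1) * y → s' = s + x → Step x y (r, s) (r, s') 0 1
  | r_r {s s'} : (φ - 1) * y < s → s < x + (φ - 1) * y → s' = s - (φ - 1) * y →
      Step x y (r, s) (o, s') (φ - 1) 0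
  | u_t {s s'} : 0 < s → s < y → s' = s + x → Step x y (t, s) (o, s') 0 (φ - 1)
  | r_t {s s'} : y < s → s < (φ - 1) * x + y → s' = s - y → Step x y (t, s) (t, s') 1 0

theorem Step.det {x y p q a b q' a' b'} (h : Step x y p q a b) (h' : Step x y p q' a' b') :
    q = q' ∧ a = a' ∧ b = b' := by
  cases h <;> cases h' <;> first
    | (exfalso; linarith)
    | (subst_vars; exact ⟨rfl, rfl, rfl⟩)

/-- A piece of a flow line with `n` steps, and its total displacement. -/
inductive Path (x y : ℝ) : ℕ → Rect × ℝ → Rect × ℝ → ℝ → ℝ → Prop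
  | nil (p) : Path x y 0 p p 0 0
  | cons {n p q r a b c d} : Step x y p q a b → Path x y n q r c d →
      Path x y (n + 1) p r (a + c) (b + d)

theorem Path.cast {x y n p f s a b s' a' b'} (h : Path x y n p (f, s) a b) (hs : s = s')
    (ha : a = a') (hb : b = b') : Path x y n p (f, s') a' b' := by
  subst hs ha hb; exact h

theorem Path.disp {x y n p q a b a' b'} (h : Path x y n p q a b)
    (ha : a = a') (hb : b = b') : Path x y n p q a' b' := by
  subst ha hb; exact h

theorem Path.trans {x y n p q a b m r c d} (h : Path x y n p q a b) (h' : Path x y m q r c d) :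
    Path x y (n + m) p r (a + c) (b + d) := by
  induction h with
  | nil p => simpa using h'
  | @cons n p q r' a b c' d' hs _ ih =>
    have := Path.cons hs (ih h')
    rw [show n + 1 + m = n + m + 1 by ring]
    exact this.disp (by ring) (by ring)

/-- A state from which the flow does not go on. -/
def Dead (x y : ℝ) (p : Rect × ℝ) : Prop := ∀ q a b, ¬ Step x y p q a b

/-- The flow is deterministic, so the path to `q` is an initial piece of the path to `r`; it cannot
be longer, because the flow stops at `r`. -/
theorem Path.split {x y m p q a b n r c d} (h : Path x y m p q a b) (h' : Path x y n p r c d)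
    (hr : Dead x y r) : m ≤ n ∧ Path x y (n - m) q r (c - a) (d - b) := by
  induction h generalizing n c d with
  | nil p => simpa using h'
  | cons hs _ ih =>
    cases h' with
    | nil => exact absurd hs (hr _ _ _)
    | cons hs' h'' =>
      obtain ⟨rfl, rfl, rfl⟩ := hs.det hs'
      obtain ⟨h1, h2⟩ := ih h''
      refine ⟨by omega, ?_⟩
      rw [Nat.add_sub_add_right]
      exact h2.disp (by ring) (by ring)

/-- A set of states in which the flow goes on for ever. -/
def Flows (x y : ℝ) (O : Set (Rect × ℝ)) : Prop := ∀ p ∈ O, ∃ q ∈ O, ∃ a b, Step x y p q a b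

theorem Flows.mem_of_path {x y O} (hO : Flows x y O) {n p q a b} (h : Path x y n p q a b)
    (hp : p ∈ O) : q ∈ O := by
  induction h with
  | nil => exact hp
  | cons hs _ ih =>
    obtain ⟨q', hq', a', b', hs'⟩ := hO _ hp
    obtain ⟨rfl, -, -⟩ := hs.det hs'
    exact ih hq'

/-- The state in which a flow line leaves the lower left corner of `f`. -/
def start (x _y : ℝ) (f : Rect) : Rect × ℝ := (f, f.ht * x)

/-- The state in which a flow line runs into the upper right corner of `f`. -/
def final (_x y : ℝ) (f : Rect) : Rect × ℝ := (f, f.wd * y)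

/-- The inequalities in `Step` are strict: at distance exactly `wd * y` the line runs into the upper
right corner instead of leaving through the top or the right side. -/
theorem dead_final (x y : ℝ) (f : Rect) : Dead x y (final x y f) := by
  intro q a b h
  cases f <;> simp only [final, Rect.wd] at h <;> cases h <;> linarith

/-- The hyperelliptic involution. -/
def invol (x y : ℝ) (p : Rect × ℝ) : Rect × ℝ := (p.1, p.1.len x y - p.2)

/-- A flow line that crosses the interior of a rectangle. -/
def Valid (x y : ℝ) (p : Rect × ℝ) : Prop := 0 < p.2 ∧ p.2 < p.1.len x y

theorem Step.valid {x y p q a b} (hx : 0 < x) (hy : 0 ≤ y) (h : Step x y p q a b) :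
    Valid x y p ∧ Valid x y q := by
  obtain ⟨h1, h2, h3⟩ := φ_mul_facts hx.le
  obtain ⟨h4, h5, h6⟩ := φ_mul_facts hy
  cases h <;> simp only [Valid, Rect.len, Rect.wd, Rect.ht] <;> subst_vars <;>
    refine ⟨⟨?_, ?_⟩, ?_, ?_⟩ <;> linarith

theorem Valid.step_or_final {x y p} (h : Valid x y p) :
    (∃ q a b, Step x y p q a b) ∨ p = final x y p.1 := by
  obtain ⟨f, s⟩ := p
  obtain ⟨h1, h2⟩ := h
  simp only [Rect.len] at h1 h2
  rcases lt_trichotomy s (f.wd * y) with h3 | h3 | h3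
  · left
    cases f <;> simp only [Rect.wd, Rect.ht] at h1 h2 h3
    · exact ⟨_, _, _, .u_o h1 (by linarith) rfl⟩
    · exact ⟨_, _, _, .u_r h1 (by linarith) rfl⟩
    · exact ⟨_, _, _, .u_t h1 (by linarith) rfl⟩
  · right; simp [final, h3]
  · left
    cases f <;> simp only [Rect.wd, Rect.ht] at h1 h2 h3
    · exact ⟨_, _, _, .r_o (by linarith) (by linarith) rfl⟩
    · exact ⟨_, _, _, .r_r (by linarith) (by linarith) rfl⟩
    · exact ⟨_, _, _, .r_t (by linarith) (by linarith) rfl⟩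

/-! ### Renormalization -/

/-- First coordinate of `σ_k (x, y)`. -/
def sx (k : Fin 4) (x y : ℝ) : ℝ := ![x + φ * y, φ * x + φ * y, φ * x + y, x] k

/-- Second coordinate of `σ_k (x, y)`. -/
def sy (k : Fin 4) (x y : ℝ) : ℝ := ![y, x + φ * y, φ * x + φ * y, φ * x + y] k

/-- The flow in direction `(x, y)` embeds into the flow in direction `σ_k (x, y)`. -/
def emb (k : Fin 4) (x y : ℝ) : Rect × ℝ → Rect × ℝ
  | (o, s) => ![(o, s), (t, s), (r, φ * x + y + s), (o, φ * x + s)] k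
  | (r, s) => ![(r, s), (r, (φ - 1) * x + y + s), (t, s), (r, x + s)] k
  | (t, s) => ![(t, s), (r, φ * x + φ * y + s), (t, x + (φ - 1) * y + s), (t, φ * x + s)] k

/-- Position of the lower left corners, first coordinate. -/
def ox (k : Fin 4) : Rect → ℝ
  | o => 0
  | r => ![0, 1 - φ, 0, 0] k
  | t => ![1 - φ, 1 - φ, φ - 2, 0] k

/-- Position of the lower left corners, second coordinate. -/
def oy (k : Fin 4) : Rect → ℝ
  | o => 0
  | r => ![0, φ - 2, 1 - φ, 1 - φ] k
  | t => ![0, 0, 1 - φ, 0] k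

theorem sx_pos {k : Fin 4} {x y : ℝ} (hx : 0 < x) (hy : 0 ≤ y) : 0 < sx k x y := by
  have := one_lt_φ
  fin_cases k <;> simp [sx] <;> positivity

theorem sy_nonneg {k : Fin 4} {x y : ℝ} (hx : 0 < x) (hy : 0 ≤ y) : 0 ≤ sy k x y := by
  have := one_lt_φ
  fin_cases k <;> simp [sy] <;> positivity

/-! ### Lifting single steps along each of the four matrices -/

/-- The affine automorphism moves the antidiagonals to transversals which, slid along the flow,
become pieces of antidiagonals; as the determinant is 1, the coordinate `s` is only translated. The
six kinds of steps are followed one by one. The correction by `ox` and `oy` is a coboundary, so it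
telescopes along paths, and `n + 1` records that a lifted step is never empty. The other three
letters are treated alike. -/
theorem step_lift_0 {x y p q a b} (hx : 0 < x) (hy : 0 ≤ y) (h : Step x y p q a b) :
    ∃ n, Path (sx 0 x y) (sy 0 x y) (n + 1) (emb 0 x y p) (emb 0 x y q)
      (sx 0 a b + ox 0 q.1 - ox 0 p.1) (sy 0 a b + oy 0 q.1 - oy 0 p.1) := by
  obtain ⟨h1, h2, h3⟩ := φ_mul_facts hx.le
  obtain ⟨h4, h5, h6⟩ := φ_mul_facts hy
  have h7 := φ_mul_self
  cases h <;> simp [sx, sy, emb, ox, oy] <;> subst_vars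
  · exact ⟨1, Path.cast (.cons (.u_o (by linarith) (by linarith) rfl) (.cons (.r_t (by linarith) (by linarith) rfl) (Path.nil _))) (by linarith) (by linarith) (by linarith)⟩
  · exact ⟨0, Path.cast (.cons (.r_o (by linarith) (by linarith) rfl) (Path.nil _)) (by linarith) (by linarith) (by linarith)⟩
  · exact ⟨2, Path.cast (.cons (.u_r (by linarith) (by linarith) rfl) (.cons (.r_r (by linarith) (by linarith) rfl) (.cons (.r_o (by linarith) (by linarith) rfl) (Path.nil _)))) (by linarith) (by linarith) (by linarith)⟩
  · exact ⟨0, Path.cast (.cons (.r_r (by linarith) (by linarith) rfl) (Path.nil _)) (by linarith) (by linarith) (by linarith)⟩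
  · exact ⟨2, Path.cast (.cons (.u_t (by linarith) (by linarith) rfl) (.cons (.r_o (by linarith) (by linarith) rfl) (.cons (.r_r (by linarith) (by linarith) rfl) (Path.nil _)))) (by linarith) (by linarith) (by linarith)⟩
  · exact ⟨0, Path.cast (.cons (.r_t (by linarith) (by linarith) rfl) (Path.nil _)) (by linarith) (by linarith) (by linarith)⟩

theorem step_lift_1 {x y p q a b} (hx : 0 < x) (hy : 0 ≤ y) (h : Step x y p q a b) :
    ∃ n, Path (sx 1 x y) (sy 1 x y) (n + 1) (emb 1 x y p) (emb 1 x y q)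
      (sx 1 a b + ox 1 q.1 - ox 1 p.1) (sy 1 a b + oy 1 q.1 - oy 1 p.1) := by
  obtain ⟨h1, h2, h3⟩ := φ_mul_facts hx.le
  obtain ⟨h4, h5, h6⟩ := φ_mul_facts hy
  have h7 := φ_mul_self
  cases h <;> simp [sx, sy, emb, ox, oy] <;> subst_vars
  · exact ⟨2, Path.cast (.cons (.u_t (by linarith) (by linarith) rfl) (.cons (.r_o (by linarith) (by linarith) rfl) (.cons (.u_r (by linarith) (by linarith) rfl) (Path.nil _)))) (by linarith) (by linarith) (by linarith)⟩
  · exact ⟨1, Path.cast (.cons (.u_t (by linarith) (by linarith) rfl) (.cons (.r_o (by linarith) (by linarith) rfl) (Path.nil _))) (by linarith) (by linarith) (by linarith)⟩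
  · exact ⟨3, Path.cast (.cons (.r_r (by linarith) (by linarith) rfl) (.cons (.u_o (by linarith) (by linarith) rfl) (.cons (.u_t (by linarith) (by linarith) rfl) (.cons (.r_o (by linarith) (by linarith) rfl) (Path.nil _))))) (by linarith) (by linarith) (by linarith)⟩
  · exact ⟨2, Path.cast (.cons (.r_r (by linarith) (by linarith) rfl) (.cons (.u_o (by linarith) (by linarith) rfl) (.cons (.r_t (by linarith) (by linarith) rfl) (Path.nil _)))) (by linarith) (by linarith) (by linarith)⟩
  · exact ⟨2, Path.cast (.cons (.r_r (by linarith) (by linarith) rfl) (.cons (.u_o (by linarith) (by linarith) rfl) (.cons (.r_t (by linarith) (by linarith) rfl) (Path.nil _)))) (by linarith) (by linarith) (by linarith)⟩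
  · exact ⟨2, Path.cast (.cons (.r_r (by linarith) (by linarith) rfl) (.cons (.r_o (by linarith) (by linarith) rfl) (.cons (.u_r (by linarith) (by linarith) rfl) (Path.nil _)))) (by linarith) (by linarith) (by linarith)⟩

theorem step_lift_2 {x y p q a b} (hx : 0 < x) (hy : 0 ≤ y) (h : Step x y p q a b) :
    ∃ n, Path (sx 2 x y) (sy 2 x y) (n + 1) (emb 2 x y p) (emb 2 x y q)
      (sx 2 a b + ox 2 q.1 - ox 2 p.1) (sy 2 a b + oy 2 q.1 - oy 2 p.1) := by
  obtain ⟨h1, h2, h3⟩ := φ_mul_facts hx.le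
  obtain ⟨h4, h5, h6⟩ := φ_mul_facts hy
  have h7 := φ_mul_self
  cases h <;> simp [sx, sy, emb, ox, oy] <;> subst_vars
  · exact ⟨1, Path.cast (.cons (.r_r (by linarith) (by linarith) rfl) (.cons (.u_o (by linarith) (by linarith) rfl) (Path.nil _))) (by linarith) (by linarith) (by linarith)⟩
  · exact ⟨2, Path.cast (.cons (.r_r (by linarith) (by linarith) rfl) (.cons (.u_o (by linarith) (by linarith) rfl) (.cons (.r_t (by linarith) (by linarith) rfl) (Path.nil _)))) (by linarith) (by linarith) (by linarith)⟩
  · exact ⟨2, Path.cast (.cons (.u_t (by linarith) (by linarith) rfl) (.cons (.u_o (by linarith) (by linarith) rfl) (.cons (.r_t (by linarith) (by linarith) rfl) (Path.nil _)))) (by linarith) (by linarith) (by linarith)⟩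
  · exact ⟨2, Path.cast (.cons (.u_t (by linarith) (by linarith) rfl) (.cons (.r_o (by linarith) (by linarith) rfl) (.cons (.u_r (by linarith) (by linarith) rfl) (Path.nil _)))) (by linarith) (by linarith) (by linarith)⟩
  · exact ⟨2, Path.cast (.cons (.u_t (by linarith) (by linarith) rfl) (.cons (.r_o (by linarith) (by linarith) rfl) (.cons (.u_r (by linarith) (by linarith) rfl) (Path.nil _)))) (by linarith) (by linarith) (by linarith)⟩
  · exact ⟨3, Path.cast (.cons (.u_t (by linarith) (by linarith) rfl) (.cons (.r_o (by linarith) (by linarith) rfl) (.cons (.r_r (by linarith) (by linarith) rfl) (.cons (.u_o (by linarith) (by linarith) rfl) (Path.nil _))))) (by linarith) (by linarith) (by linarith)⟩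

theorem step_lift_3 {x y p q a b} (hx : 0 < x) (hy : 0 ≤ y) (h : Step x y p q a b) :
    ∃ n, Path (sx 3 x y) (sy 3 x y) (n + 1) (emb 3 x y p) (emb 3 x y q)
      (sx 3 a b + ox 3 q.1 - ox 3 p.1) (sy 3 a b + oy 3 q.1 - oy 3 p.1) := by
  obtain ⟨h1, h2, h3⟩ := φ_mul_facts hx.le
  obtain ⟨h4, h5, h6⟩ := φ_mul_facts hy
  have h7 := φ_mul_self
  cases h <;> simp [sx, sy, emb, ox, oy] <;> subst_vars
  · exact ⟨0, Path.cast (.cons (.u_o (by linarith) (by linarith) rfl) (Path.nil _)) (by linarith) (by linarith) (by linarith)⟩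
  · exact ⟨1, Path.cast (.cons (.r_o (by linarith) (by linarith) rfl) (.cons (.u_r (by linarith) (by linarith) rfl) (Path.nil _))) (by linarith) (by linarith) (by linarith)⟩
  · exact ⟨0, Path.cast (.cons (.u_r (by linarith) (by linarith) rfl) (Path.nil _)) (by linarith) (by linarith) (by linarith)⟩
  · exact ⟨2, Path.cast (.cons (.r_r (by linarith) (by linarith) rfl) (.cons (.u_o (by linarith) (by linarith) rfl) (.cons (.u_t (by linarith) (by linarith) rfl) (Path.nil _)))) (by linarith) (by linarith) (by linarith)⟩
  · exact ⟨0, Path.cast (.cons (.u_t (by linarith) (by linarith) rfl) (Path.nil _)) (by linarith) (by linarith) (by linarith)⟩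
  · exact ⟨2, Path.cast (.cons (.r_t (by linarith) (by linarith) rfl) (.cons (.u_t (by linarith) (by linarith) rfl) (.cons (.u_o (by linarith) (by linarith) rfl) (Path.nil _)))) (by linarith) (by linarith) (by linarith)⟩

/-! ### Corners and the hyperelliptic involution under lifting -/

/-- The corner whose outgoing flow line leads to the image of the one from the corner of `f`. -/
def corner : Fin 4 → Rect → Rect
  | 0, f => f
  | 1, o => r | 1, r => t | 1, t => o
  | 2, o => t | 2, r => o | 2, t => r
  | 3, f => f

theorem corner_surjective (k : Fin 4) (f : Rect) : ∃ f', corner k f' = f := by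
  fin_cases k
  · exact ⟨f, rfl⟩
  · cases f
    exacts [⟨t, rfl⟩, ⟨o, rfl⟩, ⟨r, rfl⟩]
  · cases f
    exacts [⟨r, rfl⟩, ⟨t, rfl⟩, ⟨o, rfl⟩]
  · exact ⟨f, rfl⟩

/-- Position of the images of the lower left corners, first coordinate. -/
def cx (k : Fin 4) : ℝ := ![φ, φ, 1, 0] k

/-- Position of the images of the lower left corners, second coordinate. -/
def cy (k : Fin 4) : ℝ := ![0, 1, φ, φ] k

/-- All corners are one cone point of angle 6π, which three flow lines leave in a given direction.
The automorphism permutes these three as `corner` does: trivially for `σ_0` and `σ_3`, cyclically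
for `σ_1` and `σ_2`. -/
theorem start_lift_0 {x y : ℝ} (hx : 0 < x) (hy : 0 < y) (f : Rect) :
    ∃ n, Path (sx 0 x y) (sy 0 x y) n (start (sx 0 x y) (sy 0 x y) (corner 0 f))
      (emb 0 x y (start x y f)) (ox 0 f + cx 0) (oy 0 f + cy 0) := by
  obtain ⟨h1, h2, h3⟩ := φ_mul_facts hx.le
  obtain ⟨h4, h5, h6⟩ := φ_mul_facts hy.le
  have h7 := φ_mul_self
  cases f <;> simp [sx, sy, emb, ox, oy, cx, cy, start, corner, Rect.ht]
  · exact ⟨2, Path.cast (.cons (.r_o (by linarith) (by linarith) rfl) (.cons (.r_r (by linarith) (by linarith) rfl) (Path.nil _))) (by linarith) (by linarith) (by linarith)⟩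
  · exact ⟨2, Path.cast (.cons (.r_r (by linarith) (by linarith) rfl) (.cons (.r_o (by linarith) (by linarith) rfl) (Path.nil _))) (by linarith) (by linarith) (by linarith)⟩
  · exact ⟨1, Path.cast (.cons (.r_t (by linarith) (by linarith) rfl) (Path.nil _)) (by linarith) (by linarith) (by linarith)⟩

/-- The displacement is arranged so that, after adding the diagonal of the last rectangle, the terms
in `ox`, `oy`, `cx`, `cy` cancel against those of `start_lift` and `path_lift`; what remains is
`σ_k` applied to the saddle connection vector. -/
theorem final_lift_0 {x y : ℝ} (hx : 0 < x) (hy : 0 < y) (f : Rect) :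
    ∃ n, Path (sx 0 x y) (sy 0 x y) n (emb 0 x y (final x y f))
      (final (sx 0 x y) (sy 0 x y) (corner 0 f))
      (sx 0 f.wd f.ht - (corner 0 f).wd - ox 0 f - cx 0)
      (sy 0 f.wd f.ht - (corner 0 f).ht - oy 0 f - cy 0) := by
  obtain ⟨h1, h2, h3⟩ := φ_mul_facts hx.le
  obtain ⟨h4, h5, h6⟩ := φ_mul_facts hy.le
  have h7 := φ_mul_self
  cases f <;> simp [sx, sy, emb, ox, oy, cx, cy, final, corner, Rect.ht, Rect.wd]
  · exact ⟨0, Path.cast (Path.nil _) (by linarith) (by linarith) (by linarith)⟩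
  · exact ⟨0, Path.cast (Path.nil _) (by linarith) (by linarith) (by linarith)⟩
  · exact ⟨0, Path.cast (Path.nil _) (by linarith) (by linarith) (by linarith)⟩

/-- The automorphism commutes with the involution, but `emb` chooses representatives on
antidiagonals, so the two orders of composition agree only after flowing on for a while. -/
theorem invol_lift_0 {x y : ℝ} {p} (hx : 0 < x) (hy : 0 ≤ y) (hp : Valid x y p) :
    ∃ n a b, Path (sx 0 x y) (sy 0 x y) n (invol (sx 0 x y) (sy 0 x y) (emb 0 x y p))
      (emb 0 x y (invol x y p)) a b := by
  obtain ⟨h1, h2, h3⟩ := φ_mul_facts hx.le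
  obtain ⟨h4, h5, h6⟩ := φ_mul_facts hy
  have h7 := φ_mul_self
  obtain ⟨f, s⟩ := p
  obtain ⟨h8, h9⟩ := hp
  cases f <;> simp [sx, sy, emb, invol, Rect.len, Rect.ht, Rect.wd] at h8 h9 ⊢
  · exact ⟨2, _, _, Path.cast (.cons (.r_o (by linarith) (by linarith) rfl) (.cons (.r_r (by linarith) (by linarith) rfl) (Path.nil _))) (by linarith) rfl rfl⟩
  · exact ⟨2, _, _, Path.cast (.cons (.r_r (by linarith) (by linarith) rfl) (.cons (.r_o (by linarith) (by linarith) rfl) (Path.nil _))) (by linarith) rfl rfl⟩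
  · exact ⟨1, _, _, Path.cast (.cons (.r_t (by linarith) (by linarith) rfl) (Path.nil _)) (by linarith) rfl rfl⟩

theorem start_lift_1 {x y : ℝ} (hx : 0 < x) (hy : 0 < y) (f : Rect) :
    ∃ n, Path (sx 1 x y) (sy 1 x y) n (start (sx 1 x y) (sy 1 x y) (corner 1 f))
      (emb 1 x y (start x y f)) (ox 1 f + cx 1) (oy 1 f + cy 1) := by
  obtain ⟨h1, h2, h3⟩ := φ_mul_facts hx.le
  obtain ⟨h4, h5, h6⟩ := φ_mul_facts hy.le
  have h7 := φ_mul_self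
  cases f <;> simp [sx, sy, emb, ox, oy, cx, cy, start, corner, Rect.ht]
  · exact ⟨3, Path.cast (.cons (.r_r (by linarith) (by linarith) rfl) (.cons (.u_o (by linarith) (by linarith) rfl) (.cons (.r_t (by linarith) (by linarith) rfl) (Path.nil _)))) (by linarith) (by linarith) (by linarith)⟩
  · exact ⟨2, Path.cast (.cons (.u_t (by linarith) (by linarith) rfl) (.cons (.r_o (by linarith) (by linarith) rfl) (Path.nil _))) (by linarith) (by linarith) (by linarith)⟩
  · exact ⟨2, Path.cast (.cons (.r_o (by linarith) (by linarith) rfl) (.cons (.u_r (by linarith) (by linarith) rfl) (Path.nil _))) (by linarith) (by linarith) (by linarith)⟩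

theorem final_lift_1 {x y : ℝ} (hx : 0 < x) (hy : 0 < y) (f : Rect) :
    ∃ n, Path (sx 1 x y) (sy 1 x y) n (emb 1 x y (final x y f))
      (final (sx 1 x y) (sy 1 x y) (corner 1 f))
      (sx 1 f.wd f.ht - (corner 1 f).wd - ox 1 f - cx 1)
      (sy 1 f.wd f.ht - (corner 1 f).ht - oy 1 f - cy 1) := by
  obtain ⟨h1, h2, h3⟩ := φ_mul_facts hx.le
  obtain ⟨h4, h5, h6⟩ := φ_mul_facts hy.le
  have h7 := φ_mul_self
  cases f <;> simp [sx, sy, emb, ox, oy, cx, cy, final, corner, Rect.ht, Rect.wd]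
  · exact ⟨2, Path.cast (.cons (.u_t (by linarith) (by linarith) rfl) (.cons (.r_o (by linarith) (by linarith) rfl) (Path.nil _))) (by linarith) (by linarith) (by linarith)⟩
  · exact ⟨2, Path.cast (.cons (.r_r (by linarith) (by linarith) rfl) (.cons (.u_o (by linarith) (by linarith) rfl) (Path.nil _))) (by linarith) (by linarith) (by linarith)⟩
  · exact ⟨1, Path.cast (.cons (.r_r (by linarith) (by linarith) rfl) (Path.nil _)) (by linarith) (by linarith) (by linarith)⟩

theorem invol_lift_1 {x y : ℝ} {p} (hx : 0 < x) (hy : 0 ≤ y) (hp : Valid x y p) :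
    ∃ n a b, Path (sx 1 x y) (sy 1 x y) n (invol (sx 1 x y) (sy 1 x y) (emb 1 x y p))
      (emb 1 x y (invol x y p)) a b := by
  obtain ⟨h1, h2, h3⟩ := φ_mul_facts hx.le
  obtain ⟨h4, h5, h6⟩ := φ_mul_facts hy
  have h7 := φ_mul_self
  obtain ⟨f, s⟩ := p
  obtain ⟨h8, h9⟩ := hp
  cases f <;> simp [sx, sy, emb, invol, Rect.len, Rect.ht, Rect.wd] at h8 h9 ⊢
  · exact ⟨1, _, _, Path.cast (.cons (.r_t (by linarith) (by linarith) rfl) (Path.nil _)) (by linarith) rfl rfl⟩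
  · exact ⟨0, _, _, Path.cast (Path.nil _) (by linarith) rfl rfl⟩
  · exact ⟨1, _, _, Path.cast (.cons (.u_r (by linarith) (by linarith) rfl) (Path.nil _)) (by linarith) rfl rfl⟩

theorem start_lift_2 {x y : ℝ} (hx : 0 < x) (hy : 0 < y) (f : Rect) :
    ∃ n, Path (sx 2 x y) (sy 2 x y) n (start (sx 2 x y) (sy 2 x y) (corner 2 f))
      (emb 2 x y (start x y f)) (ox 2 f + cx 2) (oy 2 f + cy 2) := by
  obtain ⟨h1, h2, h3⟩ := φ_mul_facts hx.le
  obtain ⟨h4, h5, h6⟩ := φ_mul_facts hy.le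
  have h7 := φ_mul_self
  cases f <;> simp [sx, sy, emb, ox, oy, cx, cy, start, corner, Rect.ht]
  · exact ⟨3, Path.cast (.cons (.u_t (by linarith) (by linarith) rfl) (.cons (.r_o (by linarith) (by linarith) rfl) (.cons (.u_r (by linarith) (by linarith) rfl) (Path.nil _)))) (by linarith) (by linarith) (by linarith)⟩
  · exact ⟨2, Path.cast (.cons (.u_o (by linarith) (by linarith) rfl) (.cons (.r_t (by linarith) (by linarith) rfl) (Path.nil _))) (by linarith) (by linarith) (by linarith)⟩
  · exact ⟨2, Path.cast (.cons (.r_r (by linarith) (by linarith) rfl) (.cons (.u_o (by linarith) (by linarith) rfl) (Path.nil _))) (by linarith) (by linarith) (by linarith)⟩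

theorem final_lift_2 {x y : ℝ} (hx : 0 < x) (hy : 0 < y) (f : Rect) :
    ∃ n, Path (sx 2 x y) (sy 2 x y) n (emb 2 x y (final x y f))
      (final (sx 2 x y) (sy 2 x y) (corner 2 f))
      (sx 2 f.wd f.ht - (corner 2 f).wd - ox 2 f - cx 2)
      (sy 2 f.wd f.ht - (corner 2 f).ht - oy 2 f - cy 2) := by
  obtain ⟨h1, h2, h3⟩ := φ_mul_facts hx.le
  obtain ⟨h4, h5, h6⟩ := φ_mul_facts hy.le
  have h7 := φ_mul_self
  cases f <;> simp [sx, sy, emb, ox, oy, cx, cy, final, corner, Rect.ht, Rect.wd]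
  · exact ⟨2, Path.cast (.cons (.r_r (by linarith) (by linarith) rfl) (.cons (.u_o (by linarith) (by linarith) rfl) (Path.nil _))) (by linarith) (by linarith) (by linarith)⟩
  · exact ⟨1, Path.cast (.cons (.u_t (by linarith) (by linarith) rfl) (Path.nil _)) (by linarith) (by linarith) (by linarith)⟩
  · exact ⟨2, Path.cast (.cons (.u_t (by linarith) (by linarith) rfl) (.cons (.r_o (by linarith) (by linarith) rfl) (Path.nil _))) (by linarith) (by linarith) (by linarith)⟩

theorem invol_lift_2 {x y : ℝ} {p} (hx : 0 < x) (hy : 0 ≤ y) (hp : Valid x y p) :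
    ∃ n a b, Path (sx 2 x y) (sy 2 x y) n (invol (sx 2 x y) (sy 2 x y) (emb 2 x y p))
      (emb 2 x y (invol x y p)) a b := by
  obtain ⟨h1, h2, h3⟩ := φ_mul_facts hx.le
  obtain ⟨h4, h5, h6⟩ := φ_mul_facts hy
  have h7 := φ_mul_self
  obtain ⟨f, s⟩ := p
  obtain ⟨h8, h9⟩ := hp
  cases f <;> simp [sx, sy, emb, invol, Rect.len, Rect.ht, Rect.wd] at h8 h9 ⊢
  · exact ⟨1, _, _, Path.cast (.cons (.u_r (by linarith) (by linarith) rfl) (Path.nil _)) (by linarith) rfl rfl⟩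
  · exact ⟨1, _, _, Path.cast (.cons (.r_t (by linarith) (by linarith) rfl) (Path.nil _)) (by linarith) rfl rfl⟩
  · exact ⟨0, _, _, Path.cast (Path.nil _) (by linarith) rfl rfl⟩

theorem start_lift_3 {x y : ℝ} (hx : 0 < x) (hy : 0 < y) (f : Rect) :
    ∃ n, Path (sx 3 x y) (sy 3 x y) n (start (sx 3 x y) (sy 3 x y) (corner 3 f))
      (emb 3 x y (start x y f)) (ox 3 f + cx 3) (oy 3 f + cy 3) := by
  obtain ⟨h1, h2, h3⟩ := φ_mul_facts hx.le
  obtain ⟨h4, h5, h6⟩ := φ_mul_facts hy.le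
  have h7 := φ_mul_self
  cases f <;> simp [sx, sy, emb, ox, oy, cx, cy, start, corner, Rect.ht]
  · exact ⟨2, Path.cast (.cons (.u_o (by linarith) (by linarith) rfl) (.cons (.u_t (by linarith) (by linarith) rfl) (Path.nil _))) (by linarith) (by linarith) (by linarith)⟩
  · exact ⟨1, Path.cast (.cons (.u_r (by linarith) (by linarith) rfl) (Path.nil _)) (by linarith) (by linarith) (by linarith)⟩
  · exact ⟨2, Path.cast (.cons (.u_t (by linarith) (by linarith) rfl) (.cons (.u_o (by linarith) (by linarith) rfl) (Path.nil _))) (by linarith) (by linarith) (by linarith)⟩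

theorem final_lift_3 {x y : ℝ} (hx : 0 < x) (hy : 0 < y) (f : Rect) :
    ∃ n, Path (sx 3 x y) (sy 3 x y) n (emb 3 x y (final x y f))
      (final (sx 3 x y) (sy 3 x y) (corner 3 f))
      (sx 3 f.wd f.ht - (corner 3 f).wd - ox 3 f - cx 3)
      (sy 3 f.wd f.ht - (corner 3 f).ht - oy 3 f - cy 3) := by
  obtain ⟨h1, h2, h3⟩ := φ_mul_facts hx.le
  obtain ⟨h4, h5, h6⟩ := φ_mul_facts hy.le
  have h7 := φ_mul_self
  cases f <;> simp [sx, sy, emb, ox, oy, cx, cy, final, corner, Rect.ht, Rect.wd]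
  · exact ⟨0, Path.cast (Path.nil _) (by linarith) (by linarith) (by linarith)⟩
  · exact ⟨0, Path.cast (Path.nil _) (by linarith) (by linarith) (by linarith)⟩
  · exact ⟨0, Path.cast (Path.nil _) (by linarith) (by linarith) (by linarith)⟩

theorem invol_lift_3 {x y : ℝ} {p} (hx : 0 < x) (hy : 0 ≤ y) (hp : Valid x y p) :
    ∃ n a b, Path (sx 3 x y) (sy 3 x y) n (invol (sx 3 x y) (sy 3 x y) (emb 3 x y p))
      (emb 3 x y (invol x y p)) a b := by
  obtain ⟨h1, h2, h3⟩ := φ_mul_facts hx.le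
  obtain ⟨h4, h5, h6⟩ := φ_mul_facts hy
  have h7 := φ_mul_self
  obtain ⟨f, s⟩ := p
  obtain ⟨h8, h9⟩ := hp
  cases f <;> simp [sx, sy, emb, invol, Rect.len, Rect.ht, Rect.wd] at h8 h9 ⊢
  · exact ⟨2, _, _, Path.cast (.cons (.u_o (by linarith) (by linarith) rfl) (.cons (.u_t (by linarith) (by linarith) rfl) (Path.nil _))) (by linarith) rfl rfl⟩
  · exact ⟨1, _, _, Path.cast (.cons (.u_r (by linarith) (by linarith) rfl) (Path.nil _)) (by linarith) rfl rfl⟩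
  · exact ⟨2, _, _, Path.cast (.cons (.u_t (by linarith) (by linarith) rfl) (.cons (.u_o (by linarith) (by linarith) rfl) (Path.nil _))) (by linarith) rfl rfl⟩

/-! ### Every infinite flow line meets the image of the embedding -/

/-- Since `emb 0` does not change a state, its image consists of the states valid for the old
direction. A line about to go up is low enough to be in it, and moves to the right lower `s` into it
after at most two steps. -/
theorem Flows.exists_emb_0 {x y O} (hx : 0 < x) (hy : 0 ≤ y) (hO : Flows (sx 0 x y) (sy 0 x y) O)
    (hne : O.Nonempty) : ∃ p, Valid x y p ∧ emb 0 x y p ∈ O := by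
  obtain ⟨h1, h2, h3⟩ := φ_mul_facts hx.le
  obtain ⟨h4, h5, h6⟩ := φ_mul_facts hy
  have h7 := φ_mul_self
  obtain ⟨p, hp⟩ := hne
  suffices h : ∃ p ∈ O, Valid x y p by
    obtain ⟨⟨f, s⟩, h, h'⟩ := h
    exact ⟨(f, s), h', by cases f <;> exact h⟩
  obtain ⟨q, hq, a, b, h⟩ := hO p hp
  simp only [sx, sy, Matrix.cons_val_zero] at h
  have hV : ∀ f s, (f, s) ∈ O → 0 < s → f.len x y ≤ s ∨ ∃ p ∈ O, Valid x y p := fun f s hm h0 => by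
    rcases le_or_gt (f.len x y) s with h | h
    · exact .inl h
    · exact .inr ⟨_, hm, h0, h⟩
  cases h
  case u_o s s' a1 a2 a3 =>
    refine (hV _ _ hp a1).resolve_left fun hc => ?_
    simp only [Rect.len, Rect.wd, Rect.ht] at hc; linarith
  case u_r s s' a1 a2 a3 =>
    refine (hV _ _ hp a1).resolve_left fun hc => ?_
    simp only [Rect.len, Rect.wd, Rect.ht] at hc; linarith
  case u_t s s' a1 a2 a3 =>
    refine (hV _ _ hp a1).resolve_left fun hc => ?_
    simp only [Rect.len, Rect.wd, Rect.ht] at hc; linarith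
  case r_t s s' a1 a2 a3 =>
    refine (hV _ _ hp (by linarith)).elim (fun hc => (hV _ _ hq ?_).resolve_left fun hc' => ?_) id <;>
      simp only [Rect.len, Rect.wd, Rect.ht] at * <;> linarith
  case r_o s s' a1 a2 a3 =>
    refine (hV _ _ hp (by linarith)).elim (fun hc => (hV _ _ hq ?_).elim (fun hc' => ?_) id) id
    · simp only [Rect.len, Rect.wd, Rect.ht] at *; linarith
    · simp only [Rect.len, Rect.wd, Rect.ht] at hc hc'
      obtain ⟨q', hq', a', b', h'⟩ := hO _ hq
      simp only [sx, sy, Matrix.cons_val_zero] at h'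
      cases h'
      · linarith
      · refine ⟨_, hq', ?_⟩
        simp only [Valid, Rect.len, Rect.wd, Rect.ht]
        constructor <;> linarith
  case r_r s s' a1 a2 a3 =>
    refine (hV _ _ hp (by linarith)).elim (fun hc => (hV _ _ hq ?_).elim (fun hc' => ?_) id) id
    · simp only [Rect.len, Rect.wd, Rect.ht] at *; linarith
    · simp only [Rect.len, Rect.wd, Rect.ht] at hc hc'
      obtain ⟨q', hq', a', b', h'⟩ := hO _ hq
      simp only [sx, sy, Matrix.cons_val_zero] at h'
      cases h'
      · linarith
      · refine ⟨_, hq', ?_⟩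
        simp only [Valid, Rect.len, Rect.wd, Rect.ht]
        constructor <;> linarith

/-- Mirror image of the case of `emb 0`: a line about to go right has `s` large enough to be in the
image, and moves up raise `s` into it after at most two steps. -/
theorem Flows.exists_emb_3 {x y O} (hx : 0 < x) (hy : 0 ≤ y) (hO : Flows (sx 3 x y) (sy 3 x y) O)
    (hne : O.Nonempty) : ∃ p, Valid x y p ∧ emb 3 x y p ∈ O := by
  obtain ⟨h1, h2, h3⟩ := φ_mul_facts hx.le
  obtain ⟨h4, h5, h6⟩ := φ_mul_facts hy
  have h7 := φ_mul_self
  obtain ⟨p, hp⟩ := hne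
  simp only [sx, sy, Matrix.cons_val] at hO
  have ho : ∀ s, (o, s) ∈ O → φ * x < s → s < x + (φ * x + y) →
      ∃ p, Valid x y p ∧ emb 3 x y p ∈ O := fun s hs h h' =>
    ⟨(o, s - φ * x), by simp only [Valid, Rect.len, Rect.wd, Rect.ht]; constructor <;> linarith,
      by simpa [emb] using hs⟩
  have hr : ∀ s, (r, s) ∈ O → x < s → s < x + (φ - 1) * (φ * x + y) →
      ∃ p, Valid x y p ∧ emb 3 x y p ∈ O := fun s hs h h' =>
    ⟨(r, s - x), by simp only [Valid, Rect.len, Rect.wd, Rect.ht]; constructor <;> linarith,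
      by simpa [emb] using hs⟩
  have ht : ∀ s, (t, s) ∈ O → φ * x < s → s < (φ - 1) * x + (φ * x + y) →
      ∃ p, Valid x y p ∧ emb 3 x y p ∈ O := fun s hs h h' =>
    ⟨(t, s - φ * x), by simp only [Valid, Rect.len, Rect.wd, Rect.ht]; constructor <;> linarith,
      by simpa [emb] using hs⟩
  obtain ⟨q, hq, a, b, h⟩ := hO p hp
  cases h
  case r_o s s' a1 a2 a3 => exact ho _ hp (by linarith) (by linarith)
  case r_r s s' a1 a2 a3 => exact hr _ hp (by linarith) (by linarith)
  case r_t s s' a1 a2 a3 => exact ht _ hp (by linarith) (by linarith)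
  case u_r s s' a1 a2 a3 => exact hr _ hq (by linarith) (by linarith)
  case u_o s s' a1 a2 a3 =>
    rcases lt_or_ge (φ * x) s with h | h
    · exact ho _ hp h (by linarith)
    · obtain ⟨q', hq', a', b', h'⟩ := hO _ hq
      cases h'
      · exact ho _ hq' (by linarith) (by linarith)
      · exact ht _ hq (by linarith) (by linarith)
  case u_t s s' a1 a2 a3 =>
    rcases lt_or_ge (φ * x) s with h | h
    · exact ht _ hp h (by linarith)
    · obtain ⟨q', hq', a', b', h'⟩ := hO _ hq
      cases h'
      · exact ht _ hq' (by linarith) (by linarith)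
      · exact ho _ hq (by linarith) (by linarith)

/-- The image lies in the rectangles `t` and `r`. Every line from `r` reaches it, a line from `t`
reaches it or passes to `r`, and a line from `o` goes to one of the two. -/
theorem Flows.exists_emb_1 {x y O} (hx : 0 < x) (hy : 0 ≤ y) (hO : Flows (sx 1 x y) (sy 1 x y) O)
    (hne : O.Nonempty) : ∃ p, Valid x y p ∧ emb 1 x y p ∈ O := by
  obtain ⟨h1, h2, h3⟩ := φ_mul_facts hx.le
  obtain ⟨h4, h5, h6⟩ := φ_mul_facts hy
  have h7 := φ_mul_self
  obtain ⟨p, hp⟩ := hne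
  simp only [sx, sy, Matrix.cons_val] at hO
  have ho' : ∀ s, (t, s) ∈ O → 0 < s → s < x + y → ∃ p, Valid x y p ∧ emb 1 x y p ∈ O :=
    fun s hs h h' => ⟨(o, s), by
      simp only [Valid, Rect.len, Rect.wd, Rect.ht]; constructor <;> linarith, hs⟩
  have hr' : ∀ s, (r, s) ∈ O → (φ - 1) * x + y < s → s < φ * x + φ * y →
      ∃ p, Valid x y p ∧ emb 1 x y p ∈ O :=
    fun s hs h h' => ⟨(r, s - ((φ - 1) * x + y)), by
      simp only [Valid, Rect.len, Rect.wd, Rect.ht]; constructor <;> linarith, by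
      simpa [emb] using hs⟩
  have ht' : ∀ s, (r, s) ∈ O → φ * x + φ * y < s → s < φ * x + φ * y + (φ - 1) * x + y →
      ∃ p, Valid x y p ∧ emb 1 x y p ∈ O :=
    fun s hs h h' => ⟨(t, s - (φ * x + φ * y)), by
      simp only [Valid, Rect.len, Rect.wd, Rect.ht]; constructor <;> linarith, by
      simpa [emb] using hs⟩
  have hr : ∀ s, (r, s) ∈ O → ∃ p, Valid x y p ∧ emb 1 x y p ∈ O := fun s hs => by
    obtain ⟨q, hq, a, b, h⟩ := hO _ hs
    cases h
    case u_r s' a1 a2 a3 => exact ht' _ hq (by linarith) (by linarith)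
    case r_r s' a1 a2 a3 =>
      rcases lt_trichotomy s (φ * x + φ * y) with h | h | h
      · exact hr' _ hs (by linarith) h
      -- This is the one state between the adjacent images of `r` and `t`; the line through it has
      -- to be followed until it meets the image of `o`.
      · obtain ⟨q2, hq2, _, _, h'⟩ := hO _ hq
        cases h'
        · obtain ⟨q3, hq3, _, _, h''⟩ := hO _ hq2
          cases h''
          · linarith
          · exact ho' _ hq3 (by linarith) (by linarith)
        · linarith
      · exact ht' _ hs h (by linarith)
  have ht : ∀ s, (t, s) ∈ O → ∃ p, Valid x y p ∧ emb 1 x y p ∈ O := fun s hs => by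
    obtain ⟨q, hq, a, b, h⟩ := hO _ hs
    cases h
    case u_t s' a1 a2 a3 =>
      obtain ⟨q2, hq2, _, _, h'⟩ := hO _ hq
      cases h'
      · linarith
      · exact hr _ hq2
    case r_t s' a1 a2 a3 => exact ho' _ hq (by linarith) (by linarith)
  obtain ⟨q, hq, a, b, h⟩ := hO p hp
  cases h
  case u_o => exact ht _ hq
  case r_o => exact hr _ hq
  case u_r => exact hr _ hp
  case r_r => exact hr _ hp
  case u_t => exact ht _ hp
  case r_t => exact ht _ hp

theorem Flows.exists_emb_2 {x y O} (hx : 0 < x) (hy : 0 ≤ y) (hO : Flows (sx 2 x y) (sy 2 x y) O)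
    (hne : O.Nonempty) : ∃ p, Valid x y p ∧ emb 2 x y p ∈ O := by
  obtain ⟨h1, h2, h3⟩ := φ_mul_facts hx.le
  obtain ⟨h4, h5, h6⟩ := φ_mul_facts hy
  have h7 := φ_mul_self
  obtain ⟨p, hp⟩ := hne
  simp only [sx, sy, Matrix.cons_val] at hO
  have ho' : ∀ s, (r, s) ∈ O → φ * x + y < s → s < φ * x + y + x + y →
      ∃ p, Valid x y p ∧ emb 2 x y p ∈ O :=
    fun s hs h h' => ⟨(o, s - (φ * x + y)), by
      simp only [Valid, Rect.len, Rect.wd, Rect.ht]; constructor <;> linarith, by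
      simpa [emb] using hs⟩
  have hr' : ∀ s, (t, s) ∈ O → 0 < s → s < x + (φ - 1) * y →
      ∃ p, Valid x y p ∧ emb 2 x y p ∈ O :=
    fun s hs h h' => ⟨(r, s), by
      simp only [Valid, Rect.len, Rect.wd, Rect.ht]; constructor <;> linarith, hs⟩
  have ht' : ∀ s, (t, s) ∈ O → x + (φ - 1) * y < s → s < φ * x + φ * y →
      ∃ p, Valid x y p ∧ emb 2 x y p ∈ O :=
    fun s hs h h' => ⟨(t, s - (x + (φ - 1) * y)), by
      simp only [Valid, Rect.len, Rect.wd, Rect.ht]; constructor <;> linarith, by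
      simpa [emb] using hs⟩
  have ht : ∀ s, (t, s) ∈ O → ∃ p, Valid x y p ∧ emb 2 x y p ∈ O := fun s hs => by
    obtain ⟨q, hq, a, b, h⟩ := hO _ hs
    cases h
    case r_t s' a1 a2 a3 => exact hr' _ hq (by linarith) (by linarith)
    case u_t s' a1 a2 a3 =>
      rcases lt_trichotomy s (x + (φ - 1) * y) with h | h | h
      · exact hr' _ hs (by linarith) h
      · obtain ⟨q2, hq2, _, _, h'⟩ := hO _ hq
        cases h'
        · linarith
        · obtain ⟨q3, hq3, _, _, h''⟩ := hO _ hq2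
          cases h''
          · exact ho' _ hq3 (by linarith) (by linarith)
          · linarith
      · exact ht' _ hs h (by linarith)
  have hr : ∀ s, (r, s) ∈ O → ∃ p, Valid x y p ∧ emb 2 x y p ∈ O := fun s hs => by
    obtain ⟨q, hq, a, b, h⟩ := hO _ hs
    cases h
    case u_r s' a1 a2 a3 => exact ho' _ hq (by linarith) (by linarith)
    case r_r s' a1 a2 a3 =>
      rcases lt_or_ge (φ * x + y) s with h | h
      · exact ho' _ hs h (by linarith)
      · obtain ⟨q2, hq2, _, _, h'⟩ := hO _ hq
        cases h'
        · exact ht _ hq2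
        · linarith
  obtain ⟨q, hq, a, b, h⟩ := hO p hp
  cases h
  case u_o => exact ht _ hq
  case r_o => exact hr _ hq
  case u_r => exact hr _ hp
  case r_r => exact hr _ hp
  case u_t => exact ht _ hp
  case r_t => exact ht _ hp

/-! ### A finite orbit set is not contained in the image -/

/-- At a state with `s` minimal, a step to the right would lower `s`, because `y` is positive, and a
step up lands above the image; so the successor cannot be in the image. -/
theorem Flows.exists_not_emb_0 {x y O} (hx : 0 < x) (hy : 0 < y)
    (hO : Flows (sx 0 x y) (sy 0 x y) O) (hfin : O.Finite) (hne : O.Nonempty) :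
    ∃ p ∈ O, ∀ p', Valid x y p' → emb 0 x y p' ≠ p := by
  obtain ⟨h1, h2, h3⟩ := φ_mul_facts hx.le
  obtain ⟨h4, h5, h6⟩ := φ_mul_facts hy.le
  have h7 := φ_mul_self
  by_contra! hcon
  obtain ⟨p, hp, hmin⟩ := Set.exists_min_image O Prod.snd hfin hne
  obtain ⟨q, hq, a, b, h⟩ := hO p hp
  obtain ⟨⟨f, s⟩, ⟨h8, h9⟩, rfl⟩ := hcon q hq
  have hmin := hmin _ hq
  simp only [sx, sy, Matrix.cons_val_zero] at h
  cases f <;> simp [emb, Rect.len, Rect.wd, Rect.ht] at h h9 hmin <;> cases h <;>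
    simp only at hmin <;> linarith

/-- At a state with `s` maximal, a step up would raise `s`, and a step to the right lands below the
image. -/
theorem Flows.exists_not_emb_3 {x y O} (hx : 0 < x) (hy : 0 ≤ y)
    (hO : Flows (sx 3 x y) (sy 3 x y) O) (hfin : O.Finite) (hne : O.Nonempty) :
    ∃ p ∈ O, ∀ p', Valid x y p' → emb 3 x y p' ≠ p := by
  obtain ⟨h1, h2, h3⟩ := φ_mul_facts hx.le
  obtain ⟨h4, h5, h6⟩ := φ_mul_facts hy
  have h7 := φ_mul_self
  by_contra! hcon
  obtain ⟨p, hp, hmax⟩ := Set.exists_max_image O Prod.snd hfin hne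
  obtain ⟨q, hq, a, b, h⟩ := hO p hp
  obtain ⟨⟨f, s⟩, ⟨h8, h9⟩, rfl⟩ := hcon q hq
  have hmax := hmax _ hq
  simp only [sx, sy, Matrix.cons_val] at h
  cases f <;> simp [emb, Rect.len, Rect.wd, Rect.ht] at h h8 h9 hmax <;> cases h <;>
    simp only at hmax <;> linarith

/-- No single step leads from the image to the image, so any two consecutive states give the claim
and finiteness plays no role. -/
theorem Flows.exists_not_emb_1 {x y O} (hx : 0 < x) (hy : 0 ≤ y)
    (hO : Flows (sx 1 x y) (sy 1 x y) O) (hne : O.Nonempty) :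
    ∃ p ∈ O, ∀ p', Valid x y p' → emb 1 x y p' ≠ p := by
  obtain ⟨h1, h2, h3⟩ := φ_mul_facts hx.le
  obtain ⟨h4, h5, h6⟩ := φ_mul_facts hy
  have h7 := φ_mul_self
  by_contra! hcon
  obtain ⟨p, hp⟩ := hne
  obtain ⟨q, hq, a, b, h⟩ := hO p hp
  obtain ⟨⟨f, s⟩, ⟨h8, h9⟩, rfl⟩ := hcon p hp
  obtain ⟨⟨f', s'⟩, ⟨h8', h9'⟩, rfl⟩ := hcon q hq
  simp only [sx, sy, Matrix.cons_val] at h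
  cases f <;> cases f' <;> simp [emb, Rect.len, Rect.wd, Rect.ht] at h h8 h9 h8' h9' <;> cases h <;>
    linarith

theorem Flows.exists_not_emb_2 {x y O} (hx : 0 < x) (hy : 0 ≤ y)
    (hO : Flows (sx 2 x y) (sy 2 x y) O) (hne : O.Nonempty) :
    ∃ p ∈ O, ∀ p', Valid x y p' → emb 2 x y p' ≠ p := by
  obtain ⟨h1, h2, h3⟩ := φ_mul_facts hx.le
  obtain ⟨h4, h5, h6⟩ := φ_mul_facts hy
  have h7 := φ_mul_self
  by_contra! hcon
  obtain ⟨p, hp⟩ := hne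
  obtain ⟨q, hq, a, b, h⟩ := hO p hp
  obtain ⟨⟨f, s⟩, ⟨h8, h9⟩, rfl⟩ := hcon p hp
  obtain ⟨⟨f', s'⟩, ⟨h8', h9'⟩, rfl⟩ := hcon q hq
  simp only [sx, sy, Matrix.cons_val] at h
  cases f <;> cases f' <;> simp [emb, Rect.len, Rect.wd, Rect.ht] at h h8 h9 h8' h9' <;> cases h <;>
    linarith

/-! ### The four letters together: lifting paths and pulling back orbit sets -/

theorem step_lift (k : Fin 4) {x y p q a b} (hx : 0 < x) (hy : 0 ≤ y) (h : Step x y p q a b) :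
    ∃ n, Path (sx k x y) (sy k x y) (n + 1) (emb k x y p) (emb k x y q)
      (sx k a b + ox k q.1 - ox k p.1) (sy k a b + oy k q.1 - oy k p.1) :=
  match k with
  | 0 => step_lift_0 hx hy h
  | 1 => step_lift_1 hx hy h
  | 2 => step_lift_2 hx hy h
  | 3 => step_lift_3 hx hy h

theorem start_lift (k : Fin 4) {x y : ℝ} (hx : 0 < x) (hy : 0 < y) (f : Rect) :
    ∃ n, Path (sx k x y) (sy k x y) n (start (sx k x y) (sy k x y) (corner k f))
      (emb k x y (start x y f)) (ox k f + cx k) (oy k f + cy k) :=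
  match k with
  | 0 => start_lift_0 hx hy f
  | 1 => start_lift_1 hx hy f
  | 2 => start_lift_2 hx hy f
  | 3 => start_lift_3 hx hy f

theorem final_lift (k : Fin 4) {x y : ℝ} (hx : 0 < x) (hy : 0 < y) (f : Rect) :
    ∃ n, Path (sx k x y) (sy k x y) n (emb k x y (final x y f))
      (final (sx k x y) (sy k x y) (corner k f))
      (sx k f.wd f.ht - (corner k f).wd - ox k f - cx k)
      (sy k f.wd f.ht - (corner k f).ht - oy k f - cy k) :=
  match k with
  | 0 => final_lift_0 hx hy f
  | 1 => final_lift_1 hx hy f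
  | 2 => final_lift_2 hx hy f
  | 3 => final_lift_3 hx hy f

theorem invol_lift (k : Fin 4) {x y : ℝ} {p} (hx : 0 < x) (hy : 0 ≤ y) (hp : Valid x y p) :
    ∃ n a b, Path (sx k x y) (sy k x y) n (invol (sx k x y) (sy k x y) (emb k x y p))
      (emb k x y (invol x y p)) a b :=
  match k with
  | 0 => invol_lift_0 hx hy hp
  | 1 => invol_lift_1 hx hy hp
  | 2 => invol_lift_2 hx hy hp
  | 3 => invol_lift_3 hx hy hp

theorem Flows.exists_emb (k : Fin 4) {x y O} (hx : 0 < x) (hy : 0 ≤ y)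
    (hO : Flows (sx k x y) (sy k x y) O) (hne : O.Nonempty) :
    ∃ p, Valid x y p ∧ emb k x y p ∈ O :=
  match k with
  | 0 => exists_emb_0 hx hy hO hne
  | 1 => exists_emb_1 hx hy hO hne
  | 2 => exists_emb_2 hx hy hO hne
  | 3 => exists_emb_3 hx hy hO hne

theorem Flows.exists_not_emb (k : Fin 4) {x y O} (hx : 0 < x) (hy : 0 ≤ y) (h0 : 0 < sy k x y)
    (hO : Flows (sx k x y) (sy k x y) O) (hfin : O.Finite) (hne : O.Nonempty) :
    ∃ p ∈ O, ∀ p', Valid x y p' → emb k x y p' ≠ p :=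
  match k with
  | 0 => exists_not_emb_0 hx h0 hO hfin hne
  | 1 => exists_not_emb_1 hx hy hO hne
  | 2 => exists_not_emb_2 hx hy hO hne
  | 3 => exists_not_emb_3 hx hy hO hfin hne

theorem sx_add (k : Fin 4) (a b c d : ℝ) : sx k (a + c) (b + d) = sx k a b + sx k c d := by
  fin_cases k <;> simp [sx] <;> ring

theorem sy_add (k : Fin 4) (a b c d : ℝ) : sy k (a + c) (b + d) = sy k a b + sy k c d := by
  fin_cases k <;> simp [sy] <;> ring

theorem sx_mul (k : Fin 4) (c a b : ℝ) : sx k (c * a) (c * b) = c * sx k a b := by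
  fin_cases k <;> simp [sx] <;> ring

theorem sy_mul (k : Fin 4) (c a b : ℝ) : sy k (c * a) (c * b) = c * sy k a b := by
  fin_cases k <;> simp [sy] <;> ring

/-- The coboundary terms telescope. The bound `n ≤ m` ensures that a nonempty closed path lifts to a
nonempty one. -/
theorem path_lift (k : Fin 4) {x y n p q a b} (hx : 0 < x) (hy : 0 ≤ y) (h : Path x y n p q a b) :
    ∃ m, n ≤ m ∧ Path (sx k x y) (sy k x y) m (emb k x y p) (emb k x y q)
      (sx k a b + ox k q.1 - ox k p.1) (sy k a b + oy k q.1 - oy k p.1) := by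
  induction h with
  | nil p =>
    refine ⟨0, le_rfl, (Path.nil _).disp ?_ ?_⟩
    · have := sx_mul k 0 0 0; simp at this; simp [this]
    · have := sy_mul k 0 0 0; simp at this; simp [this]
  | cons hs _ ih =>
    obtain ⟨m, hm, ih⟩ := ih
    obtain ⟨n, hn⟩ := step_lift k hx hy hs
    refine ⟨n + 1 + m, by omega, (hn.trans ih).disp ?_ ?_⟩
    · rw [sx_add]; ring
    · rw [sy_add]; ring

theorem emb_injOn (k : Fin 4) {x y : ℝ} (hx : 0 < x) (hy : 0 ≤ y) :
    Set.InjOn (emb k x y) {p | Valid x y p} := by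
  obtain ⟨h1, h2, h3⟩ := φ_mul_facts hx.le
  obtain ⟨h4, h5, h6⟩ := φ_mul_facts hy
  rintro ⟨f, s⟩ ⟨a1, a2⟩ ⟨g, s'⟩ ⟨b1, b2⟩ h
  fin_cases k <;> cases f <;> cases g <;> simp [emb, Rect.len, Rect.wd, Rect.ht] at * <;> linarith

/-- A valid state without successor runs into a vertex; by `final_lift` so would its image, which
belongs to a set where the flow never stops. That argument needs `0 < y`, which holds because for `y
= 0` the final state is not valid. -/
theorem Flows.pullback (k : Fin 4) {x y O} (hx : 0 < x) (hy : 0 ≤ y)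
    (hO : Flows (sx k x y) (sy k x y) O) : Flows x y {p | Valid x y p ∧ emb k x y p ∈ O} := by
  rintro p ⟨hp, hpO⟩
  rcases hp.step_or_final with ⟨q, a, b, h⟩ | h
  · obtain ⟨n, hn⟩ := step_lift k hx hy h
    exact ⟨q, ⟨(h.valid hx hy).2, hO.mem_of_path hn hpO⟩, a, b, h⟩
  · exfalso
    have hy' : 0 < y := by
      have h1 := hp.1
      rw [h] at h1
      refine hy.lt_of_ne fun h0 => ?_
      simp [final, ← h0] at h1
    obtain ⟨n, hn⟩ := final_lift k hx hy' p.1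
    rw [h] at hpO
    obtain ⟨q, -, a, b, hq⟩ := hO _ (hO.mem_of_path hn hpO)
    exact dead_final _ _ _ _ _ _ hq

/-! ### Tree words, descent to the horizontal direction, closed lines -/

/-- The vector `σ_{kₙ} ⋯ σ_{k₁} [r, 0]`. -/
def vec (u : List (Fin 4)) (r : ℝ) : ℝ × ℝ :=
  u.foldl (fun p k => (sx k p.1 p.2, sy k p.1 p.2)) (r, 0)

theorem vec_nil (r : ℝ) : vec [] r = (r, 0) := rfl

theorem vec_concat (u : List (Fin 4)) (k : Fin 4) (r : ℝ) :
    vec (u ++ [k]) r = (sx k (vec u r).1 (vec u r).2, sy k (vec u r).1 (vec u r).2) := by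
  simp [vec, List.foldl_append]

theorem vec_pos (u : List (Fin 4)) {r : ℝ} (hr : 0 < r) : 0 < (vec u r).1 ∧ 0 ≤ (vec u r).2 := by
  induction u using List.reverseRecOn with
  | nil => simp [vec_nil, hr]
  | append_singleton u k ih =>
    rw [vec_concat]
    exact ⟨sx_pos ih.1 ih.2, sy_nonneg ih.1 ih.2⟩

theorem vec_mul (u : List (Fin 4)) (c r : ℝ) :
    vec u (c * r) = (c * (vec u r).1, c * (vec u r).2) := by
  induction u using List.reverseRecOn with
  | nil => simp [vec_nil]
  | append_singleton u k ih => rw [vec_concat, vec_concat, ih, ← sx_mul, ← sy_mul]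

/-- The slopes 1/φ, 1 and φ bound the sectors; the witnesses are the inverse matrices applied to the
vector. -/
theorem exists_sector {x y : ℝ} (hx : 0 < x) (hy : 0 < y) :
    ∃ (k : Fin 4) (x' y' : ℝ), 0 < x' ∧ 0 ≤ y' ∧ x = sx k x' y' ∧ y = sy k x' y' := by
  have h1 := φ_mul_self
  have h2 := one_lt_φ
  have h3 := (φ_mul_facts hx.le).1
  have h4 := (φ_mul_facts hy.le).1
  rcases lt_or_ge (φ * y) x with h | h
  · exact ⟨0, x - φ * y, y, by linarith, hy.le, by simp [sx], by simp [sy]⟩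
  rcases lt_or_ge y x with h' | h'
  · refine ⟨1, φ * (x - y), φ * y - x, by nlinarith, by linarith, ?_, ?_⟩ <;>
      simp [sx, sy] <;> linarith
  rcases lt_or_ge y (φ * x) with h'' | h''
  · refine ⟨2, φ * x - y, φ * (y - x), by linarith, by nlinarith, ?_, ?_⟩ <;>
      simp [sx, sy] <;> linarith
  · exact ⟨3, x, y - φ * x, hx, by linarith, by simp [sx], by simp [sy]⟩

/-- The direction of a periodic flow line is given by a tree word. -/
theorem exists_word_of_flows (n : ℕ) : ∀ {x y : ℝ} {O : Set (Rect × ℝ)}, 0 < x → 0 ≤ y →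
    Flows x y O → O.Finite → O.Nonempty → O.ncard ≤ n →
    ∃ (u : List (Fin 4)) (r : ℝ), 0 < r ∧ u.head? ≠ some 0 ∧ vec u r = (x, y) := by
  induction n with
  | zero =>
    intro x y O _ _ _ hfin hne hc
    have := (Set.ncard_pos hfin).2 hne
    omega
  | succ n ih =>
    intro x y O hx hy hO hfin hne hc
    rcases hy.eq_or_lt with rfl | hy'
    · exact ⟨[], x, hx, by simp, rfl⟩
    obtain ⟨k, x', y', hx', hy0, rfl, rfl⟩ := exists_sector hx hy'
    obtain ⟨p, hp, hpO⟩ := hO.exists_emb k hx' hy0 hne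
    have hsub : emb k x' y' '' {p | Valid x' y' p ∧ emb k x' y' p ∈ O} ⊆ O := by
      rintro _ ⟨q, hq, rfl⟩; exact hq.2
    have hinj : Set.InjOn (emb k x' y') {p | Valid x' y' p ∧ emb k x' y' p ∈ O} :=
      (emb_injOn k hx' hy0).mono fun q hq => hq.1
    -- The descent: the pulled-back set embeds into `O` and misses one of its states.
    have hlt : {p | Valid x' y' p ∧ emb k x' y' p ∈ O}.ncard < O.ncard := by
      rw [← hinj.ncard_image]
      refine Set.ncard_lt_ncard (hsub.ssubset_of_ne fun h => ?_) hfin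
      obtain ⟨q, hq, hq'⟩ := hO.exists_not_emb k hx' hy0 hy' hfin hne
      rw [← h] at hq
      obtain ⟨p', hp', rfl⟩ := hq
      exact hq' p' hp'.1 rfl
    obtain ⟨u, r, hr, hu, h⟩ := ih hx' hy0 (hO.pullback k hx' hy0)
      (Set.Finite.of_finite_image (hfin.subset hsub) hinj) ⟨p, hp, hpO⟩ (by omega)
    -- The letter 0 cannot come first: `σ_0` fixes horizontal vectors, and `y` is positive.
    by_cases h0 : u = [] ∧ k = 0
    · obtain ⟨rfl, rfl⟩ := h0
      simp only [vec_nil, Prod.mk.injEq] at h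
      obtain ⟨rfl, rfl⟩ := h
      simp [sy] at hy'
    · refine ⟨u ++ [k], r, hr, ?_, by rw [vec_concat, h]⟩
      cases u with
      | nil => simpa using h0
      | cons a u => simpa using hu

/-- In the direction of a tree word, every infinite flow line closes up after displacement `v` or
`φ v`. -/
theorem Flows.exists_closed (u : List (Fin 4)) : ∀ {O : Set (Rect × ℝ)},
    Flows (vec u 1).1 (vec u 1).2 O → O.Nonempty → ∃ p ∈ O, ∃ n, ∃ c : ℝ, (c = 1 ∨ c = φ) ∧
      Path (vec u 1).1 (vec u 1).2 (n + 1) p p (c * (vec u 1).1) (c * (vec u 1).2) := by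
  induction u using List.reverseRecOn with
  | nil =>
    intro O hO ⟨p, hp⟩
    simp only [vec_nil] at *
    obtain ⟨q, hq, a, b, h⟩ := hO p hp
    -- Horizontally, `o` and `r` form a cylinder of circumference φ, and `t` alone one of
    -- circumference 1.
    cases h
    case u_o => linarith
    case u_r => linarith
    case u_t => linarith
    case r_o s s' a1 a2 a3 =>
      obtain ⟨q, hq', a, b, h⟩ := hO _ hq
      cases h
      · linarith
      refine ⟨_, hp, 1, φ, .inr rfl, Path.cast (Path.cons (.r_o a1 a2 a3)
        (Path.cons (.r_r ?_ ?_ rfl) (.nil _))) ?_ ?_ ?_⟩ <;> linarith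
    case r_r s s' a1 a2 a3 =>
      obtain ⟨q, hq', a, b, h⟩ := hO _ hq
      cases h
      · linarith
      refine ⟨_, hp, 1, φ, .inr rfl, Path.cast (Path.cons (.r_r a1 a2 a3)
        (Path.cons (.r_o ?_ ?_ rfl) (.nil _))) ?_ ?_ ?_⟩ <;> linarith
    case r_t s s' a1 a2 a3 =>
      refine ⟨_, hp, 0, 1, .inl rfl, Path.cast (Path.cons (.r_t a1 a2 a3) (.nil _)) ?_ ?_ ?_⟩ <;>
        linarith
  | append_singleton u k ih =>
    intro O hO hne
    obtain ⟨hx, hy⟩ := vec_pos u one_pos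
    rw [vec_concat] at hO ⊢
    obtain ⟨p, hp⟩ := hO.exists_emb k hx hy hne
    obtain ⟨q, hq, n, c, hc, hP⟩ := ih (hO.pullback k hx hy) ⟨p, hp⟩
    obtain ⟨m, hm, hP'⟩ := path_lift k hx hy hP
    obtain ⟨m, rfl⟩ : ∃ m', m = m' + 1 := ⟨m - 1, by omega⟩
    refine ⟨_, hq.2, m, c, hc, hP'.disp ?_ ?_⟩
    · simp only; rw [sx_mul]; ring
    · simp only; rw [sy_mul]; ring

theorem Path.exists_step {x y n p q a b} (h : Path x y n p q a b) (hn : n ≠ 0) :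
    ∃ r c d, Step x y p r c d := by
  cases h with
  | nil => exact absurd rfl hn
  | cons h _ => exact ⟨_, _, _, h⟩

/-- In the direction of a tree word, there are closed flow lines with displacement `v` and `φ v`
that are invariant under the involution. -/
theorem exists_core (u : List (Fin 4)) {c : ℝ} (hc : c = 1 ∨ c = φ) : ∃ p n z,
    Path (vec u 1).1 (vec u 1).2 (n + 1) p p (c * (vec u 1).1) (c * (vec u 1).2) ∧
    (∃ m a b, Path (vec u 1).1 (vec u 1).2 m p z a b) ∧
    ∃ m a b, Path (vec u 1).1 (vec u 1).2 m (invol (vec u 1).1 (vec u 1).2 p) z a b := by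
  induction u using List.reverseRecOn with
  | nil =>
    have h1 := lt_φ
    simp only [vec_nil]
    -- The midpoint of an antidiagonal is fixed by the involution. After lifting, the line and its
    -- image agree only from some later state on, which is why the statement has a common state `z`.
    rcases hc with rfl | rfl
    · refine ⟨(t, (φ - 1) / 2), 0, (t, (φ - 1) / 2), Path.cast (Path.cons (.r_t ?_ ?_ rfl)
        (.nil _)) ?_ ?_ ?_, ⟨0, 0, 0, .nil _⟩, 0, 0, 0, Path.cast (.nil _) ?_ rfl rfl⟩ <;>
        (try simp only [Rect.len, Rect.wd, Rect.ht]) <;> linarith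
    · refine ⟨(o, 1 / 2), 1, (o, 1 / 2), Path.cast (Path.cons (.r_o ?_ ?_ rfl)
        (Path.cons (.r_r ?_ ?_ rfl) (.nil _))) ?_ ?_ ?_, ⟨0, 0, 0, .nil _⟩, 0, 0, 0,
        Path.cast (.nil _) ?_ rfl rfl⟩ <;>
        (try simp only [Rect.len, Rect.wd, Rect.ht]) <;> linarith
  | append_singleton u k ih =>
    obtain ⟨hx, hy⟩ := vec_pos u one_pos
    obtain ⟨p, n, z, hP, ⟨m, a, b, hm⟩, m', a', b', hm'⟩ := ih
    rw [vec_concat]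
    have hv : Valid (vec u 1).1 (vec u 1).2 p := by
      obtain ⟨q, a, b, h⟩ := hP.exists_step n.succ_ne_zero
      exact (h.valid hx hy).1
    obtain ⟨m1, hm1, hP'⟩ := path_lift k hx hy hP
    obtain ⟨m1, rfl⟩ : ∃ m', m1 = m' + 1 := ⟨m1 - 1, by omega⟩
    obtain ⟨m2, -, h2⟩ := path_lift k hx hy hm
    obtain ⟨m3, -, h3⟩ := path_lift k hx hy hm'
    obtain ⟨m4, _, _, h4⟩ := invol_lift k hx hy hv
    refine ⟨_, m1, _, hP'.disp ?_ ?_, ⟨_, _, _, h2⟩, _, _, _, h4.trans h3⟩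
    · simp only; rw [sx_mul]; ring
    · simp only; rw [sy_mul]; ring

/-! ### Saddle connections -/

/-- `(a, b)` is the vector of a saddle connection of the golden L in direction `(x, y)`. -/
def Saddle (x y a b : ℝ) : Prop :=
  ∃ f g n c d, Path x y n (start x y f) (final x y g) c d ∧ a = c + g.wd ∧ b = d + g.ht

theorem Saddle.lift (k : Fin 4) {x y a b} (hx : 0 < x) (hy : 0 < y) (h : Saddle x y a b) :
    Saddle (sx k x y) (sy k x y) (sx k a b) (sy k a b) := by
  obtain ⟨f, g, n, c, d, hP, rfl, rfl⟩ := h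
  obtain ⟨m, -, h⟩ := path_lift k hx hy.le hP
  obtain ⟨m1, h1⟩ := start_lift k hx hy f
  obtain ⟨m2, h2⟩ := final_lift k hx hy g
  refine ⟨_, _, _, _, _, (h1.trans h).trans h2, ?_, ?_⟩
  · simp only [start, final]; rw [sx_add]; ring
  · simp only [start, final]; rw [sy_add]; ring

theorem Path.final_unique {x y m n p f g a b c d} (h : Path x y m p (final x y f) a b)
    (h' : Path x y n p (final x y g) c d) : f = g ∧ a = c ∧ b = d := by
  obtain ⟨-, h2⟩ := h.split h' (dead_final _ _ _)
  generalize n - m = n' at h2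
  generalize hc : c - _ = c' at h2
  generalize hd : d - _ = d' at h2
  generalize hf : final x y g = z at h2
  cases h2 with
  | nil => exact ⟨(congrArg Prod.fst hf).symm, by linarith, by linarith⟩
  | cons hs _ => exact absurd hs (dead_final _ _ _ _ _ _)

/-- The next step from `p` lifts to an initial piece of the given path, which `Path.split` cuts off;
if `p` itself runs into a vertex, the given path must be the one from `final_lift`. -/
theorem Path.descend_final (k : Fin 4) {x y : ℝ} (hx : 0 < x) (hy : 0 < y) (n : ℕ) :
    ∀ {p g c d}, Valid x y p →
    Path (sx k x y) (sy k x y) n (emb k x y p) (final (sx k x y) (sy k x y) g) c d →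
    ∃ m g' c' d', Path x y m p (final x y g') c' d' ∧
      c + g.wd = sx k (c' + g'.wd) (d' + g'.ht) - ox k p.1 - cx k ∧
      d + g.ht = sy k (c' + g'.wd) (d' + g'.ht) - oy k p.1 - cy k := by
  induction n using Nat.strong_induction_on with
  | _ n ih =>
    intro p g c d hp hP
    rcases hp.step_or_final with ⟨q, a, b, h⟩ | h
    · obtain ⟨m, hm⟩ := step_lift k hx hy.le h
      obtain ⟨h1, h2⟩ := hm.split hP (dead_final _ _ _)
      obtain ⟨m', g', c', d', hP', h3, h4⟩ := ih _ (by omega) (h.valid hx hy.le).2 h2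
      refine ⟨_, g', _, _, .cons h hP', ?_, ?_⟩
      · rw [show a + c' + g'.wd = a + (c' + g'.wd) by ring, add_assoc b, sx_add]; linarith
      · rw [show a + c' + g'.wd = a + (c' + g'.wd) by ring, add_assoc b, sy_add]; linarith
    · obtain ⟨m, hm⟩ := final_lift k hx hy p.1
      rw [← h] at hm
      obtain ⟨rfl, rfl, rfl⟩ := hm.final_unique hP
      refine ⟨0, p.1, 0, 0, ?_, ?_, ?_⟩
      · rw [← h]; exact .nil _
      · simp; ring
      · simp; ring

theorem valid_start {x y : ℝ} (hx : 0 < x) (hy : 0 < y) (f : Rect) : Valid x y (start x y f) := by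
  have := one_lt_φ
  cases f <;> simp only [Valid, start, Rect.len, Rect.wd, Rect.ht] <;> constructor <;> nlinarith

theorem Saddle.descend (k : Fin 4) {x y a b} (hx : 0 < x) (hy : 0 < y)
    (h : Saddle (sx k x y) (sy k x y) a b) :
    ∃ a' b', Saddle x y a' b' ∧ a = sx k a' b' ∧ b = sy k a' b' := by
  obtain ⟨f, g, n, c, d, hP, rfl, rfl⟩ := h
  obtain ⟨f, rfl⟩ := corner_surjective k f
  obtain ⟨m, hm⟩ := start_lift k hx hy f
  obtain ⟨h1, h2⟩ := hm.split hP (dead_final _ _ _)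
  obtain ⟨m', g', c', d', hP', h3, h4⟩ := h2.descend_final k hx hy _ (valid_start hx hy f)
  refine ⟨_, _, ⟨f, g', m', c', d', hP', rfl, rfl⟩, ?_, ?_⟩
  · simp only [start] at h3; linarith
  · simp only [start] at h4; linarith

/-- A saddle connection is determined by the corner that it leaves, so exhibiting one for each of
the three corners shows that there are no others. -/
theorem Saddle.eq_of_path {x y A B : ℝ}
    (h : ∀ f, ∃ n g c d, Path x y n (start x y f) (final x y g) c d ∧
      ((c + g.wd = A ∧ d + g.ht = B) ∨ c + g.wd = (φ - 1) * A ∧ d + g.ht = (φ - 1) * B)) {a b : ℝ}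
    (hs : Saddle x y a b) : (a = A ∧ b = B) ∨ a = (φ - 1) * A ∧ b = (φ - 1) * B := by
  obtain ⟨f, g, n, c, d, hP, rfl, rfl⟩ := hs
  obtain ⟨n', g', c', d', hP', h⟩ := h f
  obtain ⟨rfl, rfl, rfl⟩ := hP'.final_unique hP
  exact h

/-- The induction starts with one nonzero letter, because horizontal saddle connections run along
the edges and their starting states are not valid. Of the three saddle connections, two have the
vector `σ_k [1, 0]` and one is shorter by the factor φ - 1. -/
theorem saddle_base {k : Fin 4} (hk : k ≠ 0) {ρ : ℝ} (hr : 0 < ρ) :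
    (∀ a b, Saddle (sx k ρ 0) (sy k ρ 0) a b → (a = sx k 1 0 ∧ b = sy k 1 0) ∨
      a = (φ - 1) * sx k 1 0 ∧ b = (φ - 1) * sy k 1 0) ∧
    Saddle (sx k ρ 0) (sy k ρ 0) (sx k 1 0) (sy k 1 0) := by
  obtain ⟨h1, h2, h3⟩ := φ_mul_facts hr.le
  have h4 := φ_mul_self
  fin_cases k
  · exact absurd rfl hk
  · simp [sx, sy]
    refine ⟨fun a b h => (Saddle.eq_of_path (x := φ * ρ) (y := ρ) (A := φ) (B := 1) ?_ h).imp id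
      (by rw [mul_one] <;> exact id), ?_⟩
    · rintro (_ | _ | _)
      · exact ⟨_, r, _, _, Path.cast (.cons (.r_o (by simp [Rect.ht] <;> linarith)
          (by simp [Rect.ht] <;> linarith) rfl) (.nil _))
          (by simp [Rect.ht, Rect.wd] <;> linarith) rfl rfl, by simp [Rect.wd, Rect.ht]⟩
      · exact ⟨_, o, _, _, Path.cast (.cons (.r_r (by simp [Rect.ht] <;> linarith)
          (by simp [Rect.ht] <;> linarith) rfl) (.nil _))
          (by simp [Rect.ht, Rect.wd] <;> linarith) rfl rfl, by simp [Rect.wd, Rect.ht]⟩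
      · exact ⟨_, t, _, _, Path.cast (.nil _)
          (by simp [Rect.ht, Rect.wd] <;> linarith) rfl rfl, .inr (by simp [Rect.wd, Rect.ht] <;> linarith)⟩
    · exact ⟨o, r, _, _, _, Path.cast (.cons (.r_o (by simp [Rect.ht] <;> linarith)
          (by simp [Rect.ht] <;> linarith) rfl) (.nil _))
          (by simp [Rect.ht, Rect.wd] <;> linarith) rfl rfl, by simp [Rect.wd, Rect.ht]⟩
  · simp [sx, sy]
    refine ⟨fun a b h => (Saddle.eq_of_path (x := φ * ρ) (y := φ * ρ) (A := φ) (B := φ) ?_ h), ?_⟩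
    · rintro (_ | _ | _)
      · exact ⟨_, o, _, _, Path.cast (.nil _)
          (by simp [Rect.ht, Rect.wd]) rfl rfl, .inr (by simp [Rect.wd, Rect.ht] <;> linarith)⟩
      · exact ⟨_, t, _, _, Path.cast (.cons (.r_r (by simp [Rect.ht] <;> linarith)
          (by simp [Rect.ht] <;> linarith) rfl) (.cons (.u_o (by simp [Rect.ht] <;> linarith)
          (by simp [Rect.ht] <;> linarith) rfl) (.nil _)))
          (by simp [Rect.ht, Rect.wd]) rfl rfl, by simp [Rect.wd, Rect.ht]⟩
      · exact ⟨_, r, _, _, Path.cast (.cons (.u_t (by simp [Rect.ht] <;> linarith)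
          (by simp [Rect.ht] <;> linarith) rfl) (.cons (.r_o (by simp [Rect.ht] <;> linarith)
          (by simp [Rect.ht] <;> linarith) rfl) (.nil _)))
          (by simp [Rect.ht, Rect.wd]) rfl rfl, by simp [Rect.wd, Rect.ht]⟩
    · exact ⟨r, t, _, _, _, Path.cast (.cons (.r_r (by simp [Rect.ht] <;> linarith)
          (by simp [Rect.ht] <;> linarith) rfl) (.cons (.u_o (by simp [Rect.ht] <;> linarith)
          (by simp [Rect.ht] <;> linarith) rfl) (.nil _)))
          (by simp [Rect.ht, Rect.wd]) rfl rfl, by simp [Rect.wd, Rect.ht]⟩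
  · simp [sx, sy]
    refine ⟨fun a b h => (Saddle.eq_of_path (x := ρ) (y := φ * ρ) (A := 1) (B := φ) ?_ h).imp id
      (by rw [mul_one] <;> exact id), ?_⟩
    · rintro (_ | _ | _)
      · exact ⟨_, t, _, _, Path.cast (.cons (.u_o (by simp [Rect.ht] <;> linarith)
          (by simp [Rect.ht] <;> linarith) rfl) (.nil _))
          (by simp [Rect.ht, Rect.wd] <;> linarith) rfl rfl, by simp [Rect.wd, Rect.ht]⟩
      · exact ⟨_, r, _, _, Path.cast (.nil _)
          (by simp [Rect.ht, Rect.wd] <;> linarith) rfl rfl, .inr (by simp [Rect.wd, Rect.ht] <;> linarith)⟩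
      · exact ⟨_, o, _, _, Path.cast (.cons (.u_t (by simp [Rect.ht] <;> linarith)
          (by simp [Rect.ht] <;> linarith) rfl) (.nil _))
          (by simp [Rect.ht, Rect.wd] <;> linarith) rfl rfl, by simp [Rect.wd, Rect.ht]⟩
    · exact ⟨o, t, _, _, _, Path.cast (.cons (.u_o (by simp [Rect.ht] <;> linarith)
          (by simp [Rect.ht] <;> linarith) rfl) (.nil _))
          (by simp [Rect.ht, Rect.wd] <;> linarith) rfl rfl, by simp [Rect.wd, Rect.ht]⟩

theorem vec_snd_pos {u : List (Fin 4)} (hu : u.head? ≠ some 0) (h : u ≠ []) {r : ℝ} (hr : 0 < r) :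
    0 < (vec u r).2 := by
  have := one_lt_φ
  induction u using List.reverseRecOn with
  | nil => exact absurd rfl h
  | append_singleton u k ih =>
    obtain ⟨hx, hy⟩ := vec_pos u hr
    rw [vec_concat]
    by_cases hk : k = 0
    · subst hk
      cases u with
      | nil => simp at hu
      | cons a u => simpa [sy] using ih (by simpa using hu) (by simp)
    · fin_cases k
      · exact absurd rfl hk
      all_goals simp [sy]; positivity

/-- The saddle connections in the direction of a nonempty tree word. -/
theorem saddle_vec {u : List (Fin 4)} (hu : u.head? ≠ some 0) (h : u ≠ []) {r : ℝ} (hr : 0 < r) :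
    (∀ a b, Saddle (vec u r).1 (vec u r).2 a b → (a, b) = vec u 1 ∨ (a, b) = vec u (φ - 1)) ∧
    Saddle (vec u r).1 (vec u r).2 (vec u 1).1 (vec u 1).2 := by
  induction u using List.reverseRecOn with
  | nil => exact absurd rfl h
  | append_singleton u k ih =>
    rw [vec_concat, vec_concat, vec_concat]
    by_cases h0 : u = []
    · subst h0
      have := saddle_base (k := k) (by simpa using hu) hr
      simp only [vec_nil]
      refine ⟨fun a b h => ?_, this.2⟩
      rw [← sx_mul, ← sy_mul, mul_one, mul_zero] at this
      simpa using this.1 a b h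
    · have hu' : u.head? ≠ some 0 := by
        cases u with
        | nil => simp
        | cons a u => simpa using hu
      obtain ⟨h1, h2⟩ := ih hu' h0
      have hx := (vec_pos u hr).1
      have hy := vec_snd_pos hu' h0 hr
      refine ⟨fun a b h => ?_, h2.lift k hx hy⟩
      obtain ⟨a', b', h3, rfl, rfl⟩ := h.descend k hx hy
      rcases h1 _ _ h3 with h4 | h4 <;> rw [← h4] <;> simp

/-! ### Flow lines on the golden L -/

theorem mem_openSegment_horizontal {a b c : ℝ} (h : a < b) (z : ℂ) :
    z ∈ openSegment ℝ (⟨a, c⟩ : ℂ) ⟨b, c⟩ ↔ z.im = c ∧ a < z.re ∧ z.re < b := by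
  constructor
  · rintro ⟨p, q, hp, hq, hpq, rfl⟩
    simp
    obtain rfl : p = 1 - q := by linarith
    refine ⟨by ring, ?_, ?_⟩ <;> nlinarith
  · rintro ⟨rfl, h1, h2⟩
    have h3 : b - a ≠ 0 := by linarith
    refine ⟨(b - z.re) / (b - a), (z.re - a) / (b - a), div_pos (by linarith) (by linarith),
      div_pos (by linarith) (by linarith), by field_simp; ring, ?_⟩
    apply Complex.ext <;>
      simp only [Complex.add_re, Complex.add_im, Complex.smul_re, Complex.smul_im, smul_eq_mul] <;>
      field_simp <;> ring

theorem mem_openSegment_vertical {a b c : ℝ} (h : a < b) (z : ℂ) :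
    z ∈ openSegment ℝ (⟨c, a⟩ : ℂ) ⟨c, b⟩ ↔ z.re = c ∧ a < z.im ∧ z.im < b := by
  constructor
  · rintro ⟨p, q, hp, hq, hpq, rfl⟩
    simp
    obtain rfl : p = 1 - q := by linarith
    refine ⟨by ring, ?_, ?_⟩ <;> nlinarith
  · rintro ⟨rfl, h1, h2⟩
    have h3 : b - a ≠ 0 := by linarith
    refine ⟨(b - z.im) / (b - a), (z.im - a) / (b - a), div_pos (by linarith) (by linarith),
      div_pos (by linarith) (by linarith), by field_simp; ring, ?_⟩
    apply Complex.ext <;>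
      simp only [Complex.add_re, Complex.add_im, Complex.smul_re, Complex.smul_im, smul_eq_mul] <;>
      field_simp <;> ring

/-- The rectangle of a face of the golden L. -/
def toRect : Fin 3 → Rect := ![o, r, t]

/-- The face of the golden L that is a given rectangle. -/
def ofRect : Rect → Fin 3
  | o => 0 | r => 1 | t => 2

theorem toRect_ofRect (f : Rect) : toRect (ofRect f) = f := by cases f <;> rfl

/-- Abscissa of the left side. -/
def lx : Fin 3 → ℝ := ![0, 1, 0]

/-- Ordinate of the bottom side. -/
def ly : Fin 3 → ℝ := ![0, 0, 1]

theorem goldenL_vertex (f : Fin 3) :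
    goldenL.vertex f 0 = ⟨lx f, ly f⟩ ∧
    goldenL.vertex f 1 = ⟨lx f + (toRect f).wd, ly f⟩ ∧
    goldenL.vertex f 2 = ⟨lx f + (toRect f).wd, ly f + (toRect f).ht⟩ ∧
    goldenL.vertex f 3 = ⟨lx f, ly f + (toRect f).ht⟩ := by
  fin_cases f <;> simp [goldenL, goldenLVertex, lx, ly, toRect, Rect.wd, Rect.ht, φ]

theorem wd_pos (f : Rect) : 0 < f.wd := by
  have := one_lt_φ
  cases f <;> simp [Rect.wd, this]

theorem ht_pos (f : Rect) : 0 < f.ht := by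
  have := one_lt_φ
  cases f <;> simp [Rect.ht, this]

theorem mem_goldenL_side (f : Fin 3) (z : ℂ) :
    (z ∈ goldenL.side (f, 0) ↔ z.im = ly f ∧ lx f < z.re ∧ z.re < lx f + (toRect f).wd) ∧
    (z ∈ goldenL.side (f, 1) ↔
      z.re = lx f + (toRect f).wd ∧ ly f < z.im ∧ z.im < ly f + (toRect f).ht) ∧
    (z ∈ goldenL.side (f, 2) ↔
      z.im = ly f + (toRect f).ht ∧ lx f < z.re ∧ z.re < lx f + (toRect f).wd) ∧
    (z ∈ goldenL.side (f, 3) ↔ z.re = lx f ∧ ly f < z.im ∧ z.im < ly f + (toRect f).ht) := by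
  obtain ⟨h0, h1, h2, h3⟩ := goldenL_vertex f
  have hw := wd_pos (toRect f)
  have hh := ht_pos (toRect f)
  refine ⟨?_, ?_, ?_, ?_⟩ <;> simp only [GluedPolygons.side]
  · rw [h0, show (0 : Fin 4) + 1 = 1 from rfl, h1, mem_openSegment_horizontal (by linarith)]
  · rw [h1, show (1 : Fin 4) + 1 = 2 from rfl, h2, mem_openSegment_vertical (by linarith)]
  · rw [h2, show (2 : Fin 4) + 1 = 3 from rfl, h3, openSegment_symm,
      mem_openSegment_horizontal (by linarith)]
  · rw [h3, show (3 : Fin 4) + 1 = 0 from rfl, h0, openSegment_symm,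
      mem_openSegment_vertical (by linarith)]

/-- The rectangle that the flow enters through the top side. -/
def Rect.up : Rect → Rect
  | o => t | r => r | t => o

/-- The rectangle that the flow enters through the right side. -/
def Rect.right : Rect → Rect
  | o => r | r => o | t => t

theorem wd_up (f : Rect) : f.up.wd = f.wd := by cases f <;> rfl

theorem ht_right (f : Rect) : f.right.ht = f.ht := by cases f <;> rfl

theorem step_iff {x y p q a b} : Step x y p q a b ↔
    (0 < p.2 ∧ p.2 < p.1.wd * y ∧ q = (p.1.up, p.2 + p.1.up.ht * x) ∧ a = 0 ∧ b = p.1.ht) ∨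
    (p.1.wd * y < p.2 ∧ p.2 < p.1.len x y ∧ q = (p.1.right, p.2 - p.1.wd * y) ∧ a = p.1.wd ∧
      b = 0) := by
  constructor
  · intro h
    cases h
    · left; refine ⟨?_, ?_, Prod.ext rfl ?_, rfl, rfl⟩ <;> simp only [Rect.wd, Rect.ht, Rect.up] <;> linarith
    · right; refine ⟨?_, ?_, Prod.ext rfl ?_, rfl, rfl⟩ <;> simp only [Rect.wd, Rect.ht, Rect.len] <;> linarith
    · left; refine ⟨?_, ?_, Prod.ext rfl ?_, rfl, rfl⟩ <;> simp only [Rect.wd, Rect.ht, Rect.up] <;> linarith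
    · right; refine ⟨?_, ?_, Prod.ext rfl ?_, rfl, rfl⟩ <;> simp only [Rect.wd, Rect.ht, Rect.len] <;> linarith
    · left; refine ⟨?_, ?_, Prod.ext rfl ?_, rfl, rfl⟩ <;> simp only [Rect.wd, Rect.ht, Rect.up] <;> linarith
    · right; refine ⟨?_, ?_, Prod.ext rfl ?_, rfl, rfl⟩ <;> simp only [Rect.wd, Rect.ht, Rect.len] <;> linarith
  · obtain ⟨f, s⟩ := p
    rintro (⟨h1, h2, rfl, rfl, rfl⟩ | ⟨h1, h2, rfl, rfl, rfl⟩) <;> cases f <;>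
      simp only [Rect.wd, Rect.ht, Rect.up, Rect.right, Rect.len] at *
    · exact .u_o h1 (by linarith) rfl
    · exact .u_r h1 (by linarith) (by ring)
    · exact .u_t h1 (by linarith) (by ring)
    · exact .r_o (by linarith) (by linarith) (by ring)
    · exact .r_r (by linarith) (by linarith) (by ring)
    · exact .r_t (by linarith) (by linarith) (by ring)

/-- The transverse coordinate of a point of a face of the golden L. -/
def trans (x y : ℝ) (f : Fin 3) (z : ℂ) : ℝ :=
  x * ((toRect f).ht - (z.im - ly f)) + y * (z.re - lx f)

theorem goldenL_glue (f : Fin 3) :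
    toRect (goldenL.glue (f, 2)).1 = (toRect f).up ∧
    goldenL.shift (f, 2) = ⟨lx (goldenL.glue (f, 2)).1 - lx f,
      ly (goldenL.glue (f, 2)).1 - ly f - (toRect f).ht⟩ ∧
    toRect (goldenL.glue (f, 1)).1 = (toRect f).right ∧
    goldenL.shift (f, 1) = ⟨lx (goldenL.glue (f, 1)).1 - lx f - (toRect f).wd,
      ly (goldenL.glue (f, 1)).1 - ly f⟩ := by
  refine ⟨?_, ?_, ?_, ?_⟩ <;> fin_cases f <;>
    simp [goldenL, goldenLGlue, GluedPolygons.shift, goldenLVertex, lx, ly, toRect, Rect.up,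
      Rect.right, Rect.wd, Rect.ht, φ, Complex.ext_iff] <;> ring

/-- The transverse coordinate is constant along the flow inside a rectangle, so its value at the
entry tells whether the line leaves through the top or the right side. Exits through the bottom or
the left side are impossible, as both coordinates increase. The last two equations telescope along a
trajectory. -/
theorem golden_step {x y : ℝ} (hx : 0 < x) (hy : 0 < y) {f : Fin 3} {i : Fin 4} {z : ℂ} {t : ℝ}
    (ht : 0 < t) (hU : lx f ≤ z.re) (hV : ly f ≤ z.im)
    (h : z + t • (⟨x, y⟩ : ℂ) ∈ goldenL.side (f, i)) :
    ∃ g z' a b, g = (goldenL.glue (f, i)).1 ∧ z' = z + t • (⟨x, y⟩ : ℂ) + goldenL.shift (f, i) ∧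
      Step x y (toRect f, trans x y f z) (toRect g, trans x y g z') a b ∧
      lx g ≤ z'.re ∧ ly g ≤ z'.im ∧
      t * x = a + (z'.re - lx g) - (z.re - lx f) ∧ t * y = b + (z'.im - ly g) - (z.im - ly f) := by
  have h1 := mul_pos ht hx
  have h2 := mul_pos ht hy
  obtain ⟨m0, m1, m2, m3⟩ := mem_goldenL_side f (z + t • (⟨x, y⟩ : ℂ))
  obtain ⟨g1, g2, g3, g4⟩ := goldenL_glue f
  have hw := wd_pos (toRect f)
  have hh := ht_pos (toRect f)
  refine ⟨(goldenL.glue (f, i)).1, z + t • (⟨x, y⟩ : ℂ) + goldenL.shift (f, i), ?_⟩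
  have hi : i = 0 ∨ i = 1 ∨ i = 2 ∨ i = 3 := by fin_cases i <;> simp
  rcases hi with rfl | rfl | rfl | rfl
  · rw [m0] at h; simp at h; linarith
  · rw [m1] at h; simp at h
    refine ⟨(toRect f).wd, 0, rfl, rfl, step_iff.2 (.inr ⟨?_, ?_, ?_, rfl, rfl⟩), ?_, ?_, ?_, ?_⟩
    · simp only [trans]; nlinarith
    · simp only [trans, Rect.len]; nlinarith
    · rw [g3]; ext <;> simp [trans, g3, g4, ht_right]; linarith [h.1, mul_comm x y, show t * x = lx f + (toRect f).wd - z.re by linarith, show x * (t * y) = y * (t * x) by ring, show y * (t * x) = y * (lx f + (toRect f).wd - z.re) by rw [show t * x = lx f + (toRect f).wd - z.re by linarith]]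
    · simp [g4]; linarith
    · simp [g4]; linarith
    · simp [g4]; ring
    · simp [g4]; ring
  · rw [m2] at h; simp at h
    refine ⟨0, (toRect f).ht, rfl, rfl, step_iff.2 (.inl ⟨?_, ?_, ?_, rfl, rfl⟩), ?_, ?_, ?_, ?_⟩
    · simp only [trans]; nlinarith
    · simp only [trans]; nlinarith
    · rw [g1]; ext <;> simp [trans, g1, g2]; linarith [show x * (t * y) = y * (t * x) by ring, show x * (t * y) = x * (ly f + (toRect f).ht - z.im) by rw [show t * y = ly f + (toRect f).ht - z.im by linarith]]
    · simp [g2]; linarith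
    · simp [g2]; linarith
    · simp [g2]; ring
    · simp [g2]; ring
  · rw [m3] at h; simp at h; linarith

/-- The coded states of a periodic trajectory form a finite set in which the flow goes on for ever,
to which the descent applies. -/
theorem exists_word_of_periodic {x y : ℝ} (hx : 0 < x) (hy : 0 ≤ y)
    (h : goldenL.IsPeriodicDirection ⟨x, y⟩) :
    ∃ (u : List (Fin 4)) (r : ℝ), 0 < r ∧ u.head? ≠ some 0 ∧ vec u r = (x, y) := by
  rcases hy.eq_or_lt with rfl | hy'
  · exact ⟨[], x, hx, by simp, rfl⟩
  obtain ⟨τ, N, ⟨hN, hp⟩, -⟩ := h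
  set F : ℤ → Rect × ℝ := fun k => (toRect (τ.face k), trans x y (τ.face k) (τ.pt k)) with hF
  have hper : Function.Periodic F (N : ℤ) := fun k => by simp [hF, hp k]
  have hfin : (Set.range F).Finite := by
    rw [← hper.image_Ioc (by exact_mod_cast hN) 0]
    exact (Set.finite_Ioc _ _).image F
  refine exists_word_of_flows (Set.range F).ncard hx hy (O := Set.range F) ?_ hfin
    (Set.range_nonempty F) le_rfl
  rintro _ ⟨k, rfl⟩
  have hin : lx (τ.face k) ≤ (τ.pt k).re ∧ ly (τ.face k) ≤ (τ.pt k).im := by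
    obtain ⟨m0, m1, m2, m3⟩ := mem_goldenL_side (τ.face k) (τ.pt k)
    have hm := τ.pt_mem k
    have hw := wd_pos (toRect (τ.face k))
    have hh := ht_pos (toRect (τ.face k))
    have hi : τ.sideIn k = 0 ∨ τ.sideIn k = 1 ∨ τ.sideIn k = 2 ∨ τ.sideIn k = 3 := by
      generalize τ.sideIn k = i
      fin_cases i <;> simp
    rcases hi with h | h | h | h <;> rw [h] at hm
    · rw [m0] at hm; constructor <;> linarith
    · rw [m1] at hm; constructor <;> linarith
    · rw [m2] at hm; constructor <;> linarith
    · rw [m3] at hm; constructor <;> linarith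
  obtain ⟨g, z', a, b, h1, h2, h3, -⟩ :=
    golden_step hx hy' (τ.time_pos k) hin.1 hin.2 (τ.exit_mem k)
  refine ⟨F (k + 1), ⟨k + 1, rfl⟩, a, b, ?_⟩
  rw [← τ.next_pt k] at h2
  have h4 : g = τ.face (k + 1) := by rw [h1, ← τ.next_side k]
  rw [h2, h4] at h3
  exact h3

theorem saddle_of_isSaddleVector {x y : ℝ} (hx : 0 < x) (hy : 0 < y)
    (h : goldenL.IsSaddleVector ⟨x, y⟩) : Saddle x y x y := by
  obtain ⟨-, m, f, z, t, ⟨i, hi⟩, ht, hstep, ⟨j, hj⟩, hsum⟩ := h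
  have hver : ∀ g i, (goldenL.vertex g i).re = lx g ∨
      (goldenL.vertex g i).re = lx g + (toRect g).wd := by
    intro g i
    obtain ⟨v0, v1, v2, v3⟩ := goldenL_vertex g
    have hi : i = 0 ∨ i = 1 ∨ i = 2 ∨ i = 3 := by fin_cases i <;> simp
    rcases hi with rfl | rfl | rfl | rfl <;> simp [*]
  have hver' : ∀ g i, (goldenL.vertex g i).im = ly g ∨
      (goldenL.vertex g i).im = ly g + (toRect g).ht := by
    intro g i
    obtain ⟨v0, v1, v2, v3⟩ := goldenL_vertex g
    have hi : i = 0 ∨ i = 1 ∨ i = 2 ∨ i = 3 := by fin_cases i <;> simp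
    rcases hi with rfl | rfl | rfl | rfl <;> simp [*]
  have key : ∀ k ≤ m, ∃ c d, Path x y k (toRect (f 0), trans x y (f 0) (z 0))
      (toRect (f k), trans x y (f k) (z k)) c d ∧ lx (f k) ≤ (z k).re ∧ ly (f k) ≤ (z k).im ∧
      (∑ l ∈ Finset.range k, t l) * x = c + ((z k).re - lx (f k)) - ((z 0).re - lx (f 0)) ∧
      (∑ l ∈ Finset.range k, t l) * y = d + ((z k).im - ly (f k)) - ((z 0).im - ly (f 0)) := by
    intro k
    induction k with
    | zero =>
      intro _
      refine ⟨0, 0, .nil _, ?_, ?_, by simp, by simp⟩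
      · have := wd_pos (toRect (f 0))
        rcases hver (f 0) i with h | h <;> rw [hi, h] <;> linarith
      · have := ht_pos (toRect (f 0))
        rcases hver' (f 0) i with h | h <;> rw [hi, h] <;> linarith
    | succ k ih =>
      intro hk
      obtain ⟨c, d, hP, hU, hV, hs, hs'⟩ := ih (by omega)
      obtain ⟨i', h1, h2, h3⟩ := hstep k (by omega)
      obtain ⟨g, z', a, b, e1, e2, e3, e4, e5, e6, e7⟩ := golden_step hx hy (ht k (by omega)) hU hV h1
      rw [← h2] at e1
      rw [← h3] at e2
      subst e1 e2
      refine ⟨_, _, hP.trans (.cons e3 (.nil _)), e4, e5, ?_, ?_⟩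
      · rw [Finset.sum_range_succ, add_mul, hs, e6]; ring
      · rw [Finset.sum_range_succ, add_mul, hs', e7]; ring
  obtain ⟨c, d, hP, hU, hV, hs, hs'⟩ := key m le_rfl
  have h1 := mul_pos (ht m le_rfl) hx
  have h2 := mul_pos (ht m le_rfl) hy
  -- Both coordinates exceed those of the lower left corner, so the last vertex is the upper right
  -- corner.
  have hj1 : (z m).re + t m * x = lx (f m) + (toRect (f m)).wd := by
    have := congrArg Complex.re hj
    simp at this
    rcases hver (f m) j with h | h <;> rw [h] at this <;> linarith
  have hj2 : (z m).im + t m * y = ly (f m) + (toRect (f m)).ht := by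
    have := congrArg Complex.im hj
    simp at this
    rcases hver' (f m) j with h | h <;> rw [h] at this <;> linarith
  have hend : (toRect (f m), trans x y (f m) (z m)) = final x y (toRect (f m)) := by
    ext
    · rfl
    · simp only [trans, final]
      rw [show (toRect (f m)).ht - ((z m).im - ly (f m)) = t m * y by linarith,
        show (z m).re - lx (f m) = (toRect (f m)).wd - t m * x by linarith]
      ring
  have hstart : (z 0).re = lx (f 0) ∧ (z 0).im = ly (f 0) := by
    rcases Nat.eq_zero_or_pos m with rfl | hm
    · constructor
      · rcases hver (f 0) i with h | h <;> rw [hi] at * <;> linarith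
      · rcases hver' (f 0) i with h | h <;> rw [hi] at * <;> linarith
    · obtain ⟨q, a, b, hq⟩ := hP.exists_step hm.ne'
      have hw := wd_pos (toRect (f 0))
      have hh := ht_pos (toRect (f 0))
      rw [step_iff] at hq
      simp only [trans, Rect.len] at hq
      rw [hi] at hq ⊢
      have h3 := mul_pos hx hh
      have h4 := mul_pos hy hw
      -- At the corners other than the lower left one the transverse coordinate is 0, `wd * y` or
      -- the full width, and no step starts from such a state.
      rcases hver (f 0) i with h | h <;> rcases hver' (f 0) i with h' | h' <;> rw [h, h'] at hq ⊢
      · exact ⟨rfl, rfl⟩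
      all_goals
        exfalso
        simp only [add_sub_cancel_left, sub_self, sub_zero, mul_zero, add_zero] at hq
        rcases hq with ⟨q1, q2, -⟩ | ⟨q1, q2, -⟩ <;> linarith
  have hst : (toRect (f 0), trans x y (f 0) (z 0)) = start x y (toRect (f 0)) := by
    ext
    · rfl
    · simp only [trans, start, hstart]; ring
  rw [hend, hst] at hP
  rw [Finset.sum_range_succ] at hsum
  rw [show (∑ l ∈ Finset.range m, t l) = 1 - t m by linarith, hstart.1] at hs
  rw [show (∑ l ∈ Finset.range m, t l) = 1 - t m by linarith, hstart.2] at hs'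
  exact ⟨_, _, m, c, d, hP, by linarith, by linarith⟩

/-! ### From coded flow lines back to segments on the golden L -/

/-- The point where a flow line enters a rectangle. -/
def entry (x y : ℝ) (p : Rect × ℝ) : ℂ :=
  if p.2 ≤ p.1.ht * x then ⟨lx (ofRect p.1), ly (ofRect p.1) + p.1.ht - p.2 / x⟩
  else ⟨lx (ofRect p.1) + (p.2 - p.1.ht * x) / y, ly (ofRect p.1)⟩

/-- Converse of `golden_step`. Only the horizontal displacement is recorded, since `x > 0` lets it
determine the total time. -/
theorem entry_step {x y : ℝ} (hx : 0 < x) (hy : 0 < y) {p q a b} (h : Step x y p q a b) :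
    ∃ (t : ℝ) (i : Fin 4), 0 < t ∧
      entry x y p + t • (⟨x, y⟩ : ℂ) ∈ goldenL.side (ofRect p.1, i) ∧
      ofRect q.1 = (goldenL.glue (ofRect p.1, i)).1 ∧
      entry x y q = entry x y p + t • (⟨x, y⟩ : ℂ) + goldenL.shift (ofRect p.1, i) ∧
      t * x = a + ((entry x y q).re - lx (ofRect q.1)) - ((entry x y p).re - lx (ofRect p.1)) := by
  obtain ⟨m0, m1, m2, m3⟩ := mem_goldenL_side (ofRect p.1) (0 : ℂ)
  have hm1 := fun z => (mem_goldenL_side (ofRect p.1) z).2.1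
  have hm2 := fun z => (mem_goldenL_side (ofRect p.1) z).2.2.1
  obtain ⟨g1, g2, g3, g4⟩ := goldenL_glue (ofRect p.1)
  rw [toRect_ofRect] at *
  have e1 : (goldenL.glue (ofRect p.1, 2)).1 = ofRect p.1.up := by cases p.1 <;> rfl
  have e2 : (goldenL.glue (ofRect p.1, 1)).1 = ofRect p.1.right := by cases p.1 <;> rfl
  have hw := wd_pos p.1
  have hh := ht_pos p.1
  have hh' := ht_pos p.1.up
  have hhr := ht_right p.1
  obtain ⟨F, s⟩ := p
  simp only at *
  rw [e1] at g2
  rw [e2] at g4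
  rw [step_iff] at h
  rcases h with ⟨h1, h2, rfl, rfl, rfl⟩ | ⟨h1, h2, rfl, rfl, rfl⟩ <;> simp only at *
  · have hq : entry x y (F.up, s + F.up.ht * x) = ⟨lx (ofRect F.up) + s / y, ly (ofRect F.up)⟩ := by
      simp only [entry]
      rw [if_neg (by linarith)]
      simp
    rw [hq]
    by_cases hs : s ≤ F.ht * x
    · have hp : entry x y (F, s) = ⟨lx (ofRect F), ly (ofRect F) + F.ht - s / x⟩ := by
        simp only [entry]
        rw [if_pos hs]
      rw [hp]
      refine ⟨s / y / x, 2, by positivity, ?_, e1.symm, ?_, ?_⟩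
      · rw [hm2]
        refine ⟨?_, ?_, ?_⟩
        · simp; field_simp; ring
        · simp; positivity
        · simp; field_simp; linarith
      · rw [g2]; apply Complex.ext <;> simp <;> field_simp <;> ring
      · simp; field_simp
    · have hp : entry x y (F, s) = ⟨lx (ofRect F) + (s - F.ht * x) / y, ly (ofRect F)⟩ := by
        simp only [entry]
        rw [if_neg hs]
      rw [hp]
      refine ⟨F.ht / y, 2, by positivity, ?_, e1.symm, ?_, ?_⟩
      · rw [hm2]
        refine ⟨?_, ?_, ?_⟩
        · simp; field_simp
        · simp; field_simp; linarith
        · simp; field_simp; linarith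
      · rw [g2]; apply Complex.ext <;> simp <;> field_simp <;> ring
      · simp; field_simp; ring
  · have hq : entry x y (F.right, s - F.wd * y) =
        ⟨lx (ofRect F.right), ly (ofRect F.right) + F.ht - (s - F.wd * y) / x⟩ := by
      simp only [entry]
      rw [if_pos (by rw [ht_right]; simp only [Rect.len] at h2; linarith), ht_right]
    rw [hq]
    simp only [Rect.len] at h2
    by_cases hs : s ≤ F.ht * x
    · have hp : entry x y (F, s) = ⟨lx (ofRect F), ly (ofRect F) + F.ht - s / x⟩ := by
        simp only [entry]
        rw [if_pos hs]
      rw [hp]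
      refine ⟨F.wd / x, 1, by positivity, ?_, e2.symm, ?_, ?_⟩
      · rw [hm1]
        refine ⟨?_, ?_, ?_⟩
        · simp; field_simp
        · simp; field_simp; linarith
        · simp; field_simp; linarith
      · rw [g4]; apply Complex.ext <;> simp <;> field_simp <;> ring
      · simp; field_simp
    · have hp : entry x y (F, s) = ⟨lx (ofRect F) + (s - F.ht * x) / y, ly (ofRect F)⟩ := by
        simp only [entry]
        rw [if_neg hs]
      rw [hp]
      obtain ⟨t, ht⟩ : ∃ t : ℝ, t = (F.wd * y + F.ht * x - s) / (x * y) := ⟨_, rfl⟩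
      have ht0 : 0 < t := by rw [ht]; exact div_pos (by linarith) (by positivity)
      have htx : t * x = (F.wd * y + F.ht * x - s) / y := by rw [ht]; field_simp
      have hty : t * y = (F.wd * y + F.ht * x - s) / x := by rw [ht]; field_simp
      refine ⟨t, 1, ht0, ?_, e2.symm, ?_, ?_⟩
      · rw [hm1]
        refine ⟨?_, ?_, ?_⟩
        · simp; rw [htx]; field_simp; ring
        · simp; positivity
        · simp; rw [hty]; field_simp; linarith
      · rw [g4]; apply Complex.ext <;> simp
        · rw [htx]; field_simp; ring
        · rw [hty]; field_simp; ring
      · simp; rw [htx]; field_simp; ring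

/-- A straight segment in direction `v` that starts at the point `z` of the face `g` and ends at
a vertex after time `T`. -/
def RunsToVertex (v : ℂ) (g : Fin 3) (z : ℂ) (T : ℝ) : Prop :=
  ∃ (m : ℕ) (f : ℕ → Fin 3) (x : ℕ → ℂ) (t : ℕ → ℝ), f 0 = g ∧ x 0 = z ∧
    (∀ k ≤ m, 0 < t k) ∧
    (∀ k < m, ∃ i, x k + t k • v ∈ goldenL.side (f k, i) ∧ f (k + 1) = (goldenL.glue (f k, i)).1 ∧
      x (k + 1) = x k + t k • v + goldenL.shift (f k, i)) ∧
    (∃ j, x m + t m • v = goldenL.vertex (f m) j) ∧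
    ∑ k ∈ Finset.range (m + 1), t k = T

theorem RunsToVertex.cons {v z : ℂ} {g : Fin 3} {T s : ℝ} {i : Fin 4} (hs : 0 < s)
    (hi : z + s • v ∈ goldenL.side (g, i))
    (h : RunsToVertex v (goldenL.glue (g, i)).1 (z + s • v + goldenL.shift (g, i)) T) :
    RunsToVertex v g z (s + T) := by
  obtain ⟨m, f, x, t, h0, h1, h2, h3, h4, h5⟩ := h
  refine ⟨m + 1, fun k => Nat.casesOn k g f, fun k => Nat.casesOn k z x,
    fun k => Nat.casesOn k s t, rfl, rfl, ?_, ?_, h4, ?_⟩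
  · rintro (_ | k) hk
    · exact hs
    · exact h2 k (by omega)
  · rintro (_ | k) hk
    · exact ⟨i, hi, h0, h1⟩
    · exact h3 k (by omega)
  · rw [Finset.sum_range_succ', h5]
    exact add_comm _ _

theorem runsToVertex_of_path {x y : ℝ} (hx : 0 < x) (hy : 0 < y) {n p q c d}
    (h : Path x y n p q c d) : ∀ g, q = final x y g → ∃ T, RunsToVertex ⟨x, y⟩ (ofRect p.1) (entry x y p) T ∧
      T * x = c + g.wd - ((entry x y p).re - lx (ofRect p.1)) := by
  induction h with
  | nil p =>
    rintro g rfl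
    have hw := wd_pos g
    have hh := ht_pos g
    obtain ⟨-, -, v2, -⟩ := goldenL_vertex (ofRect g)
    rw [toRect_ofRect] at v2
    simp only [final]
    by_cases hs : g.wd * y ≤ g.ht * x
    · have hp : entry x y (g, g.wd * y) = ⟨lx (ofRect g), ly (ofRect g) + g.ht - g.wd * y / x⟩ := by
        simp only [entry]
        rw [if_pos hs]
      rw [hp]
      refine ⟨g.wd / x, ⟨0, fun _ => ofRect g, fun _ => _, fun _ => g.wd / x, rfl, rfl,
        fun _ _ => by positivity, by simp, ⟨2, ?_⟩, by simp⟩, by simp; field_simp⟩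
      rw [v2]; apply Complex.ext <;> simp <;> field_simp <;> ring
    · have hp : entry x y (g, g.wd * y) =
          ⟨lx (ofRect g) + (g.wd * y - g.ht * x) / y, ly (ofRect g)⟩ := by
        simp only [entry]
        rw [if_neg hs]
      rw [hp]
      refine ⟨g.ht / y, ⟨0, fun _ => ofRect g, fun _ => _, fun _ => g.ht / y, rfl, rfl,
        fun _ _ => by positivity, by simp, ⟨2, ?_⟩, by simp⟩, by simp; field_simp; ring⟩
      rw [v2]; apply Complex.ext <;> simp <;> field_simp <;> ring
  | cons hs _ ih =>
    rintro g rfl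
    obtain ⟨T, hT, h1⟩ := ih g rfl
    obtain ⟨t, i, e1, e2, e3, e4, e5⟩ := entry_step hx hy hs
    rw [e4, e3] at hT
    exact ⟨t + T, hT.cons e1 e2, by rw [add_mul, h1, e5]; ring⟩

theorem isSaddleVector_of_saddle {x y : ℝ} (hx : 0 < x) (hy : 0 < y) (h : Saddle x y x y) :
    goldenL.IsSaddleVector ⟨x, y⟩ := by
  obtain ⟨f, g, n, c, d, hP, h1, h2⟩ := h
  obtain ⟨T, ⟨m, F, z, t, f0, z0, k1, k2, k3, k4⟩, hT⟩ := runsToVertex_of_path hx hy hP g rfl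
  have he : entry x y (start x y f) = goldenL.vertex (ofRect f) 0 := by
    rw [(goldenL_vertex _).1]
    have : entry x y (start x y f) =
        ⟨lx (ofRect f), ly (ofRect f) + f.ht - f.ht * x / x⟩ := if_pos le_rfl
    rw [this, mul_div_cancel_right₀ _ hx.ne', add_sub_cancel_right]
  have hT1 : T = 1 := by
    rw [he, (goldenL_vertex _).1, ← h1] at hT
    simp [start] at hT
    exact mul_right_cancel₀ hx.ne' (hT.trans (one_mul x).symm)
  refine ⟨fun h => hx.ne' (congrArg Complex.re h), m, F, z, t, ⟨0, ?_⟩, k1, k2, k3, by rw [k4, hT1]⟩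
  rw [z0, he, f0]; rfl

/-- A horizontal segment from a vertex stays on horizontal edges. It can only hop between the two
glued copies of its edge, which have the same width, and no width exceeds 1. -/
theorem horizontal_saddle_le {x : ℝ} (hx : 0 < x) (h : goldenL.IsSaddleVector ⟨x, 0⟩) : x ≤ 1 := by
  obtain ⟨-, m, f, z, t, ⟨i, hi⟩, ht, hstep, ⟨j, hj⟩, hsum⟩ := h
  have hver : ∀ g i, ((goldenL.vertex g i).re = lx g ∨
      (goldenL.vertex g i).re = lx g + (toRect g).wd) ∧ ((goldenL.vertex g i).im = ly g ∨
      (goldenL.vertex g i).im = ly g + (toRect g).ht) := by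
    intro g i
    obtain ⟨v0, v1, v2, v3⟩ := goldenL_vertex g
    have hi : i = 0 ∨ i = 1 ∨ i = 2 ∨ i = 3 := by fin_cases i <;> simp
    rcases hi with rfl | rfl | rfl | rfl <;> simp [*]
  have key : ∀ k ≤ m, lx (f k) ≤ (z k).re ∧ ((z k).im = ly (f k) ∨
      (z k).im = ly (f k) + (toRect (f k)).ht) ∧ (∑ l ∈ Finset.range k, t l) * x =
      ((z k).re - lx (f k)) - ((z 0).re - lx (f 0)) ∧ (toRect (f k)).wd = (toRect (f 0)).wd := by
    intro k
    induction k with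
    | zero =>
      intro _
      have := wd_pos (toRect (f 0))
      obtain ⟨h, h'⟩ := hver (f 0) i
      exact ⟨by rcases h with h | h <;> rw [hi, h] <;> linarith, by rw [hi]; exact h', by simp, rfl⟩
    | succ k ih =>
      intro hk
      obtain ⟨hU, hV, hs, hw⟩ := ih (by omega)
      obtain ⟨i', h1, h2, h3⟩ := hstep k (by omega)
      have h4 := mul_pos (ht k (by omega)) hx
      obtain ⟨m0, m1, m2, m3⟩ := mem_goldenL_side (f k) (z k + t k • (⟨x, 0⟩ : ℂ))
      have hh := ht_pos (toRect (f k))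
      have hi : i' = 0 ∨ i' = 1 ∨ i' = 2 ∨ i' = 3 := by fin_cases i' <;> simp
      obtain ⟨g1, g2, -, -⟩ := goldenL_glue (f k)
      rcases hi with rfl | rfl | rfl | rfl
      · rw [m0] at h1
        have e : toRect (goldenL.glue (f k, 0)).1 = (toRect (f k)).up ∧
            goldenL.shift (f k, 0) = ⟨lx (goldenL.glue (f k, 0)).1 - lx (f k),
              ly (goldenL.glue (f k, 0)).1 - ly (f k) +
                (toRect (goldenL.glue (f k, 0)).1).ht⟩ := by
          generalize f k = g
          constructor <;> fin_cases g <;>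
            simp [goldenL, goldenLGlue, GluedPolygons.shift, goldenLVertex, lx, ly, toRect,
              Rect.up, Rect.ht, φ, Complex.ext_iff]
        rw [h3, h2, e.2, Finset.sum_range_succ, add_mul, hs, e.1, wd_up, hw]
        simp at h1 ⊢
        exact ⟨by linarith, .inr (by linarith), by linarith⟩
      · rw [m1] at h1
        simp at h1
        rcases hV with hV | hV <;> linarith
      · rw [m2] at h1
        rw [h3, h2, g2, Finset.sum_range_succ, add_mul, hs, g1, wd_up, hw]
        simp at h1 ⊢
        exact ⟨by linarith, .inl (by linarith), by linarith⟩
      · rw [m3] at h1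
        simp at h1
        rcases hV with hV | hV <;> linarith
  obtain ⟨hU, hV, hs, hw⟩ := key m le_rfl
  have h0 := (key 0 (by omega)).1
  have h1 := mul_pos (ht m le_rfl) hx
  have hj1 := congrArg Complex.re hj
  simp at hj1
  have hj2 := (hver (f m) j).1
  have hwd : (toRect (f 0)).wd ≤ 1 := by
    have := φ_lt
    cases toRect (f 0) <;> simp [Rect.wd]
    linarith
  rw [Finset.sum_range_succ] at hsum
  rw [show (∑ l ∈ Finset.range m, t l) = 1 - t m by linarith] at hs
  rcases hj2 with h | h <;> rw [h] at hj1 <;> linarith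

theorem isSaddleVector_one : goldenL.IsSaddleVector ⟨1, 0⟩ := by
  refine ⟨fun h => one_ne_zero (congrArg Complex.re h), 0, fun _ => 0, fun _ => goldenL.vertex 0 0,
    fun _ => 1, ⟨0, rfl⟩, by simp, by simp, ⟨1, ?_⟩, by simp⟩
  simp [goldenL, goldenLVertex, Complex.ext_iff]

/-- The vector of a tree word as a point of the plane. -/
def vecC (u : List (Fin 4)) (r : ℝ) : ℂ := ⟨(vec u r).1, (vec u r).2⟩

theorem vecC_mul (u : List (Fin 4)) (c r : ℝ) : vecC u (c * r) = c • vecC u r := by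
  simp [vecC, vec_mul, Complex.ext_iff]

theorem vecC_ne_zero (u : List (Fin 4)) {r : ℝ} (hr : 0 < r) : vecC u r ≠ 0 := fun h =>
  (vec_pos u hr).1.ne' (congrArg Complex.re h)

/-- For a nonempty word `saddle_vec` leaves only the parameters 1 and φ - 1; the empty word is the
horizontal direction, with the edge of length 1. -/
theorem isSaddleVector_vecC {u : List (Fin 4)} (hu : u.head? ≠ some 0) :
    goldenL.IsSaddleVector (vecC u 1) ∧ ∀ r, 0 < r → goldenL.IsSaddleVector (vecC u r) → r ≤ 1 := by
  by_cases h : u = []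
  · subst h
    exact ⟨isSaddleVector_one, fun r hr h => horizontal_saddle_le hr h⟩
  · refine ⟨isSaddleVector_of_saddle (vec_pos u one_pos).1 (vec_snd_pos hu h one_pos)
      (saddle_vec hu h one_pos).2, fun r hr hs => ?_⟩
    have h1 := (vec_pos u one_pos).1
    have h2 := saddle_of_isSaddleVector (vec_pos u hr).1 (vec_snd_pos hu h hr) hs
    rcases (saddle_vec hu h hr).1 _ _ h2 with h3 | h3
    · rw [← mul_one r, vec_mul] at h3
      have := congrArg Prod.fst h3
      simp only at this
      nlinarith
    · rw [← mul_one r, vec_mul, ← mul_one (φ - 1), vec_mul] at h3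
      have := congrArg Prod.fst h3
      simp only at this
      have := φ_lt
      nlinarith

/-- The long saddle connection vector in the direction of a tree word. -/
theorem isLongSaddleVector_iff {u : List (Fin 4)} (hu : u.head? ≠ some 0) {r : ℝ} (hr : 0 < r)
    (v : ℂ) : goldenL.IsLongSaddleVector (vecC u r) v ↔ v = vecC u 1 := by
  obtain ⟨h1, h2⟩ := isSaddleVector_vecC hu
  have hr1 : vecC u r = r • vecC u 1 := by rw [← vecC_mul, mul_one]
  have hpos : 0 < ‖vecC u 1‖ := norm_pos_iff.2 (vecC_ne_zero u one_pos)
  have hmax : ∀ v', goldenL.IsSaddleVector v' → (∃ s : ℝ, 0 < s ∧ v' = s • vecC u r) →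
      ∃ s : ℝ, 0 < s ∧ s ≤ 1 ∧ v' = s • vecC u 1 := by
    rintro v' hv' ⟨s, hs, rfl⟩
    refine ⟨s * r, by positivity, h2 _ (by positivity) ?_, by rw [hr1, smul_smul]⟩
    rwa [vecC_mul]
  have h3 : ∃ s : ℝ, 0 < s ∧ vecC u 1 = s • vecC u r :=
    ⟨r⁻¹, by positivity, by rw [hr1, smul_smul, inv_mul_cancel₀ hr.ne', one_smul]⟩
  constructor
  · rintro ⟨hv, hs, hm⟩
    obtain ⟨s, hs0, hs1, rfl⟩ := hmax v hv hs
    have := hm _ h1 h3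
    rw [norm_smul, Real.norm_of_nonneg hs0.le] at this
    rw [show s = 1 by nlinarith, one_smul]
  · rintro rfl
    refine ⟨h1, h3, fun v' hv' hs' => ?_⟩
    obtain ⟨s, hs0, hs1, rfl⟩ := hmax v' hv' hs'
    rw [norm_smul, Real.norm_of_nonneg hs0.le]
    nlinarith

/-! ### Coordinates for the regular pentagon -/

/-- The sine of `π / 5`. -/
def sn : ℝ := Real.sin (Real.pi / 5)

theorem cos_eq : Real.cos (Real.pi / 5) = φ / 2 := by
  rw [Real.cos_pi_div_five, φ, Real.goldenRatio]; ring

theorem sn_pos : 0 < sn := Real.sin_pos_of_pos_of_lt_pi (by positivity) (by linarith [Real.pi_pos])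

theorem sn_mul_self : sn * sn = (3 - φ) / 4 := by
  have h := Real.sin_sq_add_cos_sq (Real.pi / 5)
  rw [cos_eq] at h
  have h' := φ_mul_self
  have : sn * sn = Real.sin (Real.pi / 5) ^ 2 := by rw [sn, sq]
  linarith [sq φ, div_pow φ 2 2]

/-- The primitive fifth root of unity. -/
def ζ : ℂ := Complex.exp (2 * Real.pi * Complex.I / 5)

theorem ζ_eq : ζ = ⟨(φ - 1) / 2, φ * sn⟩ := by
  have h : ζ = Complex.exp (((2 * (Real.pi / 5) : ℝ) : ℂ) * Complex.I) := by
    rw [ζ]; congr 1; push_cast; ring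
  have h' := φ_mul_self
  rw [h]
  apply Complex.ext
  · rw [Complex.exp_ofReal_mul_I_re, Real.cos_two_mul, cos_eq]
    linarith [sq φ, div_pow φ 2 2]
  · rw [Complex.exp_ofReal_mul_I_im, Real.sin_two_mul, cos_eq, sn]
    ring

theorem ζ_sq : ζ ^ 2 = ⟨-φ / 2, sn⟩ := by
  rw [sq, ζ_eq]
  have h' := φ_mul_self
  have h := sn_mul_self
  apply Complex.ext
  · simp only [Complex.mul_re]
    rw [show φ * sn * (φ * sn) = (φ * φ) * (sn * sn) by ring, h, h']; linarith
  · simp only [Complex.mul_im]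
    linear_combination sn * h'

theorem ζ_cube : ζ ^ 3 = ⟨-φ / 2, -sn⟩ := by
  rw [pow_succ, ζ_sq, ζ_eq]
  have h' := φ_mul_self
  have h := sn_mul_self
  apply Complex.ext
  · simp only [Complex.mul_re]
    linear_combination -φ * h
  · simp only [Complex.mul_im]
    linear_combination (-sn / 2) * h'

theorem ζ_four : ζ ^ 4 = ⟨(φ - 1) / 2, -(φ * sn)⟩ := by
  rw [pow_succ, ζ_cube, ζ_eq]
  have h' := φ_mul_self
  have h := sn_mul_self
  apply Complex.ext
  · simp only [Complex.mul_re]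
    linear_combination φ * h - h' / 2
  · simp only [Complex.mul_im]
    linear_combination (-sn / 2) * h'

theorem ζ_five : ζ ^ 5 = 1 := by
  rw [pow_succ, ζ_four, ζ_eq]
  have h' := φ_mul_self
  have h := sn_mul_self
  apply Complex.ext
  · simp only [Complex.mul_re, Complex.one_re]
    linear_combination φ * φ * h + (3 / 4 - φ / 4) * h'
  · simp only [Complex.mul_im, Complex.one_im]
    ring

/-- The image of `[a, b]` under `P`, as a point of the plane. -/
def pl (a b : ℝ) : ℂ := ⟨a + b * (φ / 2), b * sn⟩

theorem toPlane_P (v : Fin 2 → ℝ) : toPlane (P *ᵥ v) = pl (v 0) (v 1) := by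
  apply Complex.ext
  · simp [toPlane, P, pl, Matrix.mulVec, dotProduct, Fin.sum_univ_two, cos_eq, -Real.cos_pi_div_five,
      mul_comm]
  · simp [toPlane, P, pl, Matrix.mulVec, dotProduct, Fin.sum_univ_two, sn, mul_comm]

theorem pl_add (a b c d : ℝ) : pl (a + c) (b + d) = pl a b + pl c d := by
  apply Complex.ext <;> simp [pl] <;> ring

theorem pl_sub (a b c d : ℝ) : pl (a - c) (b - d) = pl a b - pl c d := by
  apply Complex.ext <;> simp [pl] <;> ring

theorem pl_smul (t a b : ℝ) : pl (t * a) (t * b) = t • pl a b := by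
  apply Complex.ext <;> simp [pl] <;> ring

theorem pl_injective {a b c d : ℝ} (h : pl a b = pl c d) : a = c ∧ b = d := by
  have h1 := congrArg Complex.re h
  have h2 := mul_right_cancel₀ sn_pos.ne' (congrArg Complex.im h)
  simp only [pl] at h1
  subst h2
  exact ⟨by linarith, rfl⟩

theorem exists_pl (z : ℂ) : ∃ a b, z = pl a b := by
  have := sn_pos.ne'
  refine ⟨z.re - z.im / sn * (φ / 2), z.im / sn, ?_⟩
  apply Complex.ext <;> simp [pl]
  field_simp

/-- Here 2φ - 1 = √5; the circumradius becomes a polynomial in φ and `sn`. -/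
theorem sn_inv : (2 * Real.sin (2 * Real.pi / 5))⁻¹ = 2 * (2 * φ - 1) * sn / 5 := by
  have h : Real.sin (2 * Real.pi / 5) = φ * sn := by
    rw [show 2 * Real.pi / 5 = 2 * (Real.pi / 5) by ring, Real.sin_two_mul, cos_eq, sn]; ring
  have h1 := sn_pos
  have h2 := one_lt_φ
  have h3 := sn_mul_self
  have h4 := φ_mul_self
  rw [h, inv_eq_of_mul_eq_one_right]
  linear_combination (4 / 5) * φ * (2 * φ - 1) * h3 + (1 - 2 / 5 * φ) * h4

/-- With respect to the columns of P the vertices have coordinates in ℚ(φ), so the transverse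
distances of vertices become linear forms in x and y over ℤ[φ]. -/
theorem pent_eq (k : Fin 5) : pent k =
    pl (![-(φ + 2) / 5, -(φ + 2) / 5, (3 - φ) / 5, (4 * φ - 2) / 5, (3 - φ) / 5] k)
      (![(4 * φ - 2) / 5, (3 - φ) / 5, -(φ + 2) / 5, -(φ + 2) / 5, (3 - φ) / 5] k) := by
  have h : ∀ k : Fin 5, pent k = ((2 * (2 * φ - 1) * sn / 5 : ℝ) : ℂ) * Complex.I * ζ ^ (k : ℕ) := by
    intro k
    rw [pent, sn_inv, ζ]
  have h3 := sn_mul_self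
  have h4 := φ_mul_self
  rw [h]
  fin_cases k
  · apply Complex.ext
    · simp [pl]; linear_combination (-2 / 5) * h4
    · simp [pl]; ring
  · apply Complex.ext
    · simp [pl, ζ_eq]; linear_combination (-2 / 5) * (2 * φ - 1) * φ * h3 + (φ / 5 - 2 / 5) * h4
    · simp [pl, ζ_eq]; linear_combination (2 * sn / 5) * h4
  · apply Complex.ext
    · simp [pl, ζ_sq]; linear_combination (-2 / 5) * (2 * φ - 1) * h3 + (3 / 10) * h4
    · simp [pl, ζ_sq]; linear_combination (-2 * sn / 5) * h4
  · apply Complex.ext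
    · simp [pl, ζ_cube]; linear_combination (2 / 5) * (2 * φ - 1) * h3 - (1 / 10) * h4
    · simp [pl, ζ_cube]; linear_combination (-2 * sn / 5) * h4
  · apply Complex.ext
    · simp [pl, ζ_four]; linear_combination (2 / 5) * (2 * φ - 1) * φ * h3 + (3 / 5 - φ / 5) * h4
    · simp [pl, ζ_four]; linear_combination (2 * sn / 5) * h4

/-! ### The flow on the double pentagon, seen from its sides

The state `(f, i, s)` is a flow line in direction `(x, y)` (in the coordinates given by `P`) that
enters the face `f` through the side `i`; the number `s` is the transverse distance from the first
vertex of the face. -/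

/-- States of the flow on the double pentagon. -/
abbrev DState := Fin 2 × Fin 5 × ℝ

/-- Infimum of the transverse distance on a side of the pentagon. -/
def lo (x y : ℝ) : Fin 5 → ℝ
  | 0 => 0 | 1 => (φ - 1) * x | 2 => φ * x + y | 3 => (φ - 1) * x + y | 4 => 0

/-- Supremum of the transverse distance on a side of the pentagon. -/
def hi (x y : ℝ) : Fin 5 → ℝ
  | 0 => (φ - 1) * x | 1 => φ * x + y | 2 => φ * x + φ * y | 3 => φ * x + φ * y
  | 4 => (φ - 1) * x + y

/-- A flow line at transverse distance `s` crosses the pentagon from the side `i` to the side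
`j`. -/
structure DCross (x y : ℝ) (i j : Fin 5) (s : ℝ) : Prop where
  entry : i = 0 ∨ i = 1 ∨ i = 2
  exit : j = 3 ∨ j = 4
  lo_entry : lo x y i < s
  entry_hi : s < hi x y i
  lo_exit : lo x y j < s
  exit_hi : s < hi x y j

/-- The hyperelliptic involution: rotation of the sides about their midpoints. -/
def dinv (x y : ℝ) (e : DState) : DState := (e.1, e.2.1, lo x y e.2.1 + hi x y e.2.1 - e.2.2)

theorem dinv_dinv (x y : ℝ) (e : DState) : dinv x y (dinv x y e) = e := by
  simp [dinv]

/-- The flow passes from one side to the next one. -/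
inductive DStep (x y : ℝ) : DState → DState → Prop
  | zero {i j s} : DCross x y i j s → DStep x y (0, i, s) (1, j, lo x y j + hi x y j - s)
  | one {i j s} : DCross x y i j s → DStep x y (1, j, s) (0, i, lo x y i + hi x y i - s)

theorem DCross.exit_unique {x y i j s i' j'} (h : DCross x y i j s) (h' : DCross x y i' j' s) :
    j = j' := by
  obtain ⟨-, h1, -, -, h2, h3⟩ := h
  obtain ⟨-, h1', -, -, h2', h3'⟩ := h'
  rcases h1 with rfl | rfl <;> rcases h1' with rfl | rfl <;> simp only [lo, hi] at * <;> linarith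

theorem DCross.entry_unique {x y i j s i' j'} (hx : 0 < x) (hy : 0 ≤ y) (h : DCross x y i j s)
    (h' : DCross x y i' j' s) : i = i' := by
  obtain ⟨h1, -, h2, h3, -, -⟩ := h
  obtain ⟨h1', -, h2', h3', -, -⟩ := h'
  obtain ⟨h4, h5, h6⟩ := φ_mul_facts hx.le
  obtain ⟨h7, h8, h9⟩ := φ_mul_facts hy
  rcases h1 with rfl | rfl | rfl <;> rcases h1' with rfl | rfl | rfl <;>
    simp only [lo, hi] at * <;> linarith

theorem DStep.zero_of {x y i j s s'} (h : DCross x y i j s) (hs : s' = lo x y j + hi x y j - s) :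
    DStep x y (0, i, s) (1, j, s') := hs ▸ .zero h

theorem DStep.one_of {x y i j s s'} (h : DCross x y i j s) (hs : s' = lo x y i + hi x y i - s) :
    DStep x y (1, j, s) (0, i, s') := hs ▸ .one h

theorem DStep.det {x y e e₁ e₂} (hx : 0 < x) (hy : 0 ≤ y) (h : DStep x y e e₁)
    (h' : DStep x y e e₂) : e₁ = e₂ := by
  cases h with
  | zero h =>
    cases h' with
    | zero h' => rw [h.exit_unique h']
  | one h =>
    cases h' with
    | one h' => rw [h.entry_unique hx hy h']

/-- The involution exchanges the faces and reverses the flow, so a line entering through a side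
becomes one that, read backwards, leaves through it. Backward determinism thus follows from forward
determinism. -/
theorem DStep.dinv {x y e e'} (h : DStep x y e e') : DStep x y (dinv x y e') (dinv x y e) := by
  cases h with
  | zero h => simpa [PentBilliard.dinv] using DStep.one h
  | one h => simpa [PentBilliard.dinv] using DStep.zero h

theorem DStep.det_left {x y e e₁ e₂} (hx : 0 < x) (hy : 0 ≤ y) (h : DStep x y e₁ e)
    (h' : DStep x y e₂ e) : e₁ = e₂ := by
  rw [← dinv_dinv x y e₁, h.dinv.det hx hy h'.dinv, dinv_dinv]

theorem DStep.fst {x y e e'} (h : DStep x y e e') : e'.1 = e.1 + 1 := by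
  cases h <;> rfl

/-- First coordinate of the sum of the endpoints of a side. -/
def ta : Fin 5 → ℝ :=
  ![-2 * (φ + 2) / 5, (1 - 2 * φ) / 5, (3 * φ + 1) / 5, (3 * φ + 1) / 5, (1 - 2 * φ) / 5]

/-- Second coordinate of the sum of the endpoints of a side. -/
def tb : Fin 5 → ℝ :=
  ![(3 * φ + 1) / 5, (1 - 2 * φ) / 5, -2 * (φ + 2) / 5, (1 - 2 * φ) / 5, (3 * φ + 1) / 5]

/-- First coordinate of the displacement of the face when the flow reaches the state `e`. -/
def da (e : DState) : ℝ := if e.1 = 0 then -ta e.2.1 else ta e.2.1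

/-- Second coordinate of the displacement of the face when the flow reaches the state `e`. -/
def db (e : DState) : ℝ := if e.1 = 0 then -tb e.2.1 else tb e.2.1

/-- A piece of a flow line with `n` steps, and its total displacement. -/
inductive DPath (x y : ℝ) : ℕ → DState → DState → ℝ → ℝ → Prop
  | nil (e) : DPath x y 0 e e 0 0
  | cons {n e e' e'' a b} : DStep x y e e' → DPath x y n e' e'' a b →
      DPath x y (n + 1) e e'' (da e' + a) (db e' + b)

theorem DPath.disp {x y n e e' a b a' b'} (h : DPath x y n e e' a b)
    (ha : a = a') (hb : b = b') : DPath x y n e e' a' b' := by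
  subst ha hb; exact h

theorem DPath.trans {x y n e e' a b m e'' c d} (h : DPath x y n e e' a b)
    (h' : DPath x y m e' e'' c d) : DPath x y (n + m) e e'' (a + c) (b + d) := by
  induction h with
  | nil p => simpa using h'
  | @cons n e e' f a' b' hs _ ih =>
    rw [show n + 1 + m = n + m + 1 by ring]
    exact (DPath.cons hs (ih h')).disp (by ring) (by ring)

theorem DPath.of_seq {x y e e' n a b} {st : ℤ → DState} (hx : 0 < x) (hy : 0 ≤ y)
    (hst : ∀ k, DStep x y (st k) (st (k + 1))) (h : DPath x y n e e' a b) :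
    ∀ k, st k = e → st (k + n) = e' ∧ ∑ i ∈ Finset.range n, da (st (k + i + 1)) = a ∧
      ∑ i ∈ Finset.range n, db (st (k + i + 1)) = b := by
  induction h with
  | nil => intro k hk; simp [hk]
  | @cons n e e' e'' a b hs _ ih =>
    intro k hk
    have h1 : st (k + 1) = e' := by
      have := hst k
      rw [hk] at this
      exact this.det hx hy hs
    obtain ⟨h2, h3, h4⟩ := ih (k + 1) h1
    have h5 : ∀ i : ℕ, k + 1 + (i : ℤ) + 1 = k + ((i + 1 : ℕ) : ℤ) + 1 := by
      intro i; push_cast; ring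
    simp only [h5] at h3 h4
    refine ⟨?_, ?_, ?_⟩
    · rw [← h2]; congr 1; push_cast; ring
    · rw [Finset.sum_range_succ', h3]; simp [h1, add_comm]
    · rw [Finset.sum_range_succ', h4]; simp [h1, add_comm]

/-! ### Transfer from the golden L to the double pentagon -/

/-- The side through which a flow line of the golden L enters the double pentagon. -/
def rep (x y : ℝ) : Rect × ℝ → DState
  | (o, s) => (0, 1, (φ - 1) * x + s)
  | (r, s) => (1, 3, φ * x + φ * y - s)
  | (t, s) => (1, 4, (φ - 1) * x + y - s)

/-- Position of the face that belongs to a rectangle, first coordinate. -/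
def ca : Rect → ℝ
  | o => 0 | r => ta 3 - 1 | t => ta 4

/-- Position of the face that belongs to a rectangle, second coordinate. -/
def cb : Rect → ℝ
  | o => 0 | r => tb 3 | t => tb 4 - 1

theorem rep_invol (x y : ℝ) (p : Rect × ℝ) : rep x y (invol x y p) = dinv x y (rep x y p) := by
  obtain ⟨f, s⟩ := p
  cases f <;> simp [rep, invol, dinv, lo, hi, Rect.len, Rect.wd, Rect.ht] <;> ring

/-- The entry sides 3 and 4 of the face 1 correspond to the antidiagonals of `r` and `t`. As faces
alternate, every flow line passes through states coming from the golden L. -/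
theorem exists_rep {x y e e'} (h : DStep x y e e') (h1 : e.1 = 1) :
    ∃ p, Valid x y p ∧ rep x y p = e := by
  cases h with
  | zero => simp at h1
  | @one i j s h =>
    obtain ⟨-, h2, -, -, h3, h4⟩ := h
    rcases h2 with rfl | rfl
    · refine ⟨(r, φ * x + φ * y - s), ?_, by simp [rep]⟩
      simp only [Valid, Rect.len, Rect.wd, Rect.ht, lo, hi] at *
      constructor <;> linarith
    · refine ⟨(t, (φ - 1) * x + y - s), ?_, by simp [rep]⟩
      simp only [Valid, Rect.len, Rect.wd, Rect.ht, lo, hi] at *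
      constructor <;> linarith

/-- The transverse distance of a line running into a corner of the L is that of a vertex of the
pentagon, the endpoint of two exit intervals. -/
theorem not_dStep_final {x y e} (hx : 0 < x) (hy : 0 ≤ y) (f : Rect) :
    ¬ DStep x y (rep x y (final x y f)) e := by
  obtain ⟨h4, h5, h6⟩ := φ_mul_facts hx.le
  obtain ⟨h7, h8, h9⟩ := φ_mul_facts hy
  intro h
  generalize hp : rep x y (final x y f) = p at h
  cases h with
  | @zero i j s h =>
    cases f <;> simp [rep, final, Rect.wd] at hp
    obtain ⟨-, h2, -, -, h3, h4⟩ := h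
    obtain ⟨rfl, hp⟩ := hp
    rcases h2 with rfl | rfl <;> simp only [lo, hi] at * <;> linarith
  | @one i j s h =>
    obtain ⟨h2, -, h3, h4, -, -⟩ := h
    cases f <;> simp [rep, final, Rect.wd] at hp <;> obtain ⟨rfl, hp⟩ := hp <;>
      rcases h2 with rfl | rfl | rfl <;> simp only [lo, hi] at * <;> linarith

/-- P takes the antidiagonals of `o`, `r`, `t` to translates of the sides 1, 3, 4. A step from `r`
to itself or from `t` to itself crosses two sides, any other step one. As before, displacements
agree up to a coboundary, here `ca` and `cb`. -/
theorem step_dPath {x y p q a b} (hx : 0 < x) (hy : 0 ≤ y) (h : Step x y p q a b) :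
    ∃ n, DPath x y (n + 1) (rep x y p) (rep x y q) (a + ca q.1 - ca p.1) (b + cb q.1 - cb p.1) := by
  obtain ⟨h4, h5, h6⟩ := φ_mul_facts hx.le
  obtain ⟨h7, h8, h9⟩ := φ_mul_facts hy
  have one_step : ∀ {e e' a b}, DStep x y e e' → da e' = a → db e' = b →
      DPath x y (0 + 1) e e' a b := by
    intro e e' a b h ha hb
    exact (DPath.cons h (.nil _)).disp (by simp [ha]) (by simp [hb])
  cases h with
  | @u_o s s' h1 h2 h3 =>
    subst h3
    refine ⟨0, one_step (e' := rep x y (t, s + (φ - 1) * x)) ?_ ?_ ?_⟩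
    · refine DStep.zero_of (i := 1) (j := 4) ⟨by simp, by simp, ?_, ?_, ?_, ?_⟩ ?_ <;>
        simp only [lo, hi] <;> linarith
    · simp [da, rep, ca]
    · simp [db, rep, cb]
  | @r_o s s' h1 h2 h3 =>
    subst h3
    refine ⟨0, one_step (e' := rep x y (r, s - y)) ?_ ?_ ?_⟩
    · refine DStep.zero_of (i := 1) (j := 3) ⟨by simp, by simp, ?_, ?_, ?_, ?_⟩ ?_ <;>
        simp only [lo, hi] <;> linarith
    · simp [da, rep, ca]
    · simp [db, rep, cb]
  | @u_r s s' h1 h2 h3 =>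
    subst h3
    refine ⟨1, ((one_step (e' := (0, 2, φ * x + y + s)) ?_ rfl rfl).trans
      (one_step (e' := rep x y (r, s + x)) ?_ rfl rfl)).disp ?_ ?_⟩
    · refine DStep.one_of (i := 2) (j := 3) ⟨by simp, by simp, ?_, ?_, ?_, ?_⟩ ?_ <;>
        simp only [lo, hi] <;> linarith
    · refine DStep.zero_of (i := 2) (j := 3) ⟨by simp, by simp, ?_, ?_, ?_, ?_⟩ ?_ <;>
        simp only [lo, hi] <;> linarith
    · simp [da, rep, ca, ta]
    · simp [db, rep, cb, tb]; ring
  | @r_r s s' h1 h2 h3 =>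
    subst h3
    refine ⟨0, one_step (e' := rep x y (o, s - (φ - 1) * y)) ?_ ?_ ?_⟩
    · refine DStep.one_of (i := 1) (j := 3) ⟨by simp, by simp, ?_, ?_, ?_, ?_⟩ ?_ <;>
        simp only [lo, hi] <;> linarith
    · simp [da, rep, ca, ta]; ring
    · simp [db, rep, cb, tb]
  | @u_t s s' h1 h2 h3 =>
    subst h3
    refine ⟨0, one_step (e' := rep x y (o, s + x)) ?_ ?_ ?_⟩
    · refine DStep.one_of (i := 1) (j := 4) ⟨by simp, by simp, ?_, ?_, ?_, ?_⟩ ?_ <;>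
        simp only [lo, hi] <;> linarith
    · simp [da, rep, ca, ta]
    · simp [db, rep, cb, tb]; ring
  | @r_t s s' h1 h2 h3 =>
    subst h3
    refine ⟨1, ((one_step (e' := (0, 0, s - y)) ?_ rfl rfl).trans
      (one_step (e' := rep x y (t, s - y)) ?_ rfl rfl)).disp ?_ ?_⟩
    · refine DStep.one_of (i := 0) (j := 4) ⟨by simp, by simp, ?_, ?_, ?_, ?_⟩ ?_ <;>
        simp only [lo, hi] <;> linarith
    · refine DStep.zero_of (i := 0) (j := 4) ⟨by simp, by simp, ?_, ?_, ?_, ?_⟩ ?_ <;>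
        simp only [lo, hi] <;> linarith
    · simp [da, rep, ca, ta]; ring
    · simp [db, rep, cb, tb]

theorem path_dPath {x y n p q a b} (hx : 0 < x) (hy : 0 ≤ y) (h : Path x y n p q a b) :
    ∃ m, n ≤ m ∧ DPath x y m (rep x y p) (rep x y q) (a + ca q.1 - ca p.1) (b + cb q.1 - cb p.1) := by
  induction h with
  | nil p => exact ⟨0, le_rfl, (DPath.nil _).disp (by ring) (by ring)⟩
  | cons h _ ih =>
    obtain ⟨m, hm, h1⟩ := ih
    obtain ⟨m', h2⟩ := step_dPath hx hy h
    exact ⟨m' + 1 + m, by omega, (h2.trans h1).disp (by ring) (by ring)⟩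

/-! ### Periodic sequences -/

theorem sum_range_shift {M : Type*} [AddCancelCommMonoid M] {f : ℤ → M} {m : ℕ}
    (hf : ∀ k, f (k + m) = f k) (k : ℤ) :
    ∑ i ∈ Finset.range m, f (k + i) = ∑ i ∈ Finset.range m, f i := by
  have key : ∀ k : ℤ, ∑ i ∈ Finset.range m, f (k + 1 + i) = ∑ i ∈ Finset.range m, f (k + i) := by
    intro k
    have h1 := Finset.sum_range_succ (fun i : ℕ => f (k + i)) m
    have h2 := Finset.sum_range_succ' (fun i : ℕ => f (k + i)) m
    rw [h1, hf] at h2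
    simp only [Nat.cast_zero, add_zero] at h2
    rw [add_right_cancel h2]
    exact Finset.sum_congr rfl fun i _ => by congr 1; push_cast; ring
  induction k using Int.induction_on with
  | zero => simp
  | succ k ih => rw [key, ih]
  | pred k ih =>
    rw [← ih, ← key]
    simp

theorem sum_range_mul_period {M : Type*} [AddCancelCommMonoid M] {f : ℤ → M} {m : ℕ}
    (hf : ∀ k, f (k + m) = f k) (q : ℕ) :
    ∑ i ∈ Finset.range (m * q), f i = q • ∑ i ∈ Finset.range m, f i := by
  induction q with
  | zero => simp
  | succ q ih =>
    rw [Nat.mul_succ, Finset.sum_range_add, ih, succ_nsmul, ← sum_range_shift hf ((m * q : ℕ) : ℤ)]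
    push_cast
    rfl

theorem period_dvd {α : Type*} {f : ℤ → α} {N p : ℕ}
    (h : IsLeast {p : ℕ | 0 < p ∧ ∀ k : ℤ, f (k + p) = f k} N) (hp : ∀ k : ℤ, f (k + p) = f k) :
    N ∣ p := by
  have hN : ∀ k : ℤ, f (k + N) = f k := h.1.2
  have hq : ∀ (q : ℕ) (k : ℤ), f (k + (N * q : ℕ)) = f k := by
    intro q
    induction q with
    | zero => simp
    | succ q ih =>
      intro k
      rw [← ih k, ← hN (k + (N * q : ℕ))]
      congr 1; push_cast; ring
  by_contra hd
  have h1 : 0 < p % N := Nat.pos_of_ne_zero fun h0 => hd (Nat.dvd_of_mod_eq_zero h0)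
  refine absurd (h.2 (show p % N ∈ _ from ⟨h1, fun k => ?_⟩)) (not_le.2 (Nat.mod_lt _ h.1.1))
  rw [← hq (p / N), ← hp k, add_assoc, ← Nat.cast_add, Nat.mod_add_div]

/-! ### The ring generated by the golden ratio -/

/-- The ring of integers of `ℚ(√5)`. -/
def goldenRing : Subring ℝ where
  carrier := {x | ∃ a b : ℤ, x = a + b * φ}
  zero_mem' := ⟨0, 0, by simp⟩
  one_mem' := ⟨1, 0, by simp⟩
  add_mem' := by
    rintro _ _ ⟨a, b, rfl⟩ ⟨c, d, rfl⟩
    exact ⟨a + c, b + d, by push_cast; ring⟩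
  neg_mem' := by
    rintro _ ⟨a, b, rfl⟩
    exact ⟨-a, -b, by push_cast; ring⟩
  mul_mem' := by
    rintro _ _ ⟨a, b, rfl⟩ ⟨c, d, rfl⟩
    exact ⟨a * c + b * d, a * d + b * c + b * d, by
      push_cast; linear_combination b * d * φ_mul_self⟩

theorem φ_mem : φ ∈ goldenRing := ⟨0, 1, by simp⟩

theorem goldenRing_ext {a b c d : ℤ} (h : (a : ℝ) + b * φ = c + d * φ) : a = c ∧ b = d := by
  have hb : b = d := by
    by_contra hbd
    have h1 : ((b - d : ℤ) : ℝ) ≠ 0 := by exact_mod_cast sub_ne_zero.2 hbd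
    have h2 : φ = ((c - a : ℤ) : ℝ) / ((b - d : ℤ) : ℝ) := by
      rw [eq_div_iff h1]; push_cast; linarith
    refine Real.goldenRatio_irrational ⟨((c - a : ℤ) : ℚ) / ((b - d : ℤ) : ℚ), ?_⟩
    rw [← φ, h2]; push_cast; rfl
  subst hb
  exact ⟨by exact_mod_cast (add_right_cancel h), rfl⟩

/-- Every `σ_k` has an inverse with entries in ℤ[φ], so integrality of the vector passes down to
`r`. -/
theorem mem_goldenRing_of_vec (u : List (Fin 4)) {r : ℝ} (h1 : (vec u r).1 ∈ goldenRing)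
    (h2 : (vec u r).2 ∈ goldenRing) : r ∈ goldenRing := by
  induction u using List.reverseRecOn with
  | nil => exact h1
  | append_singleton u k ih =>
    rw [vec_concat] at h1 h2
    have h := φ_mul_self
    generalize (vec u r).1 = X at *
    generalize (vec u r).2 = Y at *
    have key : X ∈ goldenRing ∧ Y ∈ goldenRing := by
      fin_cases k <;> simp [sx, sy] at h1 h2
      · refine ⟨?_, h2⟩
        convert sub_mem h1 (mul_mem φ_mem h2) using 1; ring
      · constructor
        · convert mul_mem φ_mem (sub_mem h1 h2) using 1
          linear_combination -X * h
        · convert sub_mem (mul_mem φ_mem h2) h1 using 1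
          linear_combination -Y * h
      · constructor
        · convert sub_mem (mul_mem φ_mem h1) h2 using 1
          linear_combination -X * h
        · convert mul_mem φ_mem (sub_mem h2 h1) using 1
          linear_combination -Y * h
      · refine ⟨h1, ?_⟩
        convert sub_mem h2 (mul_mem φ_mem h1) using 1; ring
    exact ih key.1 key.2

theorem eq_one_of_inv_mem {q : ℕ} (hq : 0 < q) (h : (q : ℝ)⁻¹ ∈ goldenRing) : q = 1 := by
  obtain ⟨a, b, h⟩ := h
  have h0 : (q : ℝ) ≠ 0 := by exact_mod_cast hq.ne'
  have h1 : (((q * a : ℤ) : ℝ)) + ((q * b : ℤ) : ℝ) * φ = ((1 : ℤ) : ℝ) + ((0 : ℤ) : ℝ) * φ := by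
    have := mul_inv_cancel₀ h0
    rw [h] at this
    push_cast; linarith
  have h2 := (goldenRing_ext h1).1
  have h3 : (q : ℤ) ∣ 1 := ⟨a, h2.symm⟩
  exact_mod_cast Int.eq_one_of_dvd_one (by positivity) h3

/-! ### Closed flow lines of the double pentagon -/

/-- A flow line of the double pentagon. -/
def DSeq (x y : ℝ) (st : ℤ → DState) : Prop := ∀ k, DStep x y (st k) (st (k + 1))

theorem DSeq.shift {x y st} (h : DSeq x y st) (m : ℤ) : DSeq x y fun k => st (k + m) := by
  intro k
  have := h (k + m)
  rwa [add_right_comm] at this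

theorem DSeq.eq_of_eq {x y st st'} (hx : 0 < x) (hy : 0 ≤ y) (h : DSeq x y st)
    (h' : DSeq x y st') (h0 : st 0 = st' 0) : st = st' := by
  funext k
  induction k using Int.induction_on with
  | zero => exact h0
  | succ k ih =>
    have h1 := h k
    rw [ih] at h1
    exact h1.det hx hy (h' k)
  | pred k ih =>
    have h1 := h (-k - 1)
    have h2 := h' (-k - 1)
    rw [sub_add_cancel] at h1 h2
    rw [ih] at h1
    exact h1.det_left hx hy h2

theorem DSeq.periodic {x y st} (hx : 0 < x) (hy : 0 ≤ y) (h : DSeq x y st) {k : ℤ} {m : ℕ}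
    (hk : st (k + m) = st k) (i : ℤ) : st (i + m) = st i := by
  have := (h.shift (k + m)).eq_of_eq hx hy (h.shift k) (by simpa using hk)
  have := congrFun this (i - k)
  rw [show i - k + (k + m) = i + m by ring, show i - k + k = i by ring] at this
  exact this

theorem DSeq.dinv {x y st} (h : DSeq x y st) : DSeq x y fun k => dinv x y (st (-k)) := by
  intro k
  have := (h (-(k + 1))).dinv
  rwa [show -(k + 1) + 1 = -k by ring] at this

theorem DSeq.fst_eq_iff {x y st} (h : DSeq x y st) (k : ℤ) (n : ℕ) :
    (st (k + n)).1 = (st k).1 ↔ Even n := by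
  induction n with
  | zero => simp
  | succ n ih =>
    have := (h (k + n)).fst
    rw [show k + ((n + 1 : ℕ) : ℤ) = k + n + 1 by push_cast; ring, this, Nat.even_add_one, ← ih]
    generalize (st (k + n)).1 = f
    generalize (st k).1 = g
    revert f g
    decide

/-- Faces alternate, so 2n steps contain n entries into each face. The sum is over an arbitrary `F`
because the same counts serve for real displacements and for rotations modulo 5. -/
theorem DSeq.exists_counts {x y st} (h : DSeq x y st) (n : ℕ) : ∃ n₃ n₄ m₀ m₁ m₂ : ℕ,
    n₃ + n₄ = n ∧ m₀ + m₁ + m₂ = n ∧ ∀ {M : Type} [AddCommMonoid M] (F : Fin 2 → Fin 5 → M),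
      ∑ i ∈ Finset.range (2 * n), F (st (i + 1)).1 (st (i + 1)).2.1 =
        n₃ • F 1 3 + n₄ • F 1 4 + m₀ • F 0 0 + m₁ • F 0 1 + m₂ • F 0 2 := by
  induction n with
  | zero => exact ⟨0, 0, 0, 0, 0, rfl, rfl, by simp⟩
  | succ n ih =>
    obtain ⟨n₃, n₄, m₀, m₁, m₂, h1, h2, h3⟩ := ih
    have key : ∃ i j : Fin 5, (i = 0 ∨ i = 1 ∨ i = 2) ∧ (j = 3 ∨ j = 4) ∧
        ∀ {M : Type} [AddCommMonoid M] (F : Fin 2 → Fin 5 → M),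
          ∑ k ∈ Finset.range (2 * (n + 1)), F (st (k + 1)).1 (st (k + 1)).2.1 =
            ∑ k ∈ Finset.range (2 * n), F (st (k + 1)).1 (st (k + 1)).2.1 + (F 0 i + F 1 j) := by
      have g1 := h ((2 * n : ℕ) : ℤ)
      have g2 := h ((2 * n + 1 : ℕ) : ℤ)
      have e : ((2 * n : ℕ) : ℤ) + 1 = ((2 * n + 1 : ℕ) : ℤ) := by push_cast; ring
      have aux : ∀ {M : Type} [AddCommMonoid M] (F : Fin 2 → Fin 5 → M),
          ∑ k ∈ Finset.range (2 * (n + 1)), F (st (k + 1)).1 (st (k + 1)).2.1 =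
            ∑ k ∈ Finset.range (2 * n), F (st (k + 1)).1 (st (k + 1)).2.1 +
              (F (st (((2 * n : ℕ) : ℤ) + 1)).1 (st (((2 * n : ℕ) : ℤ) + 1)).2.1 +
              F (st (((2 * n + 1 : ℕ) : ℤ) + 1)).1 (st (((2 * n + 1 : ℕ) : ℤ) + 1)).2.1) := by
        intro M _ F
        rw [show 2 * (n + 1) = 2 * n + 1 + 1 by ring, Finset.sum_range_succ, Finset.sum_range_succ,
          add_assoc]
      rw [← e] at g2
      rw [← e] at aux
      generalize st (((2 * n : ℕ) : ℤ) + 1 + 1) = e2 at *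
      generalize st (((2 * n : ℕ) : ℤ) + 1) = e1 at *
      cases g2 with
      | @zero i j s hc =>
        generalize st ((2 * n : ℕ) : ℤ) = e0 at g1
        exact ⟨i, j, hc.entry, hc.exit, aux⟩
      | @one i j s hc =>
        exact ⟨i, j, hc.entry, hc.exit, fun F => by rw [aux, add_comm (F 0 i)]⟩
    obtain ⟨i, j, hi, hj, hF⟩ := key
    rcases hi with rfl | rfl | rfl <;> rcases hj with rfl | rfl
    · exact ⟨n₃ + 1, n₄, m₀ + 1, m₁, m₂, by omega, by omega, fun F => by
        rw [hF, h3]; simp only [add_smul, one_smul]; abel⟩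
    · exact ⟨n₃, n₄ + 1, m₀ + 1, m₁, m₂, by omega, by omega, fun F => by
        rw [hF, h3]; simp only [add_smul, one_smul]; abel⟩
    · exact ⟨n₃ + 1, n₄, m₀, m₁ + 1, m₂, by omega, by omega, fun F => by
        rw [hF, h3]; simp only [add_smul, one_smul]; abel⟩
    · exact ⟨n₃, n₄ + 1, m₀, m₁ + 1, m₂, by omega, by omega, fun F => by
        rw [hF, h3]; simp only [add_smul, one_smul]; abel⟩
    · exact ⟨n₃ + 1, n₄, m₀, m₁, m₂ + 1, by omega, by omega, fun F => by
        rw [hF, h3]; simp only [add_smul, one_smul]; abel⟩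
    · exact ⟨n₃, n₄ + 1, m₀, m₁, m₂ + 1, by omega, by omega, fun F => by
        rw [hF, h3]; simp only [add_smul, one_smul]; abel⟩

/-- The states of the golden L met by the line form a nonempty set in which the flow goes on for
ever, so the closing of flow lines on the golden L carries over. -/
theorem DSeq.exists_closed {st} (u : List (Fin 4)) (h : DSeq (vec u 1).1 (vec u 1).2 st) :
    ∃ m : ℕ, ∃ c : ℝ, 0 < m ∧ (c = 1 ∨ c = φ) ∧ (∀ k, st (k + m) = st k) ∧
      ∑ i ∈ Finset.range m, da (st (i + 1)) = c * (vec u 1).1 ∧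
      ∑ i ∈ Finset.range m, db (st (i + 1)) = c * (vec u 1).2 := by
  obtain ⟨hx, hy⟩ := vec_pos u one_pos
  set x := (vec u 1).1
  set y := (vec u 1).2
  let O : Set (Rect × ℝ) := {p | Valid x y p ∧ ∃ k, st k = rep x y p}
  have hO : Flows x y O := by
    rintro p ⟨hp, k, hk⟩
    rcases hp.step_or_final with ⟨q, a, b, hs⟩ | hf
    · refine ⟨q, ⟨(hs.valid hx hy).2, ?_⟩, a, b, hs⟩
      obtain ⟨n, h1⟩ := step_dPath hx hy hs
      exact ⟨_, (h1.of_seq hx hy h k hk).1⟩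
    · have := h k
      rw [hk, hf] at this
      exact absurd this (not_dStep_final hx hy _)
  have hne : O.Nonempty := by
    have h0 : ∃ k, (st k).1 = 1 := by
      by_cases h0 : (st 0).1 = 1
      · exact ⟨0, h0⟩
      · refine ⟨0 + 1, ?_⟩
        rw [(h 0).fst]
        generalize (st 0).1 = f at *
        revert h0; revert f; decide
    obtain ⟨k, hk⟩ := h0
    obtain ⟨p, hp, hp'⟩ := exists_rep (h k) hk
    exact ⟨p, hp, k, hp'.symm⟩
  obtain ⟨p, ⟨-, k, hk⟩, n, c, hc, hp⟩ := Flows.exists_closed u hO hne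
  obtain ⟨m, hm, h1⟩ := path_dPath hx hy hp
  obtain ⟨h2, h3, h4⟩ := h1.of_seq hx hy h k hk
  have hper := h.periodic hx hy (h2.trans hk.symm)
  refine ⟨m, c, by omega, hc, hper, ?_, ?_⟩
  · rw [← sum_range_shift (f := fun k => da (st (k + 1))) (m := m)
      (fun k => by rw [add_right_comm, hper]) k, h3]; ring
  · rw [← sum_range_shift (f := fun k => db (st (k + 1))) (m := m)
      (fun k => by rw [add_right_comm, hper]) k, h4]; ring

/-- The flow line closes after `N` sides, in a cylinder whose circumference is `c` times the length
of the direction vector; the numbers of crossings of the sides are determined by the holonomy. -/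
theorem DSeq.exists_period {st} (u : List (Fin 4)) (h : DSeq (vec u 1).1 (vec u 1).2 st) :
    ∃ N : ℕ, ∃ c : ℝ, (c = 1 ∨ c = φ) ∧ IsLeast {p : ℕ | 0 < p ∧ ∀ k : ℤ, st (k + p) = st k} N ∧
      ∑ i ∈ Finset.range N, da (st (i + 1)) = c * (vec u 1).1 ∧
      ∑ i ∈ Finset.range N, db (st (i + 1)) = c * (vec u 1).2 ∧
      ∃ n₃ n₄ m₀ m₁ m₂ : ℕ, N = 2 * (n₃ + n₄) ∧ m₀ + m₁ + m₂ = n₃ + n₄ ∧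
        (∀ F : Fin 2 → Fin 5 → ZMod 5,
          ∑ i ∈ Finset.range N, F (st (i + 1)).1 (st (i + 1)).2.1 =
            n₃ • F 1 3 + n₄ • F 1 4 + m₀ • F 0 0 + m₁ • F 0 1 + m₂ • F 0 2) ∧
        c * (vec u 1).1 = m₀ + (n₃ - m₂) * φ ∧ c * (vec u 1).2 = m₂ + (m₁ + m₂ - n₃) * φ := by
  classical
  obtain ⟨hx, hy⟩ := vec_pos u one_pos
  obtain ⟨m, c, hm, hc, hper, h1, h2⟩ := h.exists_closed u
  have hex : ∃ p : ℕ, 0 < p ∧ ∀ k : ℤ, st (k + p) = st k := ⟨m, hm, hper⟩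
  have hN : IsLeast {p : ℕ | 0 < p ∧ ∀ k : ℤ, st (k + p) = st k} (Nat.find hex) :=
    ⟨Nat.find_spec hex, fun p hp => Nat.find_min' hex hp⟩
  generalize Nat.find hex = N at hN
  obtain ⟨q, rfl⟩ := period_dvd hN hper
  have hN' := hN.1.2
  obtain ⟨n, hn⟩ := (h.fst_eq_iff 0 N).1 (by rw [hN'])
  obtain ⟨n₃, n₄, m₀, m₁, m₂, g1, g2, g3⟩ := h.exists_counts n
  rw [← two_mul] at hn
  rw [← hn] at g3
  rw [sum_range_mul_period (f := fun k => da (st (k + 1)))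
    (fun k => by rw [add_right_comm, hN']), nsmul_eq_mul] at h1
  rw [sum_range_mul_period (f := fun k => db (st (k + 1)))
    (fun k => by rw [add_right_comm, hN']), nsmul_eq_mul] at h2
  have g4 : (n₄ : ℝ) = m₀ + m₁ + m₂ - n₃ := by
    have : (n₃ : ℝ) + n₄ = m₀ + m₁ + m₂ := by exact_mod_cast g1.trans g2.symm
    linarith
  have ha : ∑ i ∈ Finset.range N, da (st (i + 1)) = m₀ + (n₃ - m₂) * φ := by
    have := g3 fun f i => da (f, i, 0)
    simp only [da] at this ⊢
    rw [this]
    simp [ta]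
    linear_combination (1 - 2 * φ) / 5 * g4
  have hb : ∑ i ∈ Finset.range N, db (st (i + 1)) = m₂ + (m₁ + m₂ - n₃) * φ := by
    have := g3 fun f i => db (f, i, 0)
    simp only [db] at this ⊢
    rw [this]
    simp [tb]
    linear_combination (3 * φ + 1) / 5 * g4
  have hq : 0 < q := Nat.pos_of_mul_pos_left hm
  have hq' : (q : ℝ) ≠ 0 := by exact_mod_cast hq.ne'
  -- If closing takes q primitive periods, then c/q times v is the holonomy of one of them, and this
  -- is an integral vector.
  have hmem : (q : ℝ)⁻¹ * c ∈ goldenRing := by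
    apply mem_goldenRing_of_vec u
    · have : (vec u ((q : ℝ)⁻¹ * c)).1 = m₀ + (n₃ - m₂) * φ := by
        have := vec_mul u ((q : ℝ)⁻¹ * c) 1
        rw [mul_one] at this
        rw [this, ← ha]
        simp only
        rw [mul_assoc, ← h1, inv_mul_cancel_left₀ hq']
      rw [this]
      exact ⟨m₀, n₃ - m₂, by push_cast; ring⟩
    · have : (vec u ((q : ℝ)⁻¹ * c)).2 = m₂ + (m₁ + m₂ - n₃) * φ := by
        have := vec_mul u ((q : ℝ)⁻¹ * c) 1
        rw [mul_one] at this
        rw [this, ← hb]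
        simp only
        rw [mul_assoc, ← h2, inv_mul_cancel_left₀ hq']
      rw [this]
      exact ⟨m₂, m₁ + m₂ - n₃, by push_cast; ring⟩
  -- Since φ - 1 inverts φ, the factor c is a unit and 1/q itself lies in ℤ[φ].
  have hq1 : q = 1 := by
    apply eq_one_of_inv_mem hq
    rcases hc with rfl | rfl
    · simpa using hmem
    · have h3 := mul_mem hmem (sub_mem φ_mem goldenRing.one_mem)
      rw [mul_assoc, show φ * (φ - 1) = 1 by linarith [φ_mul_self], mul_one] at h3
      exact h3
  subst hq1
  simp only [Nat.cast_one, one_mul] at h1 h2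
  exact ⟨N, c, hc, hN, h1, h2, n₃, n₄, m₀, m₁, m₂, by omega, by omega, fun F => g3 F,
    by rw [← h1, ha], by rw [← h2, hb]⟩

theorem DPath.exists_fun {x y n e e' a b} (h : DPath x y n e e' a b) :
    ∃ f : ℕ → DState, f 0 = e ∧ f n = e' ∧ ∀ i < n, DStep x y (f i) (f (i + 1)) := by
  induction h with
  | nil e => exact ⟨fun _ => e, rfl, rfl, by simp⟩
  | @cons n e e' e'' a b hs _ ih =>
    obtain ⟨f, h0, h1, h2⟩ := ih
    refine ⟨fun i => Nat.casesOn i e f, rfl, h1, ?_⟩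
    rintro (_ | i) hi
    · simpa [h0] using hs
    · exact h2 i (by omega)

theorem DPath.exists_dSeq {x y n e a b} (h : DPath x y n e e a b) (hn : 0 < n) :
    ∃ st, DSeq x y st ∧ st 0 = e := by
  obtain ⟨f, h0, h1, h2⟩ := h.exists_fun
  have hn' : (0 : ℤ) < n := by exact_mod_cast hn
  refine ⟨fun k => f (k % n).toNat, fun k => ?_, by simpa using h0⟩
  have h3 := Int.emod_nonneg k hn'.ne'
  have h4 := Int.emod_lt_of_pos k hn'
  have h5 := h2 (k % n).toNat (by omega)
  rcases eq_or_ne (k % n + 1) n with h6 | h6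
  · have h7 : (k + 1) % n = 0 := by rw [Int.add_emod_eq_add_emod_right 1 (Int.emod_emod k n).symm, h6]; simp
    have h8 : (k % n).toNat + 1 = n := by omega
    simp only [h7]
    rw [h8, h1, ← h0] at h5
    exact h5
  · have h7 : (k + 1) % n = k % n + 1 := by
      rw [Int.add_emod_eq_add_emod_right 1 (Int.emod_emod k n).symm, Int.emod_eq_of_lt (by omega) (by omega)]
    have h8 : (k % n + 1).toNat = (k % n).toNat + 1 := by omega
    simp only [h7, h8]
    exact h5

theorem natCast_ne_φ (q : ℕ) : (q : ℝ) ≠ φ := by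
  intro h
  have := (goldenRing_ext (a := q) (b := 0) (c := 0) (d := 1) (by simpa using h)).2
  simp at this

theorem natCast_mul_φ_ne_one (q : ℕ) : (q : ℝ) * φ ≠ 1 := by
  intro h
  have := (goldenRing_ext (a := 0) (b := q) (c := 1) (d := 0) (by simpa using h)).1
  simp at this

/-- In both kinds of cylinders there are closed flow lines that the hyperelliptic involution
maps to themselves. -/
theorem exists_core_dSeq (u : List (Fin 4)) {c : ℝ} (hc : c = 1 ∨ c = φ) :
    ∃ (st : ℤ → DState) (N : ℕ), DSeq (vec u 1).1 (vec u 1).2 st ∧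
      IsLeast {p : ℕ | 0 < p ∧ ∀ k : ℤ, st (k + p) = st k} N ∧
      ∑ i ∈ Finset.range N, da (st (i + 1)) = c * (vec u 1).1 ∧
      (st 0).1 = 0 ∧ ∃ k, dinv (vec u 1).1 (vec u 1).2 (st k) = st k := by
  obtain ⟨hx, hy⟩ := vec_pos u one_pos
  obtain ⟨p, n, z, hp, ⟨m₁, a₁, b₁, h1⟩, m₂, a₂, b₂, h2⟩ := exists_core u hc
  obtain ⟨m, hm, hp⟩ := path_dPath hx hy hp
  obtain ⟨M₁, -, h1⟩ := path_dPath hx hy h1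
  obtain ⟨M₂, -, h2⟩ := path_dPath hx hy h2
  rw [rep_invol] at h2
  obtain ⟨st, hst, hst0⟩ := hp.exists_dSeq (by omega)
  obtain ⟨N, c', hc', hN, hda, -, -⟩ := hst.exists_period u
  set x := (vec u 1).1
  set y := (vec u 1).2
  obtain ⟨g1, g2, -⟩ := hp.of_seq hx hy hst 0 hst0
  have hper := hst.periodic hx hy (g1.trans hst0.symm)
  obtain ⟨q, rfl⟩ := period_dvd hN hper
  -- The closed path could wind q times around the primitive line, but q c' = c with both factors in
  -- {1, φ} forces c' = c.
  have hcc : c' = c := by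
    simp only [zero_add] at g2
    rw [sum_range_mul_period (f := fun k => da (st (k + 1)))
      (fun k => by rw [add_right_comm, hN.1.2]), nsmul_eq_mul, hda] at g2
    have : (q : ℝ) * c' = c := by
      apply mul_right_cancel₀ hx.ne'
      linarith
    rcases hc with rfl | rfl <;> rcases hc' with rfl | rfl
    · rfl
    · exact absurd this (natCast_mul_φ_ne_one q)
    · exact absurd (by simpa using this) (natCast_ne_φ q)
    · rfl
  subst hcc
  have hd := hst.dinv
  have e1 := (h1.of_seq hx hy hst 0 hst0).1
  have e2 := (h2.of_seq hx hy hd 0 (by simp [hst0])).1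
  simp only [zero_add] at e1 e2
  have key : ∀ k : ℤ, dinv x y (st (-(k + M₂))) = st (k + M₁) := by
    have := (hd.shift M₂).eq_of_eq hx hy (hst.shift M₁) (by simp [e1, e2])
    exact fun k => congrFun this k
  have key2 : ∀ k : ℤ, dinv x y (st ((M₁ : ℤ) - M₂ - k)) = st k := by
    intro k
    have := key (k - M₁)
    rwa [show -(k - (M₁ : ℤ) + M₂) = M₁ - M₂ - k by ring, sub_add_cancel] at this
  -- The line is symmetric about the index (M₁ - M₂)/2. The involution keeps the face label of a
  -- state and labels alternate, so this index is an integer, and the state there is fixed.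
  have hcore : ∃ k, dinv x y (st k) = st k := by
    have hev : Even ((M₁ : ℤ) - M₂) := by
      rcases le_total M₂ M₁ with h | h
      · have := key2 0
        rw [sub_zero, ← Nat.cast_sub h] at this
        rw [← Nat.cast_sub h, Int.even_coe_nat, ← hst.fst_eq_iff 0, ← this]
        simp [dinv]
      · have := key2 ((M₁ : ℤ) - M₂)
        rw [sub_self] at this
        rw [← even_neg, neg_sub, ← Nat.cast_sub h, Int.even_coe_nat,
          ← hst.fst_eq_iff ((M₁ : ℤ) - M₂), ← this, Nat.cast_sub h, sub_add_sub_cancel, sub_self]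
        simp [dinv]
    obtain ⟨k, hk⟩ := hev
    refine ⟨k, ?_⟩
    have := key2 k
    rwa [hk, add_sub_cancel_right] at this
  have shift_ok : ∀ j : ℤ, (st j).1 = 0 → ∃ (st : ℤ → DState) (N : ℕ), DSeq x y st ∧
      IsLeast {p : ℕ | 0 < p ∧ ∀ k : ℤ, st (k + p) = st k} N ∧
      ∑ i ∈ Finset.range N, da (st (i + 1)) = c' * x ∧
      (st 0).1 = 0 ∧ ∃ k, dinv x y (st k) = st k := by
    intro j hj
    refine ⟨fun k => st (k + j), N, hst.shift j, ?_, ?_, by simpa using hj, ?_⟩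
    · convert hN using 3 with p
      refine and_congr_right fun _ => ⟨fun h k => ?_, fun h k => ?_⟩
      · have := h (k - j)
        dsimp only at this
        rwa [sub_add_cancel, sub_add_eq_add_sub, sub_add_cancel] at this
      · dsimp only
        rw [add_right_comm, h]
    · rw [← hda, ← sum_range_shift (f := fun k => da (st (k + 1))) (m := N)
        (fun k => by rw [add_right_comm, hN.1.2]) j]
      exact Finset.sum_congr rfl fun i _ => by congr 2; ring
    · obtain ⟨k, hk⟩ := hcore
      exact ⟨k - j, by simpa using hk⟩
  by_cases h0 : (st 0).1 = 0
  · exact shift_ok 0 h0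
  · refine shift_ok (0 + 1) ?_
    rw [(hst 0).fst]
    generalize (st 0).1 = f at *
    revert h0; revert f; decide

/-! ### Transverse and longitudinal coordinates -/

/-- The coordinates of a point of the plane with respect to the columns of `P`, first one. -/
def c₁ (z : ℂ) : ℝ := z.re - z.im / sn * (φ / 2)

/-- The coordinates of a point of the plane with respect to the columns of `P`, second one. -/
def c₂ (z : ℂ) : ℝ := z.im / sn

theorem c₁_add (z w : ℂ) : c₁ (z + w) = c₁ z + c₁ w := by simp [c₁]; ring
theorem c₂_add (z w : ℂ) : c₂ (z + w) = c₂ z + c₂ w := by simp [c₂]; ring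
theorem c₁_sub (z w : ℂ) : c₁ (z - w) = c₁ z - c₁ w := by simp [c₁]; ring
theorem c₂_sub (z w : ℂ) : c₂ (z - w) = c₂ z - c₂ w := by simp [c₂]; ring
theorem c₁_smul (t : ℝ) (z : ℂ) : c₁ (t • z) = t * c₁ z := by simp [c₁]; ring
theorem c₂_smul (t : ℝ) (z : ℂ) : c₂ (t • z) = t * c₂ z := by simp [c₂]; ring

theorem c₁_pl (a b : ℝ) : c₁ (pl a b) = a := by
  have := sn_pos.ne'
  simp [c₁, pl, this]

theorem c₂_pl (a b : ℝ) : c₂ (pl a b) = b := by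
  have := sn_pos.ne'
  simp [c₂, pl, this]

theorem pl_c (z : ℂ) : pl (c₁ z) (c₂ z) = z := by
  obtain ⟨a, b, rfl⟩ := exists_pl z
  rw [c₁_pl, c₂_pl]

/-- Transverse distance of a point from the vertex `0`, for the direction `(x, y)`. -/
def ell (x y : ℝ) (z : ℂ) : ℝ := y * (c₁ z + (φ + 2) / 5) - x * (c₂ z - (4 * φ - 2) / 5)

/-- A coordinate along the flow, up to sign and scale. -/
def mu (z : ℂ) : ℝ := c₁ z + c₂ z - (3 * φ - 4) / 5

/-- Transverse distance of a vertex. -/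
def vl (x y : ℝ) : Fin 5 → ℝ
  | 0 => 0 | 1 => (φ - 1) * x | 2 => φ * x + y | 3 => φ * x + φ * y | 4 => (φ - 1) * x + y

theorem ell_pent (x y : ℝ) (i : Fin 5) : ell x y (pent i) = vl x y i := by
  have h := φ_mul_self
  rw [pent_eq, ell, c₁_pl, c₂_pl]
  fin_cases i
  · simp [vl]; right; ring_nf
  all_goals simp [vl]; ring

/-- The zero line of `mu` is the diagonal through the vertices 0 and 3, which separates the entry
sides 0, 1, 2 from the exit sides 3, 4. -/
theorem mu_pent (i : Fin 5) : mu (pent i) = ![0, 1 - φ, 1 - φ, 0, 2 - φ] i := by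
  rw [pent_eq, mu, c₁_pl, c₂_pl]
  fin_cases i <;> simp <;> ring

theorem vl_add (x y : ℝ) (i : Fin 5) : vl x y i + vl x y (i + 1) = lo x y i + hi x y i := by
  fin_cases i <;> simp [vl, lo, hi] <;> ring

theorem vl_sub_sq (x y : ℝ) (i : Fin 5) :
    (vl x y (i + 1) - vl x y i) ^ 2 = (hi x y i - lo x y i) ^ 2 := by
  fin_cases i <;> simp [vl, lo, hi] <;> ring

theorem ell_comb {x y p q : ℝ} (h : p + q = 1) (z w : ℂ) :
    ell x y (p • z + q • w) = p * ell x y z + q * ell x y w := by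
  obtain rfl : q = 1 - p := by linarith
  simp only [ell, c₁_add, c₂_add, c₁_smul, c₂_smul]
  ring

theorem mu_comb {p q : ℝ} (h : p + q = 1) (z w : ℂ) :
    mu (p • z + q • w) = p * mu z + q * mu w := by
  obtain rfl : q = 1 - p := by linarith
  simp only [mu, c₁_add, c₂_add, c₁_smul, c₂_smul]
  ring

theorem ell_add_smul (x y t : ℝ) (z : ℂ) : ell x y (z + t • pl x y) = ell x y z := by
  simp only [ell, c₁_add, c₂_add, c₁_smul, c₂_smul, c₁_pl, c₂_pl]
  ring

theorem mu_add_smul (x y t : ℝ) (z : ℂ) : mu (z + t • pl x y) = mu z + t * (x + y) := by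
  simp only [mu, c₁_add, c₂_add, c₁_smul, c₂_smul, c₁_pl, c₂_pl]
  ring

theorem ell_sum_sub (x y : ℝ) (i : Fin 5) (z : ℂ) :
    ell x y (pent i + pent (i + 1) - z) = lo x y i + hi x y i - ell x y z := by
  rw [← vl_add, ← ell_pent, ← ell_pent]
  simp only [ell, c₁_add, c₂_add, c₁_sub, c₂_sub]
  ring

theorem pl_ta_tb (i : Fin 5) : pl (ta i) (tb i) = pent i + pent (i + 1) := by
  rw [pent_eq, pent_eq, ← pl_add]
  congr 1 <;> fin_cases i <;> simp [ta, tb] <;> ring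

theorem ell_mem_openSegment {x y : ℝ} {i : Fin 5} {z : ℂ} (hz : z ∈ pentSide i) :
    ell x y z ∈ openSegment ℝ (vl x y i) (vl x y (i + 1)) := by
  obtain ⟨p, q, hp, hq, h, rfl⟩ := hz
  exact ⟨p, q, hp, hq, h, by rw [ell_comb h, ell_pent, ell_pent]; rfl⟩

theorem openSegment_vl {x y : ℝ} {i : Fin 5} (h : lo x y i < hi x y i) :
    openSegment ℝ (vl x y i) (vl x y (i + 1)) = Set.Ioo (lo x y i) (hi x y i) := by
  fin_cases i <;> simp only [lo, hi] at h <;> simp [vl, lo, hi]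
  · exact openSegment_eq_Ioo h
  · exact openSegment_eq_Ioo h
  · exact openSegment_eq_Ioo (by linarith)
  · rw [openSegment_symm]; exact openSegment_eq_Ioo h
  · rw [openSegment_symm]; exact openSegment_eq_Ioo h

theorem lo_lt_hi {x y : ℝ} (hx : 0 < x) (hy : 0 ≤ y) {i : Fin 5} (h : i = 2 → 0 < y) :
    lo x y i < hi x y i := by
  have h1 := one_lt_φ
  obtain ⟨h4, h5, h6⟩ := φ_mul_facts hx.le
  obtain ⟨h7, h8, h9⟩ := φ_mul_facts hy
  fin_cases i <;> simp [lo, hi] <;> simp at h <;> nlinarith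

theorem exists_mem_pentSide {x y s : ℝ} {i : Fin 5} (h : lo x y i < s) (h' : s < hi x y i) :
    ∃ z ∈ pentSide i, ell x y z = s := by
  have : s ∈ openSegment ℝ (vl x y i) (vl x y (i + 1)) := by
    rw [openSegment_vl (h.trans h')]; exact ⟨h, h'⟩
  obtain ⟨p, q, hp, hq, hpq, rfl⟩ := this
  exact ⟨_, ⟨p, q, hp, hq, hpq, rfl⟩, by rw [ell_comb hpq, ell_pent, ell_pent]; rfl⟩

theorem eq_of_ell_eq {x y : ℝ} {i : Fin 5} {z w : ℂ} (h : lo x y i < hi x y i)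
    (hz : z ∈ pentSide i) (hw : w ∈ pentSide i) (he : ell x y z = ell x y w) : z = w := by
  have hv : vl x y i ≠ vl x y (i + 1) := by
    intro e
    have := vl_sub_sq x y i
    rw [e, sub_self] at this
    nlinarith
  obtain ⟨p, q, hp, hq, hpq, rfl⟩ := hz
  obtain ⟨p', q', hp', hq', hpq', rfl⟩ := hw
  rw [ell_comb hpq, ell_comb hpq', ell_pent, ell_pent] at he
  obtain rfl : q = 1 - p := by linarith
  obtain rfl : q' = 1 - p' := by linarith
  have : p = p' := by
    have h1 : (p - p') * (vl x y i - vl x y (i + 1)) = 0 := by linarith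
    rcases mul_eq_zero.1 h1 with h2 | h2
    · linarith
    · exact absurd (sub_eq_zero.1 h2) hv
  rw [this]

theorem mu_neg {i : Fin 5} {z : ℂ} (hi : i = 0 ∨ i = 1 ∨ i = 2) (hz : z ∈ pentSide i) :
    mu z < 0 := by
  have h := one_lt_φ
  obtain ⟨p, q, hp, hq, hpq, rfl⟩ := hz
  rw [mu_comb hpq, mu_pent, mu_pent]
  rcases hi with rfl | rfl | rfl <;> simp <;> nlinarith

theorem mu_pos {i : Fin 5} {z : ℂ} (hi : i = 3 ∨ i = 4) (hz : z ∈ pentSide i) :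
    0 < mu z := by
  have h := φ_lt
  obtain ⟨p, q, hp, hq, hpq, rfl⟩ := hz
  rw [mu_comb hpq, mu_pent, mu_pent]
  rcases hi with rfl | rfl <;> simp <;> nlinarith

theorem entry_or_exit (i : Fin 5) : (i = 0 ∨ i = 1 ∨ i = 2) ∨ (i = 3 ∨ i = 4) := by
  revert i; decide

/-- A chord of the pentagon in direction `(x, y)` leads from an entry side to an exit side. -/
theorem dCross_of_mem {x y t : ℝ} (hx : 0 < x) (hy : 0 ≤ y) {i j : Fin 5} {z : ℂ}
    (hz : z ∈ pentSide i) (hw : z + t • pl x y ∈ pentSide j) (ht : 0 < t) (hij : j ≠ i) :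
    DCross x y i j (ell x y z) := by
  have h1 := one_lt_φ
  obtain ⟨h4, h5, h6⟩ := φ_mul_facts hx.le
  obtain ⟨h7, h8, h9⟩ := φ_mul_facts hy
  have hmu := mu_add_smul x y t z
  have ht' : 0 < t * (x + y) := by positivity
  have gi := ell_mem_openSegment (x := x) (y := y) hz
  have gj := ell_mem_openSegment (x := x) (y := y) hw
  rw [ell_add_smul] at gj
  generalize ell x y z = s at *
  -- Only a weak bound is available for side 2, because the horizontal direction is not yet
  -- excluded.
  have side2 : s ∈ openSegment ℝ (vl x y 2) (vl x y (2 + 1)) → φ * x + y ≤ s := by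
    intro h
    have h2 := openSegment_subset_segment ℝ _ _ h
    rw [segment_eq_Icc (by simp [vl]; linarith)] at h2
    simpa [vl] using h2.1
  have sides : ∀ k : Fin 5, k ≠ 2 → s ∈ openSegment ℝ (vl x y k) (vl x y (k + 1)) →
      lo x y k < s ∧ s < hi x y k := by
    intro k hk h
    rwa [openSegment_vl (lo_lt_hi hx hy fun h => absurd h hk)] at h
  have i1 := fun h => sides i h gi
  have j1 := fun h => sides j h gj
  have i2 : i = 2 → φ * x + y ≤ s := fun h => side2 (h ▸ gi)
  have j2 : j = 2 → φ * x + y ≤ s := fun h => side2 (h ▸ gj)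
  rcases entry_or_exit i with hi' | hi' <;> rcases entry_or_exit j with hj' | hj'
  · exfalso
    rcases hi' with rfl | rfl | rfl <;> rcases hj' with rfl | rfl | rfl <;>
      simp [lo, hi] at hij i1 i2 j1 j2 <;> linarith
  · have hj3 := j1 (by rintro rfl; simp at hj')
    have hi3 : lo x y i < s ∧ s < hi x y i := by
      by_cases h : i = 2
      · subst h
        have h2 := side2 gi
        have hy' : 0 < y := by
          rcases hy.lt_or_eq with h | rfl
          · exact h
          · exfalso
            rcases hj' with rfl | rfl <;> simp only [lo, hi] at hj3 <;> linarith
        rw [openSegment_vl (lo_lt_hi hx hy fun _ => hy')] at gi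
        exact gi
      · exact i1 h
    exact ⟨hi', hj', hi3.1, hi3.2, hj3.1, hj3.2⟩
  · have := mu_pos hi' hz
    have := mu_neg hj' hw
    linarith
  · exfalso
    rcases hi' with rfl | rfl <;> rcases hj' with rfl | rfl <;>
      simp [lo, hi] at hij i1 j1 <;> linarith

theorem DCross.exists_time {x y s : ℝ} (hx : 0 < x) (hy : 0 ≤ y) {i j : Fin 5}
    (h : DCross x y i j s) {z w : ℂ} (hz : z ∈ pentSide i) (hw : w ∈ pentSide j)
    (he : ell x y z = ell x y w) : ∃ t : ℝ, 0 < t ∧ w = z + t • pl x y := by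
  have h1 := mu_neg h.entry hz
  have h2 := mu_pos h.exit hw
  have hxy : 0 < x + y := by linarith
  refine ⟨(mu w - mu z) / (x + y), div_pos (by linarith) hxy, ?_⟩
  rw [← sub_eq_iff_eq_add', ← pl_smul, ← pl_c (w - z), c₁_sub, c₂_sub]
  simp only [ell, mu] at he ⊢
  congr 1
  · field_simp
    linarith
  · field_simp
    linarith

/-! ### Trajectories of the double pentagon as flow lines -/

/-- The copy in the table of a point of a face: the face `1` is turned over by `z ↦ -z`. -/
def turn (f : Fin 2) (z : ℂ) : ℂ := if f = 0 then z else -z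

theorem turn_turn (f : Fin 2) (z : ℂ) : turn f (turn f z) = z := by
  unfold turn; split <;> simp

theorem turn_mem {f : Fin 2} {i : Fin 5} {z : ℂ} :
    turn f z ∈ pentSide i ↔ z ∈ doublePentagon.side (f, i) := by
  unfold turn pentSide GluedPolygons.side doublePentagon
  by_cases h : f = 0
  · simp [h]
  · simp only [h, if_false]
    constructor
    · rintro ⟨p, q, hp, hq, hpq, hz⟩
      exact ⟨p, q, hp, hq, hpq, by rw [← neg_neg z, ← hz]; simp [add_comm]⟩
    · rintro ⟨p, q, hp, hq, hpq, rfl⟩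
      exact ⟨p, q, hp, hq, hpq, by simp [add_comm]⟩

theorem vertex_eq (f : Fin 2) (i : Fin 5) : doublePentagon.vertex f i = turn f (pent i) := rfl

theorem flip_mem {i : Fin 5} {w : ℂ} (hw : w ∈ pentSide i) :
    pent i + pent (i + 1) - w ∈ pentSide i := by
  obtain ⟨p, q, hp, hq, hpq, rfl⟩ := hw
  refine ⟨q, p, hq, hp, by linarith, ?_⟩
  obtain rfl : q = 1 - p := by linarith
  simp only [sub_smul, one_smul]
  ring

theorem fin_two (f : Fin 2) : f = 0 ∨ f = 1 := by revert f; decide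

theorem shift_eq (f : Fin 2) (i : Fin 5) :
    doublePentagon.shift (f, i) = -turn f (pent i + pent (i + 1)) := by
  rcases fin_two f with rfl | rfl <;>
    simp [GluedPolygons.shift, doublePentagon, turn]; ring

theorem pl_da_db (e : DState) : pl (da e) (db e) = -turn e.1 (pent e.2.1 + pent (e.2.1 + 1)) := by
  rw [← pl_ta_tb]
  unfold da db turn
  split
  · apply Complex.ext <;> simp [pl]; ring
  · simp

variable {x y : ℝ}

/-- The flow line of a trajectory. -/
def _root_.PentBilliard.GluedPolygons.Trajectory.st {θ : ℂ} (τ : doublePentagon.Trajectory θ)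
    (x y : ℝ) (k : ℤ) : DState :=
  (τ.face k, τ.sideIn k, ell x y (turn (τ.face k) (τ.pt k)))

theorem face_succ {θ : ℂ} (τ : doublePentagon.Trajectory θ) (k : ℤ) :
    τ.face (k + 1) = τ.face k + 1 := congrArg Prod.fst (τ.next_side k)

theorem sideIn_succ {θ : ℂ} (τ : doublePentagon.Trajectory θ) (k : ℤ) :
    τ.sideIn (k + 1) = τ.sideOut k := congrArg Prod.snd (τ.next_side k)

theorem turn_succ (f : Fin 2) (z : ℂ) : turn (f + 1) z = -turn f z := by
  rcases fin_two f with rfl | rfl <;> simp [turn]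

/-- Once the face 1 is turned over onto the table, crossing a side is the half-turn about the
midpoint of that side. -/
theorem turn_pt_succ {θ : ℂ} (τ : doublePentagon.Trajectory θ) (k : ℤ) :
    turn (τ.face (k + 1)) (τ.pt (k + 1)) = pent (τ.sideOut k) + pent (τ.sideOut k + 1) -
      turn (τ.face k) (τ.pt k + τ.time k • θ) := by
  rw [face_succ, τ.next_pt, shift_eq]
  rcases fin_two (τ.face k) with h | h <;> rw [h] <;> simp [turn] <;> ring

theorem turn_add_smul (f : Fin 2) (t : ℝ) (z w : ℂ) :
    turn f (z + t • w) = turn f z + t • turn f w := by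
  rcases fin_two f with h | h <;> rw [h] <;> simp [turn]; ring

theorem dStep_of_chord (hx : 0 < x) (hy : 0 ≤ y) {f : Fin 2} {i j : Fin 5} {t : ℝ} {z : ℂ}
    (hz : z ∈ pentSide i) (hw : z + t • turn f (pl x y) ∈ pentSide j) (ht : 0 < t) (hij : j ≠ i) :
    DStep x y (f, i, ell x y z)
      (f + 1, j, ell x y (pent j + pent (j + 1) - (z + t • turn f (pl x y)))) := by
  rw [ell_sum_sub]
  rcases fin_two f with rfl | rfl <;>
    simp only [turn, if_true, one_ne_zero, if_false] at hw ⊢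
  · refine DStep.zero_of (dCross_of_mem hx hy hz hw ht hij) ?_
    rw [ell_add_smul]
  · have h4 : z = z + t • -pl x y + t • pl x y := by rw [smul_neg]; ring
    have h5 : ell x y z = ell x y (z + t • -pl x y) := by rw [h4, ell_add_smul]; simp
    refine DStep.one_of (j := i) ?_ (by rw [h5])
    rw [h5]
    refine dCross_of_mem hx hy hw ?_ ht hij.symm
    rwa [← h4]

theorem dSeq_st (hx : 0 < x) (hy : 0 ≤ y) (τ : doublePentagon.Trajectory (pl x y)) :
    DSeq x y (τ.st x y) := by
  intro k
  simp only [GluedPolygons.Trajectory.st]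
  have h2 := turn_mem.2 (τ.exit_mem k)
  rw [turn_add_smul] at h2
  rw [turn_pt_succ, face_succ, sideIn_succ, turn_add_smul]
  exact dStep_of_chord hx hy (turn_mem.2 (τ.pt_mem k)) h2 (τ.time_pos k) (τ.side_ne k)

theorem DStep.lo_lt {e e' : DState} (h : DStep x y e e') :
    lo x y e.2.1 < e.2.2 ∧ e.2.2 < hi x y e.2.1 := by
  cases h with
  | zero h => exact ⟨h.lo_entry, h.entry_hi⟩
  | one h => exact ⟨h.lo_exit, h.exit_hi⟩

/-- The intervals of the entry sides of a face are disjoint, so the side is redundant in a state,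
and returning to a point means returning to a state. -/
theorem DStep.side_unique {e₁ e₁' e₂ e₂' : DState} (hx : 0 < x) (hy : 0 ≤ y) (h : DStep x y e₁ e₁')
    (h' : DStep x y e₂ e₂') (h1 : e₁.1 = e₂.1) (h2 : e₁.2.2 = e₂.2.2) : e₁ = e₂ := by
  cases h with
  | zero h =>
    cases h' with
    | zero h' =>
      simp only at h2; subst h2
      rw [h.entry_unique hx hy h']
    | one h' => simp at h1
  | one h =>
    cases h' with
    | zero h' => simp at h1
    | one h' =>
      simp only at h2; subst h2
      rw [h.exit_unique h']

theorem st_eq_iff (hx : 0 < x) (hy : 0 ≤ y) (τ τ' : doublePentagon.Trajectory (pl x y)) (k l : ℤ) :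
    τ.st x y k = τ'.st x y l ↔ τ.face k = τ'.face l ∧ τ.pt k = τ'.pt l := by
  constructor
  · intro h
    have h1 : τ.face k = τ'.face l := congrArg Prod.fst h
    have h2 : τ.sideIn k = τ'.sideIn l := congrArg (fun e => e.2.1) h
    have h3 : ell x y (turn (τ.face k) (τ.pt k)) = ell x y (turn (τ'.face l) (τ'.pt l)) :=
      congrArg (fun e => e.2.2) h
    refine ⟨h1, ?_⟩
    have h4 := turn_mem.2 (τ.pt_mem k)
    have h5 := turn_mem.2 (τ'.pt_mem l)
    rw [← h2] at h5
    have h6 := (dSeq_st hx hy τ k).lo_lt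
    have h7 := eq_of_ell_eq (h6.1.trans h6.2) h4 h5 h3
    rw [← turn_turn (τ.face k) (τ.pt k), h7, ← h1, turn_turn]
  · rintro ⟨h1, h2⟩
    refine DStep.side_unique hx hy (dSeq_st hx hy τ k) (dSeq_st hx hy τ' l) h1 ?_
    simp [GluedPolygons.Trajectory.st, h1, h2]

theorem hasCombPeriod_iff (hx : 0 < x) (hy : 0 ≤ y) (τ : doublePentagon.Trajectory (pl x y))
    (N : ℕ) : τ.HasCombPeriod N ↔
      IsLeast {p : ℕ | 0 < p ∧ ∀ k : ℤ, τ.st x y (k + p) = τ.st x y k} N := by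
  simp only [GluedPolygons.Trajectory.HasCombPeriod, st_eq_iff hx hy]

theorem pt_add {θ : ℂ} (τ : doublePentagon.Trajectory θ) (x y : ℝ) (N : ℕ) :
    τ.pt N = τ.pt 0 + (∑ i ∈ Finset.range N, τ.time i) • θ +
      pl (-∑ i ∈ Finset.range N, da (τ.st x y (i + 1)))
        (-∑ i ∈ Finset.range N, db (τ.st x y (i + 1))) := by
  induction N with
  | zero => simp [pl]; rfl
  | succ N ih =>
    have h := τ.next_pt N
    have h1 : doublePentagon.shift (τ.face N, τ.sideOut N) =
        -pl (da (τ.st x y (N + 1))) (db (τ.st x y (N + 1))) := by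
      rw [shift_eq, pl_da_db]
      simp only [GluedPolygons.Trajectory.st]
      rw [face_succ, sideIn_succ, turn_succ, neg_neg]
    rw [Finset.sum_range_succ, Finset.sum_range_succ, Finset.sum_range_succ, add_smul]
    push_cast
    rw [h, ih, h1, neg_add, neg_add, pl_add,
      show pl (-da (τ.st x y (N + 1))) (-db (τ.st x y (N + 1))) =
        -pl (da (τ.st x y (N + 1))) (db (τ.st x y (N + 1))) by
          apply Complex.ext <;> simp [pl]; ring]
    ring

/-- When the trajectory closes, total time times direction equals the displacement of the faces; its
first coordinate determines the time. -/
theorem sum_time_eq {c : ℝ} {N : ℕ} (hx : 0 < x) (τ : doublePentagon.Trajectory (pl x y))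
    (hN : τ.pt N = τ.pt 0) (ha : ∑ i ∈ Finset.range N, da (τ.st x y (i + 1)) = c * x) :
    ∑ i ∈ Finset.range N, τ.time i = c := by
  have h := pt_add τ x y N
  rw [hN, add_assoc, left_eq_add, ← pl_smul, ← pl_add] at h
  have h1 := congrArg c₁ h
  rw [c₁_pl, ha] at h1
  simp only [c₁, Complex.zero_re, Complex.zero_im, zero_div, zero_mul, sub_zero] at h1
  have : (∑ i ∈ Finset.range N, τ.time i - c) * x = 0 := by linarith
  rcases mul_eq_zero.1 this with h2 | h2
  · linarith
  · exact absurd h2 hx.ne'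

theorem time_unique {θ : ℂ} (hθ : θ ≠ 0) {a b : ℝ} {z : ℂ} (h : z + a • θ = z + b • θ) : a = b :=
  smul_left_injective ℝ hθ (add_left_cancel h)

theorem pl_ne_zero (hx : 0 < x) : pl x y ≠ 0 := by
  intro h
  have := congrArg c₁ h
  rw [c₁_pl] at this
  simp [c₁] at this
  exact hx.ne' this

/-- Every flow line comes from a trajectory. -/
theorem DSeq.exists_trajectory (hx : 0 < x) (hy : 0 ≤ y) {st : ℤ → DState} (h : DSeq x y st) :
    ∃ τ : doublePentagon.Trajectory (pl x y), τ.st x y = st := by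
  choose z hz using fun k => exists_mem_pentSide (h k).lo_lt.1 (h k).lo_lt.2
  have key : ∀ k, ∃ t : ℝ, 0 < t ∧ (st (k + 1)).2.1 ≠ (st k).2.1 ∧
      turn (st k).1 (z k) + t • pl x y = turn (st k).1
        (pent (st (k + 1)).2.1 + pent ((st (k + 1)).2.1 + 1) - z (k + 1)) := by
    intro k
    have h1 := hz k
    have h2 := hz (k + 1)
    have h3 := flip_mem h2.1
    have h4 := ell_sum_sub x y (st (k + 1)).2.1 (z (k + 1))
    rw [h2.2] at h4
    generalize pent (st (k + 1)).2.1 + pent ((st (k + 1)).2.1 + 1) - z (k + 1) = w at *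
    have hs := h k
    have h5 := h1.1
    have h6 := h1.2
    clear h1 h2
    generalize z k = v at *
    generalize st k = e at *
    generalize st (k + 1) = e' at *
    cases hs with
    | @zero i j s hc =>
      simp only [sub_sub_cancel] at h4
      obtain ⟨t, ht, e⟩ := hc.exists_time hx hy h5 h3 (h6.trans h4.symm)
      refine ⟨t, ht, ?_, by simp [turn, e]⟩
      rintro rfl
      rcases hc.entry with h | h | h <;> rcases hc.exit with h' | h' <;> simp_all
    | @one i j s hc =>
      simp only [sub_sub_cancel] at h4
      obtain ⟨t, ht, e⟩ := hc.exists_time hx hy h3 h5 (h4.trans h6.symm)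
      refine ⟨t, ht, ?_, by simp [turn, e]⟩
      rintro rfl
      rcases hc.entry with h | h | h <;> rcases hc.exit with h' | h' <;> simp_all
  choose t ht hne heq using key
  refine ⟨{
    face := fun k => (st k).1
    sideIn := fun k => (st k).2.1
    sideOut := fun k => (st (k + 1)).2.1
    pt := fun k => turn (st k).1 (z k)
    time := t
    pt_mem := fun k => turn_mem.1 (by rw [turn_turn]; exact (hz k).1)
    time_pos := ht
    side_ne := hne
    exit_mem := fun k => ?_
    next_side := fun k => ?_
    next_pt := fun k => ?_ }, ?_⟩
  · refine turn_mem.1 ?_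
    rw [heq, turn_turn]
    exact flip_mem (hz (k + 1)).1
  · simp [doublePentagon, (h k).fst]
  · rw [heq, shift_eq, (h k).fst, turn_succ]
    rcases fin_two (st k).1 with h | h <;> rw [h] <;> simp [turn]; ring
  · funext k
    simp only [GluedPolygons.Trajectory.st, turn_turn]
    rw [(hz k).2]

theorem throughMidpoint_iff (hx : 0 < x) (hy : 0 ≤ y) (τ : doublePentagon.Trajectory (pl x y)) :
    τ.ThroughMidpoint ↔ ∃ k, dinv x y (τ.st x y k) = τ.st x y k := by
  refine exists_congr fun k => ?_
  have h0 : τ.pt k = midpoint ℝ (doublePentagon.vertex (τ.face k) (τ.sideIn k))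
      (doublePentagon.vertex (τ.face k) (τ.sideIn k + 1)) ↔
      turn (τ.face k) (τ.pt k) = pent (τ.sideIn k) + pent (τ.sideIn k + 1) -
        turn (τ.face k) (τ.pt k) := by
    rw [eq_sub_iff_add_eq, ← two_mul, midpoint_eq_smul_add, vertex_eq, vertex_eq]
    rcases fin_two (τ.face k) with h | h <;> rw [h] <;> simp [turn] <;> constructor <;> intro h
    · rw [h]; ring
    · linear_combination (1 / 2) * h
    · rw [h]; ring
    · linear_combination (-1 / 2) * h
  rw [h0]
  have h1 := turn_mem.2 (τ.pt_mem k)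
  have h2 := (dSeq_st hx hy τ k).lo_lt
  have h3 := ell_sum_sub x y (τ.sideIn k) (turn (τ.face k) (τ.pt k))
  constructor
  · intro h
    rw [← h] at h3
    simp only [dinv, GluedPolygons.Trajectory.st]
    rw [← h3]
  · intro h
    have h4 : lo x y (τ.sideIn k) + hi x y (τ.sideIn k) - ell x y (turn (τ.face k) (τ.pt k)) =
      ell x y (turn (τ.face k) (τ.pt k)) := congrArg (fun e => e.2.2) h
    exact eq_of_ell_eq (h2.1.trans h2.2) h1 (flip_mem h1) (h4.symm.trans h3.symm)

/-! ### Tree words -/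

theorem sigma_mulVec (k : Fin 4) (a b : ℝ) : sigma k *ᵥ ![a, b] = ![sx k a b, sy k a b] := by
  ext i
  fin_cases k <;> fin_cases i <;>
    simp [sigma, sx, sy, φ, Matrix.mulVec, dotProduct, Fin.sum_univ_two]

theorem foldl_sigma (u : List (Fin 4)) :
    u.foldl (fun x k => sigma k *ᵥ x) ![1, 0] = ![(vec u 1).1, (vec u 1).2] := by
  induction u using List.reverseRecOn with
  | nil => simp [vec_nil]
  | append_singleton u k ih => rw [List.foldl_append, ih, vec_concat]; exact sigma_mulVec k _ _

theorem isTreeWord_iff (u : List (Fin 4)) (v : Fin 2 → ℝ) :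
    IsTreeWord u v ↔ u.head? ≠ some 0 ∧ v = ![(vec u 1).1, (vec u 1).2] := by
  rw [IsTreeWord, foldl_sigma]

/-- The sectors of the four matrices are disjoint. -/
theorem sector_unique {k k' : Fin 4} {x y x' y' : ℝ} (hx : 0 < x) (hy : 0 ≤ y) (hx' : 0 < x')
    (hy' : 0 ≤ y') (h1 : sx k x y = sx k' x' y') (h2 : sy k x y = sy k' x' y') :
    k = k' ∧ x = x' ∧ y = y' := by
  have h := one_lt_φ
  have hφ := φ_mul_self
  have e1 := φ_mul_facts hx.le
  have e2 := φ_mul_facts hy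
  have e1' := φ_mul_facts hx'.le
  have e2' := φ_mul_facts hy'
  have h3 : φ * sx k x y = φ * sx k' x' y' := by rw [h1]
  have h4 : φ * sy k x y = φ * sy k' x' y' := by rw [h2]
  fin_cases k <;> fin_cases k' <;> simp [sx, sy, mul_add, ← mul_assoc] at h1 h2 h3 h4 ⊢ <;>
    first
    | (subst h2; exact ⟨by linarith, rfl⟩)
    | (subst h1; exact ⟨rfl, by linarith⟩)
    | exact ⟨by linarith, by linarith⟩
    | (exfalso; linarith)

theorem head?_of_concat {u : List (Fin 4)} {k : Fin 4} (h : (u ++ [k]).head? ≠ some 0) :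
    u.head? ≠ some 0 := by
  cases u <;> simp at h ⊢
  exact h

theorem vec_concat_ne (u : List (Fin 4)) (k : Fin 4) (h : (u ++ [k]).head? ≠ some 0) :
    vec (u ++ [k]) 1 ≠ vec [] 1 := by
  intro e
  have := vec_snd_pos h (by simp) one_pos
  rw [e] at this
  simp [vec_nil] at this

theorem vec_injective {u u' : List (Fin 4)} (hu : u.head? ≠ some 0) (hu' : u'.head? ≠ some 0)
    (h : vec u 1 = vec u' 1) : u = u' := by
  induction u using List.reverseRecOn generalizing u' with
  | nil =>
    rcases u'.eq_nil_or_concat' with rfl | ⟨w, k, rfl⟩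
    · rfl
    · exact absurd h.symm (vec_concat_ne w k hu')
  | append_singleton u k ih =>
    rcases u'.eq_nil_or_concat' with rfl | ⟨w, k', rfl⟩
    · exact absurd h (vec_concat_ne u k hu)
    · rw [vec_concat, vec_concat] at h
      obtain ⟨hx, hy⟩ := vec_pos u one_pos
      obtain ⟨hx', hy'⟩ := vec_pos w one_pos
      obtain ⟨rfl, h1, h2⟩ := sector_unique hx hy hx' hy' (congrArg Prod.fst h)
        (congrArg Prod.snd h)
      rw [ih (head?_of_concat hu) (head?_of_concat hu') (Prod.ext h1 h2)]

/-- A linear form modulo `√5` for every node of the graph. -/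
def nodeForm : Node → ZMod 5 × ZMod 5
  | .A => (1, 4) | .B => (1, 1) | .C => (1, 3) | .D => (1, 0) | .E => (1, 2) | .F => (0, 1)

/-- Modulo √5 the ring ℤ[φ] becomes 𝔽₅ with φ ↦ 3, and the vector becomes (a + 3b, c + 3d). The node
forms represent the six points of the projective line over 𝔽₅, and `back k` is composition with
`σ_k` up to a scalar, so only vanishing is compared. Among the six forms only that of F vanishes at
[1, 0]. -/
theorem exists_coef (u : List (Fin 4)) : ∃ a b c d : ℕ, vec u 1 = (a + b * φ, c + d * φ) ∧
    ∀ X, u.foldr back X = .F ↔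
      (nodeForm X).1 * (a + 3 * b) + (nodeForm X).2 * (c + 3 * d) = 0 := by
  induction u using List.reverseRecOn with
  | nil => exact ⟨1, 0, 0, 0, by simp [vec_nil], by intro X; cases X <;> simp [nodeForm] <;> decide⟩
  | append_singleton u k ih =>
    obtain ⟨a, b, c, d, h1, h2⟩ := ih
    have key : ∀ (k : Fin 4) (X : Node) (p q p' q' : ZMod 5),
        (k = 0 ∧ p' = p + 3 * q ∧ q' = q ∨ k = 1 ∧ p' = 3 * p + 3 * q ∧ q' = p + 3 * q ∨
          k = 2 ∧ p' = 3 * p + q ∧ q' = 3 * p + 3 * q ∨ k = 3 ∧ p' = p ∧ q' = 3 * p + q) →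
        ((nodeForm (back k X)).1 * p + (nodeForm (back k X)).2 * q = 0 ↔
          (nodeForm X).1 * p' + (nodeForm X).2 * q' = 0) := by
      intro k X p q p' q' h
      rcases h with ⟨hk, hp, hq⟩ | ⟨hk, hp, hq⟩ | ⟨hk, hp, hq⟩ | ⟨hk, hp, hq⟩ <;>
        rw [hk, hp, hq] <;> clear hk hp hq p' q' k <;> cases X <;> revert p q <;> decide
    have h3 := φ_mul_self
    have h5 : (5 : ZMod 5) = 0 := rfl
    simp only [List.foldr_append, List.foldr_cons, List.foldr_nil, h2, vec_concat, h1]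
    fin_cases k
    · refine ⟨a + d, b + c + d, c, d, ?_, fun X => key _ _ _ _ _ _ (Or.inl ⟨rfl, ?_, ?_⟩)⟩
      · simp [sx, sy]; linear_combination d * h3
      · push_cast; linear_combination (-d : ZMod 5) * h5
      · rfl
    · refine ⟨b + d, a + b + c + d, a + d, b + c + d, ?_,
        fun X => key _ _ _ _ _ _ (Or.inr (Or.inl ⟨rfl, ?_, ?_⟩))⟩
      · simp [sx, sy]; exact ⟨by linear_combination (b + d) * h3, by linear_combination d * h3⟩
      · push_cast; linear_combination (-b - d : ZMod 5) * h5
      · push_cast; linear_combination (-d : ZMod 5) * h5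
    · refine ⟨b + c, a + b + d, b + d, a + b + c + d, ?_,
        fun X => key _ _ _ _ _ _ (Or.inr (Or.inr (Or.inl ⟨rfl, ?_, ?_⟩)))⟩
      · simp [sx, sy]; exact ⟨by linear_combination b * h3, by linear_combination (b + d) * h3⟩
      · push_cast; linear_combination (-b : ZMod 5) * h5
      · push_cast; linear_combination (-b - d : ZMod 5) * h5
    · refine ⟨a, b, b + c, a + b + d, ?_,
        fun X => key _ _ _ _ _ _ (Or.inr (Or.inr (Or.inr ⟨rfl, ?_, ?_⟩)))⟩
      · simp [sx, sy]; linear_combination b * h3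
      · rfl
      · push_cast; linear_combination (-b : ZMod 5) * h5

/-- The number of sides crossed by a closed flow line, and the rotation that it undergoes when it
is folded into the table. -/
theorem counts_of_holonomy {u : List (Fin 4)} {c : ℝ} (hc : c = 1 ∨ c = φ) {a b c' d : ℕ}
    (hv : vec u 1 = (a + b * φ, c' + d * φ)) {n₃ n₄ m₀ m₁ m₂ : ℕ} (hn : m₀ + m₁ + m₂ = n₃ + n₄)
    (h1 : c * (vec u 1).1 = m₀ + (n₃ - m₂) * φ)
    (h2 : c * (vec u 1).2 = m₂ + (m₁ + m₂ - n₃) * φ) :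
    (c = 1 → n₃ + n₄ = a + b + c' + d) ∧ (c = φ → n₃ + n₄ = a + 2 * b + c' + 2 * d) ∧
      (n₃ • (7 : ZMod 5) + n₄ • 9 + m₀ • (-1) + m₁ • (-3) + m₂ • (-5) = 0 ↔
        (a + 3 * b : ZMod 5) = c' + 3 * d) := by
  rw [hv] at h1 h2
  have h3 := φ_mul_self
  have h5 : (5 : ZMod 5) = 0 := rfl
  have hn' : (n₄ : ZMod 5) = m₀ + m₁ + m₂ - n₃ := by
    have : (n₃ : ZMod 5) + n₄ = m₀ + m₁ + m₂ := by
      exact_mod_cast congrArg (Nat.cast : ℕ → ZMod 5) hn.symm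
    linear_combination this
  have hne := natCast_ne_φ 1
  simp only [Nat.cast_one] at hne
  -- The turning is three times the form p - q applied to the reduced holonomy. For c = φ the
  -- holonomy brings another factor φ ≡ 3, and 3 · 3 ≡ 4.
  have unit3 : ∀ z : ZMod 5, 3 * z = 0 ↔ z = 0 := by decide
  have unit4 : ∀ z : ZMod 5, 4 * z = 0 ↔ z = 0 := by decide
  rcases hc with rfl | rfl
  · have e1 := goldenRing_ext (a := a) (b := b) (c := m₀) (d := n₃ - m₂)
      (by push_cast; linarith)
    have e2 := goldenRing_ext (a := c') (b := d) (c := m₂) (d := m₁ + m₂ - n₃)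
      (by push_cast; linarith)
    refine ⟨fun _ => by omega, fun h => absurd h hne, ?_⟩
    have g1 : (a : ZMod 5) = m₀ := by exact_mod_cast congrArg (Int.cast : ℤ → ZMod 5) e1.1
    have g2 : (b : ZMod 5) = n₃ - m₂ := by exact_mod_cast congrArg (Int.cast : ℤ → ZMod 5) e1.2
    have g3 : (c' : ZMod 5) = m₂ := by exact_mod_cast congrArg (Int.cast : ℤ → ZMod 5) e2.1
    have g4 : (d : ZMod 5) = m₁ + m₂ - n₃ := by
      exact_mod_cast congrArg (Int.cast : ℤ → ZMod 5) e2.2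
    rw [← sub_eq_zero (a := (a : ZMod 5) + 3 * b), ← unit3 (_ - _), g1, g2, g3, g4]
    simp only [nsmul_eq_mul]
    rw [hn']
    refine Eq.congr ?_ rfl
    linear_combination (m₀ + 3 * m₁ + 5 * m₂ - 4 * n₃) * h5
  · have e1 := goldenRing_ext (a := b) (b := a + b) (c := m₀) (d := n₃ - m₂)
      (by push_cast; linear_combination h1 - b * h3)
    have e2 := goldenRing_ext (a := d) (b := c' + d) (c := m₂) (d := m₁ + m₂ - n₃)
      (by push_cast; linear_combination h2 - d * h3)
    refine ⟨fun h => absurd h.symm hne, fun _ => by omega, ?_⟩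
    have g1 : (b : ZMod 5) = m₀ := by exact_mod_cast congrArg (Int.cast : ℤ → ZMod 5) e1.1
    have g2 : (a : ZMod 5) = n₃ - m₂ - m₀ := by
      have : (a : ZMod 5) + b = n₃ - m₂ := by
        exact_mod_cast congrArg (Int.cast : ℤ → ZMod 5) e1.2
      linear_combination this - g1
    have g3 : (d : ZMod 5) = m₂ := by exact_mod_cast congrArg (Int.cast : ℤ → ZMod 5) e2.1
    have g4 : (c' : ZMod 5) = m₁ + m₂ - n₃ - m₂ := by
      have : (c' : ZMod 5) + d = m₁ + m₂ - n₃ := by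
        exact_mod_cast congrArg (Int.cast : ℤ → ZMod 5) e2.2
      linear_combination this - g3
    rw [← sub_eq_zero (a := (a : ZMod 5) + 3 * b), ← unit4 (_ - _), g1, g2, g3, g4]
    simp only [nsmul_eq_mul]
    rw [hn']
    refine Eq.congr ?_ rfl
    linear_combination (-2 * n₃ + 2 * m₁ + 4 * m₂) * h5

/-- The walk starts at A, whose form is p - q modulo 5. -/
theorem endNode_eq_F_iff {u : List (Fin 4)} {a b c d : ℕ}
    (hv : vec u 1 = (a + b * φ, c + d * φ)) :
    endNode u = .F ↔ (a + 3 * b : ZMod 5) = c + 3 * d := by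
  obtain ⟨a', b', c', d', h1, h2⟩ := exists_coef u
  rw [hv] at h1
  have e1 := goldenRing_ext (a := a) (b := b) (c := a') (d := b')
    (by exact_mod_cast congrArg Prod.fst h1)
  have e2 := goldenRing_ext (a := c) (b := d) (c := c') (d := d')
    (by exact_mod_cast congrArg Prod.snd h1)
  norm_cast at e1 e2
  obtain ⟨rfl, rfl⟩ := e1
  obtain ⟨rfl, rfl⟩ := e2
  rw [endNode, h2]
  have : ∀ p q : ZMod 5, (nodeForm .A).1 * p + (nodeForm .A).2 * q = 0 ↔ p = q := by decide
  exact this _ _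

/-! ### The symmetries of the table -/

open ComplexConjugate in
theorem conj_ζ : conj ζ = ζ ^ 4 := by
  rw [ζ_four, ζ_eq]
  apply Complex.ext <;> simp

/-- The fifth root of unity `ζ ^ a`. -/
def zp (a : ZMod 5) : ℂ := ζ ^ a.val

theorem ζ_pow_mod (n : ℕ) : ζ ^ (n % 5) = ζ ^ n := by
  conv_rhs => rw [← Nat.div_add_mod n 5, pow_add, pow_mul, ζ_five, one_pow, one_mul]

theorem zp_zero : zp 0 = 1 := by simp [zp]

theorem zp_add (a b : ZMod 5) : zp (a + b) = zp a * zp b := by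
  rw [zp, ZMod.val_add, ζ_pow_mod, pow_add, zp, zp]

theorem zp_mul_neg (a : ZMod 5) : zp a * zp (-a) = 1 := by rw [← zp_add, add_neg_cancel, zp_zero]

theorem zp_ne_zero (a : ZMod 5) : zp a ≠ 0 := left_ne_zero_of_mul_eq_one (zp_mul_neg a)

open ComplexConjugate in
theorem conj_zp (a : ZMod 5) : conj (zp a) = zp (-a) := by
  apply mul_left_cancel₀ (zp_ne_zero a)
  rw [zp_mul_neg, zp, map_pow, conj_ζ, ← mul_pow, ← pow_succ', ζ_five, one_pow]

theorem norm_zp (a : ZMod 5) : ‖zp a‖ = 1 := by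
  have h := Complex.mul_conj (zp a)
  rw [conj_zp, zp_mul_neg, Complex.normSq_eq_norm_sq] at h
  have h' : ‖zp a‖ ^ 2 = 1 := by exact_mod_cast h.symm
  exact by nlinarith [norm_nonneg (zp a)]

theorem zp_pow_five (a : ZMod 5) : zp a ^ 5 = 1 := by
  rw [zp, ← pow_mul, mul_comm, pow_mul, ζ_five, one_pow]

theorem zp_ne_neg_one (a : ZMod 5) : zp a ≠ -1 := by
  intro h
  have := zp_pow_five a
  rw [h] at this
  norm_num at this

theorem eq_zero_of_zp {a : ZMod 5} (h : zp a = 1) : a = 0 := by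
  have h1 := lt_φ
  have h2 := φ_lt
  have h3 := congrArg Complex.re h
  by_contra ha
  have : a = 1 ∨ a = 2 ∨ a = 3 ∨ a = 4 := by
    clear h h3; revert a; decide
  rcases this with rfl | rfl | rfl | rfl
  · change (ζ ^ 1).re = 1 at h3
    rw [pow_one, ζ_eq] at h3; simp at h3; linarith
  · change (ζ ^ 2).re = 1 at h3
    rw [ζ_sq] at h3; simp at h3; linarith
  · change (ζ ^ 3).re = 1 at h3
    rw [ζ_cube] at h3; simp at h3; linarith
  · change (ζ ^ 4).re = 1 at h3
    rw [ζ_four] at h3; simp at h3; linarith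

theorem zp_injective : Function.Injective zp := by
  intro a b h
  rw [← sub_eq_zero]
  apply eq_zero_of_zp
  rw [sub_eq_add_neg, zp_add, h, zp_mul_neg]

/-- Half the reciprocal of the sine of `2π / 5`: the circumradius of the table. -/
def circumradius : ℝ := (2 * Real.sin (2 * Real.pi / 5))⁻¹

/-- The index of a side as a residue. -/
def cz (i : Fin 5) : ZMod 5 := i

/-- The side with a given residue. -/
def zc (a : ZMod 5) : Fin 5 := a

theorem pent_zp (i : Fin 5) : pent i = circumradius * Complex.I * zp (cz i) := rfl

theorem pent_succ (i : Fin 5) : pent (i + 1) = circumradius * Complex.I * (zp (cz i) * zp 1) := by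
  rw [← zp_add]; rfl

theorem circumradius_ne_zero : circumradius ≠ 0 := by
  have := sn_pos
  have := lt_φ
  rw [circumradius, sn_inv]
  have : 0 < 2 * φ - 1 := by linarith
  positivity

/-- Symmetries of the table: a rotation, preceded by the reflection `x + iy ↦ -x + iy` for the
face `1`. -/
def fold (f : Fin 2) (a : ZMod 5) (z : ℂ) : ℂ := zp a * if f = 0 then z else -starRingEnd ℂ z

/-- Action of the symmetries of the table on the sides. -/
def foldSide (f : Fin 2) (a : ZMod 5) (i : Fin 5) : Fin 5 :=
  zc (if f = 0 then a + cz i else a - cz i - 1)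

/-- Inverse of `fold`. -/
def unfold (f : Fin 2) (a : ZMod 5) (z : ℂ) : ℂ := fold f (if f = 0 then -a else a) z

/-- Inverse of `foldSide`. -/
def unfoldSide (f : Fin 2) (a : ZMod 5) (i : Fin 5) : Fin 5 :=
  foldSide f (if f = 0 then -a else a) i

theorem fold_add_smul (f : Fin 2) (a : ZMod 5) (t : ℝ) (z w : ℂ) :
    fold f a (z + t • w) = fold f a z + t • fold f a w := by
  unfold fold
  split <;> simp <;> ring

theorem fold_unfold (f : Fin 2) (a : ZMod 5) (z : ℂ) : fold f a (unfold f a z) = z := by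
  have := zp_mul_neg a
  rcases fin_two f with rfl | rfl <;> simp [fold, unfold, conj_zp, ← mul_assoc, this]

theorem unfold_fold (f : Fin 2) (a : ZMod 5) (z : ℂ) : unfold f a (fold f a z) = z := by
  have := zp_mul_neg a
  rcases fin_two f with rfl | rfl <;> simp [fold, unfold, conj_zp, ← mul_assoc, this]
  rw [mul_comm (zp (-a)), this, one_mul]

theorem fold_injective (f : Fin 2) (a : ZMod 5) : Function.Injective (fold f a) :=
  Function.LeftInverse.injective (unfold_fold f a)

theorem foldSide_unfoldSide (f : Fin 2) (a : ZMod 5) (i : Fin 5) :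
    foldSide f a (unfoldSide f a i) = i := by revert f a i; decide

theorem unfoldSide_foldSide (f : Fin 2) (a : ZMod 5) (i : Fin 5) :
    unfoldSide f a (foldSide f a i) = i := by revert f a i; decide

theorem fold_mem {f : Fin 2} {a : ZMod 5} {i : Fin 5} {z : ℂ} (hz : z ∈ pentSide i) :
    fold f a z ∈ pentSide (foldSide f a i) := by
  obtain ⟨p, q, hp, hq, hpq, rfl⟩ := hz
  rcases fin_two f with rfl | rfl
  · refine ⟨p, q, hp, hq, hpq, ?_⟩
    have h : zp (cz (foldSide 0 a i)) = zp a * zp (cz i) := zp_add a (cz i)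
    rw [pent_succ, pent_succ, pent_zp, pent_zp, h]
    simp only [fold, if_true, Complex.real_smul]
    ring
  · refine ⟨q, p, hq, hp, by linarith, ?_⟩
    have h : zp (cz (foldSide 1 a i)) = zp a * (zp (-cz i) * zp (-1)) := by
      rw [← zp_add, ← zp_add]
      congr 1
      revert a i; decide
    have h1 := zp_mul_neg 1
    have hi : starRingEnd ℂ (zp (cz i)) = zp (-cz i) := conj_zp (cz i)
    rw [pent_succ, pent_succ, pent_zp, pent_zp, h]
    simp only [fold, one_ne_zero, if_false, Complex.real_smul, map_add, map_mul, Complex.conj_ofReal,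
      Complex.conj_I, hi, conj_zp]
    linear_combination (p * circumradius * Complex.I * zp a * zp (-cz i)) * h1

theorem unfold_mem {f : Fin 2} {a : ZMod 5} {i : Fin 5} {z : ℂ} (hz : z ∈ pentSide i) :
    unfold f a z ∈ pentSide (unfoldSide f a i) := fold_mem hz

/-- The change of the rotation angle when the trajectory leaves the face `f` through the
side `j`. -/
def turning (f : Fin 2) (j : Fin 5) : ZMod 5 :=
  if f = 0 then 2 * cz j + 1 else -(2 * cz j + 1)

/-- `turning` is the rotation that makes the folded position just after crossing the side `j` agree
with the folded exit point, so the folded path is continuous at a bounce. -/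
theorem fold_next {f : Fin 2} {a : ZMod 5} {j : Fin 5} {w : ℂ} (hw : w ∈ pentSide j) :
    fold (f + 1) (a + turning f j) (pent j + pent (j + 1) - w) = fold f a w := by
  obtain ⟨p, q, hp, hq, hpq, rfl⟩ := hw
  obtain rfl : q = 1 - p := by linarith
  have hj : starRingEnd ℂ (zp (cz j)) = zp (-cz j) := conj_zp (cz j)
  have h1 := zp_mul_neg 1
  have h2 : zp (cz j) * zp (-cz j) = 1 := zp_mul_neg (cz j)
  rw [pent_succ, pent_zp]
  rcases fin_two f with rfl | rfl
  · have h : zp (a + turning 0 j) = zp a * (zp (cz j) * zp (cz j) * zp 1) := by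
      rw [← zp_add, ← zp_add, ← zp_add, turning, if_pos rfl]; congr 1; ring
    simp [fold, hj, conj_zp, h]
    linear_combination (zp a * zp (cz j) * circumradius * Complex.I) *
      ((zp 1 * (1 - p) + p * zp 1 * zp (-1)) * h2 + p * h1)
  · have h : zp (a + turning 1 j) = zp a * (zp (-cz j) * zp (-cz j) * zp (-1)) := by
      rw [← zp_add, ← zp_add, ← zp_add, turning, if_neg one_ne_zero]; congr 1; ring
    simp [fold, hj, conj_zp, h]
    linear_combination (zp a * zp (-cz j) * circumradius * Complex.I) *
      (p * h1 + (zp (-1) * (1 - p) + zp (-1) * zp 1 * p) * h2)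

theorem foldSide_next (f : Fin 2) (a : ZMod 5) (j : Fin 5) :
    foldSide (f + 1) (a + turning f j) j = foldSide f a j := by
  revert f a j; decide

theorem reflectDir_pent (i : Fin 5) (u : ℂ) :
    reflectDir (pent (i + 1) - pent i) u = zp (2 * cz i + 1) * starRingEnd ℂ u := by
  have h1 := zp_mul_neg 1
  have hi : starRingEnd ℂ (zp (cz i)) = zp (-cz i) := conj_zp (cz i)
  have h2 : zp (cz i) * zp (-cz i) = 1 := zp_mul_neg (cz i)
  have h0 : (circumradius : ℂ) ≠ 0 := by exact_mod_cast circumradius_ne_zero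
  have h3 : zp (2 * cz i + 1) = zp (cz i) * zp (cz i) * zp 1 := by
    rw [← zp_add, ← zp_add]; congr 1; ring
  have h4 : zp (-1) - 1 ≠ 0 := by
    rw [sub_ne_zero, ← zp_zero]
    exact fun h => absurd (zp_injective h) (by decide)
  rw [reflectDir, pent_succ, pent_zp, h3]
  congr 1
  simp only [map_sub, map_mul, Complex.conj_ofReal, Complex.conj_I, hi, conj_zp]
  rw [div_eq_iff]
  · linear_combination (circumradius * Complex.I * zp (cz i)) * ((1 - zp 1) * h2 -
      zp (cz i) * zp (-cz i) * h1 * (-1))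
  · have : (circumradius : ℂ) * -Complex.I * (zp (-cz i) * zp (-1)) - circumradius * -Complex.I *
        zp (-cz i) = circumradius * -Complex.I * (zp (-cz i) * (zp (-1) - 1)) := by ring
    rw [this]
    exact mul_ne_zero (mul_ne_zero h0 (neg_ne_zero.2 Complex.I_ne_zero))
      (mul_ne_zero (zp_ne_zero _) h4)

/-- Crossing a side of the surface, seen after folding, is the reflection law at the folded side. -/
theorem reflect_next (f : Fin 2) (a : ZMod 5) (j : Fin 5) (θ : ℂ) :
    reflectDir (pent (foldSide f a j + 1) - pent (foldSide f a j)) (fold f a (turn f θ)) =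
      fold (f + 1) (a + turning f j) (turn (f + 1) θ) := by
  have h1 : zp (2 * cz (foldSide f a j) + 1) * zp (-a) = zp (a + turning f j) := by
    rw [← zp_add]; congr 1; revert f a j; decide
  rw [reflectDir_pent]
  rcases fin_two f with rfl | rfl <;> simp [fold, turn, conj_zp] <;> rw [← mul_assoc, h1]

/-! ### Folding -/

variable {x y : ℝ}

/-- The recursion has to run in both directions from 0, hence the invertible steps. -/
theorem exists_int_seq {α : Type*} (e : ℤ → α ≃ α) (a : α) :
    ∃ r : ℤ → α, r 0 = a ∧ ∀ k, r (k + 1) = e k (r k) := by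
  let up : ℕ → α := fun n => Nat.rec a (fun n b => e n b) n
  let down : ℕ → α := fun n => Nat.rec a (fun n b => (e (-(n + 1 : ℕ))).symm b) n
  refine ⟨fun k => match k with | .ofNat n => up n | .negSucc n => down (n + 1), rfl, ?_⟩
  rintro (n | n)
  · rfl
  · have h : (e (-(n + 1 : ℕ))) (down (n + 1)) = down n := Equiv.apply_symm_apply _ _
    have h1 : Int.negSucc n + 1 = -(n : ℤ) := by omega
    rw [h1]
    cases n with
    | zero => exact h.symm
    | succ n => exact h.symm

/-- The billiard trajectory `β` arises from `τ` by folding; `r` records the rotation of the table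
at each step. -/
structure IsFolding {θ : ℂ} (τ : doublePentagon.Trajectory θ) (β : BilliardTrajectory)
    (r : ℤ → ZMod 5) : Prop where
  zero : r 0 = 0
  succ : ∀ k, r (k + 1) = r k + turning (τ.face k) (τ.sideOut k)
  pt : ∀ k, β.pt k = fold (τ.face k) (r k) (turn (τ.face k) (τ.pt k))
  side : ∀ k, β.side k = foldSide (τ.face k) (r k) (τ.sideIn k)
  dir : ∀ k, β.dir k = fold (τ.face k) (r k) (turn (τ.face k) θ)
  time : ∀ k, β.time k = τ.time k

theorem foldSide_injective (f : Fin 2) (a : ZMod 5) : Function.Injective (foldSide f a) :=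
  Function.LeftInverse.injective (unfoldSide_foldSide f a)

theorem exists_isFolding {θ : ℂ} (τ : doublePentagon.Trajectory θ) :
    ∃ β r, IsFolding τ β r := by
  obtain ⟨r, h0, hr⟩ := exists_int_seq
    (fun k => Equiv.addRight (turning (τ.face k) (τ.sideOut k))) 0
  simp only [Equiv.coe_addRight] at hr
  have hside : ∀ k, foldSide (τ.face (k + 1)) (r (k + 1)) (τ.sideIn (k + 1)) =
      foldSide (τ.face k) (r k) (τ.sideOut k) := by
    intro k
    rw [face_succ, hr, sideIn_succ, foldSide_next]
  refine ⟨{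
    side := fun k => foldSide (τ.face k) (r k) (τ.sideIn k)
    pt := fun k => fold (τ.face k) (r k) (turn (τ.face k) (τ.pt k))
    dir := fun k => fold (τ.face k) (r k) (turn (τ.face k) θ)
    time := τ.time
    pt_mem := fun k => fold_mem (turn_mem.2 (τ.pt_mem k))
    time_pos := τ.time_pos
    side_ne := fun k => ?_
    next_pt := fun k => ?_
    next_dir := fun k => ?_ }, r, h0, hr, fun _ => rfl, fun _ => rfl, fun _ => rfl, fun _ => rfl⟩
  · rw [hside]
    exact fun h => τ.side_ne k (foldSide_injective _ _ h)
  · rw [← fold_add_smul, ← turn_add_smul, turn_pt_succ, face_succ, hr]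
    exact fold_next (turn_mem.2 (τ.exit_mem k))
  · rw [hside, reflect_next, face_succ, hr]

theorem IsFolding.isAssociated {θ : ℂ} {τ : doublePentagon.Trajectory θ} {β : BilliardTrajectory}
    {r : ℤ → ZMod 5} (h : IsFolding τ β r) (h0 : τ.face 0 = 0) : IsAssociated τ β := by
  refine ⟨h0, ?_, ?_, ?_⟩
  · rw [h.pt, h0, h.zero]; simp [fold, turn, zp_zero]
  · rw [h.side, h0, h.zero]
    generalize τ.sideIn 0 = i
    revert i; decide
  · rw [h.dir, h0, h.zero]; simp [fold, turn, zp_zero]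

theorem reflectDir_injective (i : Fin 5) :
    Function.Injective (reflectDir (pent (i + 1) - pent i)) := by
  intro u v h
  rw [reflectDir_pent, reflectDir_pent] at h
  exact (starRingEnd ℂ).injective (mul_left_cancel₀ (zp_ne_zero _) h)

/-- The associated billiard trajectory is unique. -/
theorem IsAssociated.exists_isFolding (hx : 0 < x) (hy : 0 ≤ y)
    {τ : doublePentagon.Trajectory (pl x y)} {β : BilliardTrajectory} (h : IsAssociated τ β) :
    ∃ r, IsFolding τ β r := by
  obtain ⟨hf, hpt, hside, hdir⟩ := h
  -- The rotations are read off from `β` alone: reflecting in the side s replaces r by 2s + 1 - r.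
  -- By `arith` this is the turning at the unfolded side.
  obtain ⟨r, h0, hr⟩ := exists_int_seq
    (fun k => Equiv.subLeft (2 * cz (β.side (k + 1)) + 1)) 0
  simp only [Equiv.subLeft_apply] at hr
  have arith : ∀ (f : Fin 2) (a : ZMod 5) (s : Fin 5),
      2 * cz s + 1 - a = a + turning f (unfoldSide f a s) ∧
        unfoldSide (f + 1) (a + turning f (unfoldSide f a s)) s = unfoldSide f a s := by decide
  set i : ℤ → Fin 5 := fun k => unfoldSide (τ.face k) (r k) (β.side k) with hi
  have hj : ∀ k, unfoldSide (τ.face k) (r k) (β.side (k + 1)) = i (k + 1) := by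
    intro k
    obtain ⟨a1, a2⟩ := arith (τ.face k) (r k) (β.side (k + 1))
    simp only [hi]
    rw [face_succ, hr, a1, a2]
  have hturn : ∀ k, r (k + 1) = r k + turning (τ.face k) (i (k + 1)) := by
    intro k
    rw [hr, (arith (τ.face k) (r k) (β.side (k + 1))).1, hj]
  have hs : ∀ k, β.side (k + 1) = foldSide (τ.face k) (r k) (i (k + 1)) := by
    intro k
    rw [← hj, foldSide_unfoldSide]
  have hd : ∀ k, β.dir k = fold (τ.face k) (r k) (turn (τ.face k) (pl x y)) := by
    have step : ∀ k, reflectDir (pent (β.side (k + 1) + 1) - pent (β.side (k + 1)))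
        (fold (τ.face k) (r k) (turn (τ.face k) (pl x y))) =
          fold (τ.face (k + 1)) (r (k + 1)) (turn (τ.face (k + 1)) (pl x y)) := by
      intro k
      rw [hs, reflect_next, face_succ, hturn]
    intro k
    induction k using Int.induction_on with
    | zero => rw [hdir, hf, h0]; simp [fold, turn, zp_zero]
    | succ k ih => rw [β.next_dir, ih, step]
    | pred k ih =>
      have h1 := β.next_dir (-k - 1)
      have h2 := step (-k - 1)
      rw [sub_add_cancel] at h1 h2
      rw [ih, ← h2] at h1
      exact (reflectDir_injective _ h1).symm
  set z : ℤ → ℂ := fun k => unfold (τ.face k) (r k) (β.pt k) with hz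
  have hzf : ∀ k, fold (τ.face k) (r k) (z k) = β.pt k := fun k => fold_unfold _ _ _
  have hzm : ∀ k, z k ∈ pentSide (i k) := fun k => unfold_mem (β.pt_mem k)
  have hw : ∀ k, fold (τ.face k) (r k) (z k + β.time k • turn (τ.face k) (pl x y)) =
      β.pt (k + 1) := by
    intro k
    rw [fold_add_smul, hzf, ← hd, β.next_pt]
  have hwm : ∀ k, z k + β.time k • turn (τ.face k) (pl x y) ∈ pentSide (i (k + 1)) := by
    intro k
    have := unfold_mem (f := τ.face k) (a := r k) (β.pt_mem (k + 1))
    rwa [← hw, unfold_fold, hj] at this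
  have hznext : ∀ k, z (k + 1) = pent (i (k + 1)) + pent (i (k + 1) + 1) -
      (z k + β.time k • turn (τ.face k) (pl x y)) := by
    intro k
    apply fold_injective (τ.face (k + 1)) (r (k + 1))
    rw [hzf, ← hw, face_succ, hturn, fold_next (hwm k)]
  -- The unfolding of `β` is a flow line with the same initial state as `τ`, so determinism in both
  -- directions identifies the two.
  have hseq : DSeq x y fun k => (τ.face k, i k, ell x y (z k)) := by
    intro k
    simp only
    rw [hznext, face_succ]
    refine dStep_of_chord hx hy (hzm k) (hwm k) (β.time_pos k) fun e => β.side_ne k ?_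
    rw [hs, e, hi]
    exact foldSide_unfoldSide _ _ _
  have hst := hseq.eq_of_eq hx hy (dSeq_st hx hy τ) (by
    have e0 : ∀ s : Fin 5, unfoldSide 0 0 s = s := by decide
    simp only [hi, hz, GluedPolygons.Trajectory.st, hf, h0, hside, hpt, e0]
    simp [unfold, fold, turn, zp_zero])
  have hin : ∀ k, i k = τ.sideIn k := fun k => congrArg (fun e => e.2.1) (congrFun hst k)
  have hzk : ∀ k, z k = turn (τ.face k) (τ.pt k) := by
    intro k
    have h1 := (hseq k).lo_lt
    have h2 := turn_mem.2 (τ.pt_mem k)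
    rw [← hin] at h2
    exact eq_of_ell_eq (h1.1.trans h1.2) (hzm k) h2 (congrArg (fun e => e.2.2) (congrFun hst k))
  refine ⟨r, h0, fun k => ?_, fun k => ?_, fun k => ?_, hd, fun k => ?_⟩
  · rw [hturn, hin, sideIn_succ]
  · rw [← hzf, hzk]
  · rw [← hin, hi]
    exact (foldSide_unfoldSide _ _ _).symm
  · have h1 := hznext k
    have h2 := turn_pt_succ τ k
    rw [← hzk, h1, hin, sideIn_succ, sub_right_inj, turn_add_smul, ← hzk] at h2
    refine time_unique (θ := turn (τ.face k) (pl x y)) ?_ h2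
    have := pl_ne_zero (y := y) hx
    unfold turn
    split <;> simp [this]

/-! ### Periods of billiard trajectories -/

variable {x y : ℝ}

theorem norm_turn (f : Fin 2) (z : ℂ) : ‖turn f z‖ = ‖z‖ := by
  unfold turn; split <;> simp

theorem norm_fold (f : Fin 2) (a : ZMod 5) (z : ℂ) : ‖fold f a z‖ = ‖z‖ := by
  unfold fold; split <;> simp [norm_zp]

theorem IsFolding.norm_dir {θ : ℂ} {τ : doublePentagon.Trajectory θ} {β : BilliardTrajectory}
    {r : ℤ → ZMod 5} (h : IsFolding τ β r) (k : ℤ) : ‖β.dir k‖ = ‖θ‖ := by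
  rw [h.dir, norm_fold, norm_turn]

theorem time_add (hx : 0 < x) (hy : 0 ≤ y) {τ : doublePentagon.Trajectory (pl x y)} {N : ℕ}
    (h : ∀ k : ℤ, τ.st x y (k + N) = τ.st x y k) (k : ℤ) : τ.time (k + N) = τ.time k := by
  have h1 := turn_pt_succ τ (k + N)
  have e := fun k => (st_eq_iff hx hy τ τ (k + N) k).1 (h k)
  have e' : τ.sideOut (k + N) = τ.sideOut k := by
    rw [← sideIn_succ, ← sideIn_succ, add_right_comm]
    exact congrArg (fun e => e.2.1) (h (k + 1))
  rw [add_right_comm, (e (k + 1)).1, (e (k + 1)).2, (e k).1, (e k).2, turn_pt_succ, e',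
    sub_right_inj, turn_add_smul, turn_add_smul] at h1
  refine (time_unique (θ := turn (τ.face k) (pl x y)) ?_ h1).symm
  rw [← norm_ne_zero_iff, norm_turn, norm_ne_zero_iff]
  exact pl_ne_zero hx

theorem IsFolding.succ_st {θ : ℂ} {τ : doublePentagon.Trajectory θ} {β : BilliardTrajectory}
    {r : ℤ → ZMod 5} (h : IsFolding τ β r) (x y : ℝ) (k : ℤ) :
    r (k + 1) = r k + turning ((τ.st x y (k + 1)).1 + 1) (τ.st x y (k + 1)).2.1 := by
  rw [h.succ]
  simp only [GluedPolygons.Trajectory.st]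
  rw [face_succ, sideIn_succ]
  congr 2
  generalize τ.face k = f
  revert f; decide

theorem IsFolding.r_eq_sum {θ : ℂ} {τ : doublePentagon.Trajectory θ} {β : BilliardTrajectory}
    {r : ℤ → ZMod 5} (h : IsFolding τ β r) (x y : ℝ) (n : ℕ) : r n =
    ∑ i ∈ Finset.range n, turning ((τ.st x y (i + 1)).1 + 1) (τ.st x y (i + 1)).2.1 := by
  induction n with
  | zero => simp [h.zero]
  | succ n ih =>
    rw [Finset.sum_range_succ, ← ih, Nat.cast_succ, h.succ_st x y]

theorem IsFolding.r_add {θ : ℂ} {τ : doublePentagon.Trajectory θ} {β : BilliardTrajectory}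
    {r : ℤ → ZMod 5} (h : IsFolding τ β r) {N : ℕ}
    (hN : ∀ k : ℤ, τ.st x y (k + N) = τ.st x y k) (k : ℤ) : r (k + N) = r k + r N := by
  have key : ∀ k : ℤ, r (k + 1 + N) - r (k + 1) = r (k + N) - r k := by
    intro k
    rw [add_right_comm, h.succ_st x y, h.succ_st x y, add_right_comm, hN]
    ring
  have : ∀ k : ℤ, r (k + N) - r k = r N := by
    intro k
    induction k using Int.induction_on with
    | zero => simp [h.zero]
    | succ k ih => rw [key, ih]
    | pred k ih => rw [← ih, ← key, sub_add_cancel]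
  rw [← this k]; ring

theorem IsFolding.r_add_mul {θ : ℂ} {τ : doublePentagon.Trajectory θ} {β : BilliardTrajectory}
    {r : ℤ → ZMod 5} (h : IsFolding τ β r) {N : ℕ}
    (hN : ∀ k : ℤ, τ.st x y (k + N) = τ.st x y k) (k : ℤ) (q : ℕ) :
    τ.st x y (k + (N * q : ℕ)) = τ.st x y k ∧ r (k + (N * q : ℕ)) = r k + q * r N := by
  induction q with
  | zero => simp
  | succ q ih =>
    have e : k + ((N * (q + 1) : ℕ) : ℤ) = k + (N * q : ℕ) + N := by push_cast; ring
    rw [e, hN, ih.1, h.r_add hN, ih.2]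
    exact ⟨rfl, by push_cast; ring⟩

/-- After q periods of `τ` the folded path repeats itself rotated by q · r N. This governs both the
period and the rotational symmetry of the billiard path. -/
theorem IsFolding.shift {τ : doublePentagon.Trajectory (pl x y)} {β : BilliardTrajectory}
    {r : ℤ → ZMod 5} (h : IsFolding τ β r) (hx : 0 < x) (hy : 0 ≤ y) {N : ℕ}
    (hN : ∀ k : ℤ, τ.st x y (k + N) = τ.st x y k) (q : ℕ) (k : ℤ) :
    β.pt (k + (N * q : ℕ)) = zp (q * r N) * β.pt k ∧
      β.dir (k + (N * q : ℕ)) = zp (q * r N) * β.dir k := by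
  obtain ⟨h1, h2⟩ := h.r_add_mul hN k q
  obtain ⟨h3, h4⟩ := (st_eq_iff hx hy τ τ _ _).1 h1
  rw [h.pt, h.pt, h.dir, h.dir, h2, h3, h4]
  simp only [fold, zp_add]
  constructor <;> ring

/-- The only direction in the sector that is parallel to one of its mirror images. -/
theorem eq_zero_of_conj (hx : 0 < x) (hy : 0 ≤ y) {a : ZMod 5}
    (h : starRingEnd ℂ (pl x y) = zp a * pl x y) : y = 0 := by
  have h1 := lt_φ
  have h2 := φ_lt
  have h3 := sn_pos
  have h4 := sn_mul_self
  have h5 := φ_mul_facts hy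
  have h6 := φ_mul_facts hx.le
  have hre := congrArg Complex.re h
  have him := congrArg Complex.im h
  have hys : 0 ≤ y * sn := by positivity
  have e : y * sn * sn = (3 - φ) / 4 * y := by rw [mul_assoc, h4]; ring
  have : a = 0 ∨ a = 1 ∨ a = 2 ∨ a = 3 ∨ a = 4 := by
    clear h hre him; revert a; decide
  rcases this with rfl | rfl | rfl | rfl | rfl
  · rw [zp_zero] at him
    simp [pl] at him
    have h7 : y * sn = 0 := by linarith
    rcases mul_eq_zero.1 h7 with h8 | h8
    · exact h8
    · exact absurd h8 h3.ne'
  · change _ = (ζ ^ 1 * _).re at hre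
    rw [pow_one, ζ_eq] at hre
    simp [pl] at hre
    have : 0 ≤ φ * (y * sn) := by positivity
    nlinarith
  · change _ = (ζ ^ 2 * _).re at hre
    rw [ζ_sq] at hre
    simp [pl] at hre
    nlinarith
  · change _ = (ζ ^ 3 * _).re at hre
    rw [ζ_cube] at hre
    simp [pl] at hre
    nlinarith
  · change _ = (ζ ^ 4 * _).re at hre
    rw [ζ_four] at hre
    simp [pl] at hre
    nlinarith

/-- A non-horizontal direction of the sector has ten different images under the folding maps, so the
direction of the billiard path reveals face and rotation. -/
theorem fold_eq_fold (hx : 0 < x) (hy : 0 ≤ y) {f f' : Fin 2} {a a' : ZMod 5}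
    (h : fold f a (turn f (pl x y)) = fold f' a' (turn f' (pl x y))) :
    y = 0 ∨ f = f' ∧ a = a' := by
  have hθ := pl_ne_zero (y := y) hx
  have hθ' : starRingEnd ℂ (pl x y) ≠ 0 := by simpa using hθ
  rcases fin_two f with rfl | rfl <;> rcases fin_two f' with rfl | rfl <;>
    simp [fold, turn, hθ, zp_injective.eq_iff] at h ⊢
  · exact Or.inr h
  · apply eq_zero_of_conj hx hy (a := -a' + a)
    rw [zp_add, mul_assoc, h, ← mul_assoc, mul_comm (zp (-a')), zp_mul_neg, one_mul]
  · apply eq_zero_of_conj hx hy (a := -a + a')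
    rw [zp_add, mul_assoc, ← h, ← mul_assoc, mul_comm (zp (-a)), zp_mul_neg, one_mul]
  · exact Or.inr h

theorem IsFolding.dvd_of_even {τ : doublePentagon.Trajectory (pl x y)} {β : BilliardTrajectory}
    {r : ℤ → ZMod 5} (h : IsFolding τ β r) (hx : 0 < x) (hy : 0 ≤ y) {N : ℕ}
    (hN : τ.HasCombPeriod N) {p : ℕ} (hp : τ.face p = τ.face 0) (h1 : β.pt p = β.pt 0)
    (h2 : β.dir p = β.dir 0) : ∃ q : ℕ, p = N * q ∧ (q : ZMod 5) * r N = 0 := by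
  have hN' := (hasCombPeriod_iff hx hy τ N).1 hN
  have hθ := pl_ne_zero (y := y) hx
  have hr : r p = r 0 := by
    rw [h.dir, h.dir, hp] at h2
    apply zp_injective
    have hne : (if τ.face 0 = 0 then turn (τ.face 0) (pl x y) else
        -starRingEnd ℂ (turn (τ.face 0) (pl x y))) ≠ 0 := by
      unfold turn; split <;> simpa using hθ
    exact mul_right_cancel₀ hne h2
  rw [h.pt, h.pt, hp, hr] at h1
  have h3 := fold_injective _ _ h1
  have h4 : τ.pt p = τ.pt 0 := by rw [← turn_turn (τ.face 0) (τ.pt p), h3, turn_turn]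
  have h5 : τ.st x y (0 + p) = τ.st x y 0 := by
    rw [zero_add, st_eq_iff hx hy]; exact ⟨hp, h4⟩
  obtain ⟨q, rfl⟩ := period_dvd hN' ((dSeq_st hx hy τ).periodic hx hy h5)
  refine ⟨q, rfl, ?_⟩
  have := (h.r_add_mul hN'.1.2 0 q).2
  rw [zero_add, hr] at this
  exact left_eq_add.1 this

theorem face_eq_iff (hx : 0 < x) (hy : 0 ≤ y) (τ : doublePentagon.Trajectory (pl x y))
    (k : ℤ) (p : ℕ) : τ.face (k + p) = τ.face k ↔ Even p := (dSeq_st hx hy τ).fst_eq_iff k p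

/-- When odd periods are excluded, the period of the billiard trajectory is that of the trajectory
on the double pentagon, multiplied by the order of the rotation. -/
theorem IsFolding.hasCombPeriod {τ : doublePentagon.Trajectory (pl x y)} {β : BilliardTrajectory}
    {r : ℤ → ZMod 5} (h : IsFolding τ β r) (hx : 0 < x) (hy : 0 ≤ y) {N q : ℕ}
    (hN : τ.HasCombPeriod N) (hq : IsLeast {q : ℕ | 0 < q ∧ (q : ZMod 5) * r N = 0} q)
    (hodd : ∀ p : ℕ, (∀ k : ℤ, β.pt (k + p) = β.pt k ∧ β.dir (k + p) = β.dir k) → Even p) :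
    β.HasCombPeriod (N * q) := by
  have hN' := (hasCombPeriod_iff hx hy τ N).1 hN
  refine ⟨⟨Nat.mul_pos hN.1.1 hq.1.1, fun k => ?_⟩, ?_⟩
  · have := h.shift hx hy hN'.1.2 q k
    rwa [hq.1.2, zp_zero, one_mul, one_mul] at this
  · rintro p ⟨hp, hper⟩
    have hev := hodd p hper
    have hf := (face_eq_iff hx hy τ 0 p).2 hev
    have hp0 := hper 0
    rw [zero_add] at hf hp0
    obtain ⟨q', rfl, hq'⟩ := h.dvd_of_even hx hy hN hf hp0.1 hp0.2
    exact Nat.mul_le_mul_left N (hq.2 ⟨Nat.pos_of_mul_pos_left hp, hq'⟩)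

/-- An odd shift changes the face, so equality of directions would identify the direction with a
mirror image of itself. -/
theorem IsFolding.even_of_ne {τ : doublePentagon.Trajectory (pl x y)} {β : BilliardTrajectory}
    {r : ℤ → ZMod 5} (h : IsFolding τ β r) (hx : 0 < x) (hy : 0 ≤ y) (hy' : y ≠ 0) {p : ℕ}
    (hp : ∀ k : ℤ, β.pt (k + p) = β.pt k ∧ β.dir (k + p) = β.dir k) : Even p := by
  have h1 := (hp 0).2
  rw [h.dir, h.dir] at h1
  rcases fold_eq_fold hx hy h1 with h2 | h2
  · exact absurd h2 hy'
  · exact (face_eq_iff hx hy τ 0 p).1 h2.1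

theorem isLeast_one {a : ZMod 5} (ha : a = 0) :
    IsLeast {q : ℕ | 0 < q ∧ (q : ZMod 5) * a = 0} 1 :=
  ⟨⟨one_pos, by simp [ha]⟩, fun _ h => h.1⟩

theorem isLeast_five {a : ZMod 5} (ha : a ≠ 0) :
    IsLeast {q : ℕ | 0 < q ∧ (q : ZMod 5) * a = 0} 5 := by
  refine ⟨⟨by norm_num, ?_⟩, ?_⟩
  · have : ((5 : ℕ) : ZMod 5) = 0 := rfl
    rw [this, zero_mul]
  · rintro q ⟨hq, h⟩
    have h1 : (q : ZMod 5) = 0 := by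
      have : ∀ a b : ZMod 5, a ≠ 0 → b * a = 0 → b = 0 := by decide
      exact this a q ha h
    exact Nat.le_of_dvd hq ((ZMod.natCast_eq_zero_iff q 5).1 h1)

theorem IsFolding.hasLength {τ : doublePentagon.Trajectory (pl x y)} {β : BilliardTrajectory}
    {r : ℤ → ZMod 5} (h : IsFolding τ β r) (hx : 0 < x) (hy : 0 ≤ y) {N q : ℕ} {ℓ : ℝ}
    (hN : τ.HasCombPeriod N) (hℓ : τ.HasLength ℓ) (hβ : β.HasCombPeriod (N * q)) :
    β.HasLength (q * ℓ) := by
  obtain ⟨N', hN', rfl⟩ := hℓ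
  obtain rfl := IsLeast.unique hN hN'
  refine ⟨N * q, hβ, ?_⟩
  have hper := ((hasCombPeriod_iff hx hy τ N).1 hN).1.2
  have := sum_range_mul_period (f := fun k => τ.time k * ‖pl x y‖) (m := N)
    (fun k => by rw [time_add hx hy hper]) q
  rw [nsmul_eq_mul] at this
  rw [← this]
  exact Finset.sum_congr rfl fun k _ => by rw [h.norm_dir, h.time]

/-! ### Horizontal trajectories -/

theorem DCross.horizontal {i j : Fin 5} {s : ℝ} (hx : 0 < x) (h : DCross x 0 i j s) :
    (i = 0 ∧ j = 4) ∨ (i = 1 ∧ j = 3) := by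
  have h1 := lt_φ
  obtain ⟨h2, h3, h4, h5, h6, h7⟩ := h
  rcases h2 with rfl | rfl | rfl <;> rcases h3 with rfl | rfl <;> simp [lo, hi] at * <;> linarith

/-- Horizontal lines join the sides 0 and 4 or the sides 1 and 3, which are mirror images in the
vertical axis and have equal transverse intervals. -/
theorem DStep.horizontal {e e' : DState} (hx : 0 < x) (h : DStep x 0 e e') :
    e'.2.1 = foldSide 1 0 e.2.1 ∧ turning e.1 e'.2.1 = turning e'.1 e.2.1 ∧
      turning e.1 e'.2.1 ≠ 0 ∧ e'.2.2 = lo x 0 e'.2.1 + hi x 0 e'.2.1 - e.2.2 ∧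
      lo x 0 e'.2.1 = lo x 0 e.2.1 ∧ hi x 0 e'.2.1 = hi x 0 e.2.1 := by
  cases h with
  | zero h =>
    rcases h.horizontal hx with ⟨rfl, rfl⟩ | ⟨rfl, rfl⟩ <;>
      refine ⟨by dsimp only; decide, by dsimp only; decide, by dsimp only; decide, rfl, ?_, ?_⟩ <;> simp [lo, hi]
  | one h =>
    rcases h.horizontal hx with ⟨rfl, rfl⟩ | ⟨rfl, rfl⟩ <;>
      refine ⟨by dsimp only; decide, by dsimp only; decide, by dsimp only; decide, rfl, ?_, ?_⟩ <;> simp [lo, hi]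

theorem conj_pl_zero (x : ℝ) : starRingEnd ℂ (pl x 0) = pl x 0 := by
  apply Complex.ext <;> simp [pl]

theorem fold_turn_horizontal (f : Fin 2) (a : ZMod 5) : fold f a (turn f (pl x 0)) = zp a * pl x 0 := by
  rcases fin_two f with rfl | rfl <;> simp [fold, turn, conj_pl_zero]

theorem ell_mirror (x : ℝ) (z : ℂ) : ell x 0 (fold 1 0 z) = ell x 0 z := by
  simp [ell, c₂, fold, zp_zero]

theorem fold_mirror (f : Fin 2) (a : ZMod 5) (z : ℂ) : fold (f + 1) a (fold 1 0 z) = fold f a z := by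
  rcases fin_two f with rfl | rfl <;> simp [fold, zp_zero]

section Horizontal

variable {τ : doublePentagon.Trajectory (pl x 0)} {β : BilliardTrajectory} {r : ℤ → ZMod 5}

/-- Along a horizontal trajectory every step has the same turning, so the rotations form an
arithmetic progression with nonzero difference. -/
theorem IsFolding.exists_turning (h : IsFolding τ β r) (hx : 0 < x)
    (hN : ∀ k : ℤ, τ.st x 0 (k + 2) = τ.st x 0 k) :
    ∃ g : ZMod 5, g ≠ 0 ∧ ∀ (k : ℤ) (n : ℕ), r (k + n) = r k + n * g := by
  have hst := dSeq_st hx le_rfl τ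
  have hone : ∀ k, r (k + 1) = r k + turning (τ.st x 0 k).1 (τ.st x 0 (k + 1)).2.1 := by
    intro k
    rw [h.succ, ← sideIn_succ]; rfl
  have hconst : ∀ k, turning (τ.st x 0 (k + 1)).1 (τ.st x 0 (k + 1 + 1)).2.1 =
      turning (τ.st x 0 k).1 (τ.st x 0 (k + 1)).2.1 := by
    intro k
    have := ((hst k).horizontal hx).2.1
    rw [this, add_assoc, one_add_one_eq_two, hN]
  have hall : ∀ k, turning (τ.st x 0 k).1 (τ.st x 0 (k + 1)).2.1 =
      turning (τ.st x 0 0).1 (τ.st x 0 (0 + 1)).2.1 := by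
    intro k
    induction k using Int.induction_on with
    | zero => rfl
    | succ k ih => rw [hconst, ih]
    | pred k ih =>
      rw [← ih]
      have := hconst (-k - 1)
      rw [sub_add_cancel] at this
      rw [this, sub_add_cancel]
  refine ⟨_, ((hst 0).horizontal hx).2.2.1, fun k n => ?_⟩
  induction n with
  | zero => simp
  | succ n ih =>
    rw [Nat.cast_succ, ← add_assoc, hone, ih, hall (k + n)]
    push_cast; ring

theorem st_add_two_mul {st : ℤ → DState} (hN : ∀ k : ℤ, st (k + 2) = st k) (k m : ℤ) :
    st (k + 2 * m) = st k := by
  induction m using Int.induction_on with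
  | zero => simp
  | succ m ih => rw [mul_add, ← add_assoc, mul_one, hN, ih]
  | pred m ih => rw [← ih, ← hN, mul_sub]; congr 1; ring

/-- Equality of folded points at an odd distance makes consecutive points mirror images, hence of
equal transverse distance; but a horizontal step flips that distance about the middle of the
interval, so it is the middle. -/
theorem IsFolding.throughMidpoint_of_odd (h : IsFolding τ β r) (hx : 0 < x)
    (hN : ∀ k : ℤ, τ.st x 0 (k + 2) = τ.st x 0 k) {p : ℕ}
    (hp : ∀ k : ℤ, β.pt (k + p) = β.pt k ∧ β.dir (k + p) = β.dir k) (hodd : ¬ Even p) :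
    τ.ThroughMidpoint := by
  obtain ⟨m, rfl⟩ := Nat.not_even_iff_odd.1 hodd
  have hst := dSeq_st hx le_rfl τ
  obtain ⟨h1, h2⟩ := hp 0
  have hθ := pl_ne_zero (y := 0) hx
  rw [h.dir, h.dir, fold_turn_horizontal, fold_turn_horizontal] at h2
  have hr := zp_injective (mul_right_cancel₀ hθ h2)
  have h3 : τ.st x 0 (0 + ((2 * m + 1 : ℕ) : ℤ)) = τ.st x 0 (0 + 1) := by
    rw [← st_add_two_mul hN (0 + 1) m]; congr 1; push_cast; ring
  obtain ⟨h4, h5⟩ := (st_eq_iff hx le_rfl τ τ _ _).1 h3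
  rw [h.pt, h.pt, hr, h4, h5, face_succ, ← fold_mirror (τ.face 0)] at h1
  have h6 := fold_injective _ _ h1
  have h7 : (τ.st x 0 (0 + 1)).2.2 = (τ.st x 0 0).2.2 := by
    simp only [GluedPolygons.Trajectory.st]
    rw [face_succ, h6, ell_mirror]
  rw [throughMidpoint_iff hx le_rfl]
  refine ⟨0 + 1, ?_⟩
  have h8 := ((hst 0).horizontal hx).2.2.2.1
  rw [← h7] at h8
  unfold dinv
  rw [← h8]

/-- On a horizontal core curve every point is a side midpoint and consecutive points are mirror
images. The change of face is absorbed by the mirror, so any step repeats the path up to the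
rotation g, and five steps suffice since 5g = 0. -/
theorem IsFolding.horizontal_core (h : IsFolding τ β r) (hx : 0 < x) (hN : τ.HasCombPeriod 2)
    (hm : τ.ThroughMidpoint) {ℓ : ℝ} (hℓ : τ.HasLength ℓ) :
    β.HasCombPeriod 5 ∧ β.HasLength (5 / 2 * ℓ) := by
  have hst := dSeq_st hx le_rfl τ
  have hper := ((hasCombPeriod_iff hx le_rfl τ 2).1 hN).1.2
  simp only [Nat.cast_ofNat] at hper
  have hθ := pl_ne_zero (y := 0) hx
  have hcore : ∀ k, dinv x 0 (τ.st x 0 k) = τ.st x 0 k := by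
    obtain ⟨k, hk⟩ := (throughMidpoint_iff hx le_rfl τ).1 hm
    have h1 := (hst.dinv.shift (-k)).eq_of_eq hx le_rfl (hst.shift k) (by simpa using hk)
    intro m
    have h2 := congrFun h1 (m - k)
    simp only [sub_add_cancel] at h2
    rwa [show -(m - k + -k) = m + 2 * (k - m) by ring, st_add_two_mul hper] at h2
  set z : ℤ → ℂ := fun k => turn (τ.face k) (τ.pt k) with hz
  have hzm : ∀ k, z k ∈ pentSide (τ.sideIn k) := fun k => turn_mem.2 (τ.pt_mem k)
  have hlt : ∀ k, lo x 0 (τ.sideIn k) < hi x 0 (τ.sideIn k) := fun k =>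
    (hst k).lo_lt.1.trans (hst k).lo_lt.2
  have hell : ∀ k, lo x 0 (τ.sideIn k) + hi x 0 (τ.sideIn k) - ell x 0 (z k) = ell x 0 (z k) :=
    fun k => congrArg (fun e => e.2.2) (hcore k)
  have hzs : ∀ k, z (k + 1) = fold 1 0 (z k) := by
    intro k
    obtain ⟨h1, -, -, -, h2, h3⟩ := (hst k).horizontal hx
    have h4 := fold_mem (f := 1) (a := 0) (hzm k)
    rw [← show τ.sideIn (k + 1) = foldSide 1 0 (τ.sideIn k) from h1] at h4
    refine eq_of_ell_eq (hlt _) (hzm _) h4 ?_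
    rw [ell_mirror]
    have h5 := hell k
    have h6 := hell (k + 1)
    simp only [GluedPolygons.Trajectory.st] at h2 h3
    linarith
  have hzflip : ∀ k, pent (τ.sideIn k) + pent (τ.sideIn k + 1) - z k = z k := fun k =>
    eq_of_ell_eq (hlt k) (flip_mem (hzm k)) (hzm k) ((ell_sum_sub _ _ _ _).trans (hell k))
  have hzt : ∀ k, z (k + 1) = z k + τ.time k • turn (τ.face k) (pl x 0) := by
    intro k
    have h1 := turn_pt_succ τ k
    have h2 := hzflip (k + 1)
    rw [turn_add_smul, ← sideIn_succ] at h1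
    change z (k + 1) = _ - (z k + _) at h1
    linear_combination -h2 - h1
  have hz2 : ∀ k, z (k + 1 + 1) = z k := by
    intro k
    have := (st_eq_iff hx le_rfl τ τ _ _).1 (hper k)
    rw [add_assoc, one_add_one_eq_two]
    simp only [hz, this.1, this.2]
  have htime : ∀ k, τ.time (k + 1) = τ.time k := by
    intro k
    have h1 := hzt (k + 1)
    rw [hz2, hzt, face_succ, turn_succ] at h1
    have h2 : (τ.time k - τ.time (k + 1)) • turn (τ.face k) (pl x 0) = 0 := by
      rw [sub_smul]
      rw [smul_neg] at h1
      linear_combination -h1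
    rcases smul_eq_zero.1 h2 with h3 | h3
    · linarith
    · rw [← norm_eq_zero, norm_turn, norm_eq_zero] at h3
      exact absurd h3 hθ
  obtain ⟨g, hg, hr⟩ := h.exists_turning hx hper
  have hfive : ((5 : ℕ) : ZMod 5) = 0 := rfl
  have hβ : β.HasCombPeriod 5 := by
    refine ⟨⟨by norm_num, fun k => ?_⟩, ?_⟩
    · have h1 : τ.st x 0 (k + ((5 : ℕ) : ℤ)) = τ.st x 0 (k + 1) := by
        rw [← st_add_two_mul hper (k + 1) 2]; congr 1; push_cast; ring
      obtain ⟨h2, h3⟩ := (st_eq_iff hx le_rfl τ τ _ _).1 h1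
      rw [h.pt, h.pt, h.dir, h.dir, fold_turn_horizontal, fold_turn_horizontal, hr, hfive, zero_mul,
        add_zero, h2, h3]
      refine ⟨?_, rfl⟩
      change fold _ _ (z (k + 1)) = fold _ _ (z k)
      rw [hzs, face_succ, fold_mirror]
    · rintro p ⟨hp, hpp⟩
      have h1 := (hpp 0).2
      rw [h.dir, h.dir, fold_turn_horizontal, fold_turn_horizontal, hr] at h1
      have h2 := add_eq_left.1 (zp_injective (mul_right_cancel₀ hθ h1))
      exact (isLeast_five hg).2 ⟨hp, h2⟩
  refine ⟨hβ, 5, hβ, ?_⟩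
  obtain ⟨N', hN', rfl⟩ := hℓ
  obtain rfl := IsLeast.unique hN hN'
  have h1 := htime 0
  have h2 := htime 1
  have h3 := htime 2
  have h4 := htime 3
  norm_num at h1 h2 h3 h4
  simp [Finset.sum_range_succ, h.norm_dir, h.time, h1, h2, h3, h4]
  ring

end Horizontal

/-! ### Symmetries of billiard trajectories -/

variable {x y : ℝ}

theorem d5_r (k : ZMod 5) : d5 (.r k) = fold 0 k := by
  funext z; simp [d5, fold, zp, ζ]

theorem d5_sr (k : ZMod 5) : d5 (.sr k) = fold 1 (-k) := by
  funext z
  have : d5 (.sr k) z = -starRingEnd ℂ (zp k * z) := rfl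
  rw [this]
  simp [fold, conj_zp]

theorem fold_image_segment (f : Fin 2) (a : ZMod 5) (z w : ℂ) :
    fold f a '' segment ℝ z w = segment ℝ (fold f a z) (fold f a w) := by
  have h : ∀ p q : ℝ, fold f a (p • z + q • w) = p • fold f a z + q • fold f a w := by
    intro p q
    unfold fold; split <;> simp <;> ring
  ext v
  constructor
  · rintro ⟨_, ⟨p, q, hp, hq, hpq, rfl⟩, rfl⟩
    exact ⟨p, q, hp, hq, hpq, (h p q).symm⟩
  · rintro ⟨p, q, hp, hq, hpq, rfl⟩
    exact ⟨_, ⟨p, q, hp, hq, hpq, rfl⟩, h p q⟩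

theorem trace_image {β : BilliardTrajectory} (f : Fin 2) (a : ZMod 5) (e : ℤ ≃ ℤ)
    (h : ∀ k, segment ℝ (fold f a (β.pt k)) (fold f a (β.pt (k + 1))) =
      segment ℝ (β.pt (e k)) (β.pt (e k + 1))) : fold f a '' β.trace = β.trace := by
  rw [BilliardTrajectory.trace, Set.image_iUnion]
  simp only [fold_image_segment, h]
  exact e.surjective.iUnion_comp fun k => segment ℝ (β.pt k) (β.pt (k + 1))

/-- The multiples of a nonzero r N exhaust ℤ/5, so every rotation of the path is a shift along it.
-/
theorem IsFolding.rotationSymmetry {τ : doublePentagon.Trajectory (pl x y)}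
    {β : BilliardTrajectory} {r : ℤ → ZMod 5} (h : IsFolding τ β r) (hx : 0 < x) (hy : 0 ≤ y)
    {N : ℕ} (hN : τ.HasCombPeriod N) (hr : r N ≠ 0) : RotationSymmetry β.trace := by
  intro κ
  have hN' := ((hasCombPeriod_iff hx hy τ N).1 hN).1.2
  obtain ⟨q, hq⟩ : ∃ q : ℕ, (q : ZMod 5) * r N = κ := by
    have : ∀ a b : ZMod 5, a ≠ 0 → ∃ c : ZMod 5, c * a = b := by decide
    obtain ⟨c, hc⟩ := this (r N) κ hr
    exact ⟨c.val, by rw [ZMod.natCast_zmod_val, hc]⟩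
  have hshift : ∀ k : ℤ, fold 0 κ (β.pt k) = β.pt (k + (N * q : ℕ)) := by
    intro k
    rw [(h.shift hx hy hN' q k).1, hq]; simp [fold]
  rw [d5_r]
  refine trace_image 0 κ (Equiv.addRight ((N * q : ℕ) : ℤ)) fun k => ?_
  rw [hshift, hshift, Equiv.coe_addRight, add_right_comm]

theorem turning_succ (f : Fin 2) (j : Fin 5) : turning (f + 1) j = -turning f j := by
  revert f j; decide

theorem fold_one_fold (f : Fin 2) (b a : ZMod 5) (w : ℂ) :
    fold 1 (b + a) (fold f a w) = fold (f + 1) b w := by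
  have := zp_mul_neg a
  rcases fin_two f with rfl | rfl <;> simp [fold, zp_add, conj_zp] <;>
    first | linear_combination (zp b * starRingEnd ℂ w) * this |
      linear_combination (zp b * w) * this

/-- A trajectory through the midpoint of a side is symmetric. -/
theorem IsFolding.exists_reflection {τ : doublePentagon.Trajectory (pl x y)}
    {β : BilliardTrajectory} {r : ℤ → ZMod 5} (h : IsFolding τ β r) (hx : 0 < x) (hy : 0 ≤ y)
    (hm : τ.ThroughMidpoint) : ∃ (a : ZMod 5) (k₀ : ℤ),
      ∀ j : ℤ, β.pt (k₀ + j) = fold 1 a (β.pt (k₀ - j)) := by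
  have hst := dSeq_st hx hy τ
  obtain ⟨k₀, hk⟩ := (throughMidpoint_iff hx hy τ).1 hm
  have h1 := (hst.dinv.shift (-k₀)).eq_of_eq hx hy (hst.shift k₀) (by simpa using hk)
  have h2 : ∀ j : ℤ, τ.st x y (k₀ + j) = dinv x y (τ.st x y (k₀ - j)) := by
    intro j
    have := congrFun h1 j
    rw [add_comm k₀ j, ← this]
    congr 2; ring
  have hf : ∀ j : ℤ, τ.face (k₀ + j) = τ.face (k₀ - j) := fun j => congrArg Prod.fst (h2 j)
  have hi : ∀ j : ℤ, τ.sideIn (k₀ + j) = τ.sideIn (k₀ - j) := fun j =>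
    congrArg (fun e => e.2.1) (h2 j)
  have hz : ∀ j : ℤ, turn (τ.face (k₀ + j)) (τ.pt (k₀ + j)) =
      pent (τ.sideIn (k₀ - j)) + pent (τ.sideIn (k₀ - j) + 1) -
        turn (τ.face (k₀ - j)) (τ.pt (k₀ - j)) := by
    intro j
    have h3 := (hst (k₀ - j)).lo_lt
    have h4 := turn_mem.2 (τ.pt_mem (k₀ + j))
    rw [hi] at h4
    exact eq_of_ell_eq (h3.1.trans h3.2) h4 (flip_mem (turn_mem.2 (τ.pt_mem (k₀ - j))))
      ((congrArg (fun e => e.2.2) (h2 j)).trans (ell_sum_sub _ _ _ _).symm)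
  -- The parameter of the reflection that should exchange the steps k₀ + j and k₀ - j. It does not
  -- depend on j, because the turnings at mirrored steps cancel.
  set a : ℤ → ZMod 5 := fun j =>
    r (k₀ + j) + turning (τ.face (k₀ - j)) (τ.sideIn (k₀ - j)) + r (k₀ - j) with ha
  have hconst : ∀ j, a (j + 1) = a j := by
    intro j
    have e1 := h.succ (k₀ + j)
    have e2 := h.succ (k₀ - (j + 1))
    have e3 : k₀ - (j + 1) + 1 = k₀ - j := by ring
    have e4 := face_succ τ (k₀ - (j + 1))
    rw [← sideIn_succ, add_assoc, hi, hf] at e1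
    rw [← sideIn_succ, e3] at e2
    rw [e3] at e4
    simp only [ha]
    rw [e1, e2, e4, turning_succ, turning_succ]
    ring
  have hall : ∀ j, a j = a 0 := by
    intro j
    induction j using Int.induction_on with
    | zero => rfl
    | succ j ih => rw [hconst, ih]
    | pred j ih => rw [← ih, ← hconst, sub_add_cancel]
  refine ⟨a 0, k₀, fun j => ?_⟩
  rw [← hall j, h.pt, h.pt, hz, ha, fold_one_fold]
  have h5 := fold_next (f := τ.face (k₀ - j) + 1)
    (a := r (k₀ + j) + turning (τ.face (k₀ - j)) (τ.sideIn (k₀ - j)))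
    (turn_mem.2 (τ.pt_mem (k₀ - j)))
  rw [turning_succ, add_neg_cancel_right] at h5
  rw [← h5, hf]
  congr 1
  generalize τ.face (k₀ - j) = f
  revert f; decide

theorem IsFolding.exists_reflection_trace {τ : doublePentagon.Trajectory (pl x y)}
    {β : BilliardTrajectory} {r : ℤ → ZMod 5} (h : IsFolding τ β r) (hx : 0 < x) (hy : 0 ≤ y)
    (hm : τ.ThroughMidpoint) : ∃ a : ZMod 5, fold 1 a '' β.trace = β.trace := by
  obtain ⟨a, k₀, h1⟩ := h.exists_reflection hx hy hm
  refine ⟨a, trace_image 1 a (Equiv.subLeft (2 * k₀ - 1)) fun k => ?_⟩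
  have h2 := h1 (k₀ - k)
  have h3 := h1 (k₀ - k - 1)
  rw [show k₀ - (k₀ - k) = k by ring] at h2
  rw [show k₀ - (k₀ - k - 1) = k + 1 by ring] at h3
  rw [← h2, ← h3, segment_symm, Equiv.subLeft_apply]
  congr 2 <;> ring

theorem fold_fold_image {f : Fin 2} {a b : ZMod 5} {S : Set ℂ}
    (h1 : fold 0 a '' S = S) (h2 : fold f b '' S = S) : fold f (a + b) '' S = S := by
  conv_rhs => rw [← h1, ← h2, Set.image_image]
  refine Set.image_congr fun z _ => ?_
  simp [fold, zp_add, mul_assoc]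

theorem fullSymmetry_of {S : Set ℂ} (h : RotationSymmetry S) {a : ZMod 5}
    (ha : fold 1 a '' S = S) : FullSymmetry S := by
  rintro (k | k)
  · exact h k
  · rw [d5_sr]
    have := h (-k - a)
    rw [d5_r] at this
    have := fold_fold_image this ha
    rwa [sub_add_cancel] at this

theorem onlyBilateralSymmetry_of {S : Set ℂ} (h : NoRotationSymmetry S) {a : ZMod 5}
    (ha : fold 1 a '' S = S) : OnlyBilateralSymmetry S := by
  refine ⟨-a, ?_⟩
  rintro (k | k)
  · constructor
    · intro hk
      left
      rw [h k hk]; rfl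
    · rintro (hk | hk)
      · rw [DihedralGroup.one_def, DihedralGroup.r.injEq] at hk
        subst hk
        rw [d5_r]
        rw [show fold 0 0 = id by funext z; simp [fold, zp_zero], Set.image_id]
      · cases hk
  · constructor
    · intro hk
      right
      rw [d5_sr] at hk
      have : d5 (.r (a + k)) '' S = S := by
        rw [d5_r]
        conv_rhs => rw [← ha, ← hk, Set.image_image]
        refine Set.image_congr fun z _ => ?_
        simp [fold, zp_add, conj_zp, mul_assoc]
      have h0 := h _ this
      rw [eq_neg_of_add_eq_zero_right h0]
    · rintro (hk | hk)
      · cases hk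
      · simp only [DihedralGroup.sr.injEq] at hk
        subst hk
        rw [d5_sr, neg_neg, ha]

/-! ### Absence of rotational symmetry -/

theorem IsAssociated.pt_eq (hx : 0 < x) (hy : 0 ≤ y) {τ : doublePentagon.Trajectory (pl x y)}
    {β β' : BilliardTrajectory} (h : IsAssociated τ β) (h' : IsAssociated τ β') (k : ℤ) :
    β.pt k = β'.pt k := by
  obtain ⟨r, hr⟩ := h.exists_isFolding hx hy
  obtain ⟨r', hr'⟩ := h'.exists_isFolding hx hy
  have : r = r' := by
    funext k
    induction k using Int.induction_on with
    | zero => rw [hr.zero, hr'.zero]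
    | succ k ih => rw [hr.succ, hr'.succ, ih]
    | pred k ih =>
      have e1 := hr.succ (-k - 1)
      have e2 := hr'.succ (-k - 1)
      rw [sub_add_cancel] at e1 e2
      rw [e1, e2] at ih
      exact add_right_cancel ih
  rw [hr.pt, hr'.pt, this]

/-- The trajectory traversed backwards from the step `k + 1`, and rotated. -/
def rotatedReverse (β : BilliardTrajectory) (κ : ZMod 5) (k : ℤ) : BilliardTrajectory where
  side j := foldSide 0 (-κ) (β.side (k + 1 - j))
  pt j := zp (-κ) * β.pt (k + 1 - j)
  dir j := -(zp (-κ) * β.dir (k - j))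
  time j := β.time (k - j)
  pt_mem j := by
    have := fold_mem (f := 0) (a := -κ) (β.pt_mem (k + 1 - j))
    simpa [fold] using this
  time_pos j := β.time_pos _
  side_ne j h := by
    have h1 := β.side_ne (k + 1 - (j + 1))
    rw [show k + 1 - (j + 1) + 1 = k + 1 - j by ring] at h1
    exact h1 (foldSide_injective _ _ h).symm
  next_pt j := by
    have h1 := β.next_pt (k - j)
    rw [show k + 1 - (j + 1) = k - j by ring, show k + 1 - j = k - j + 1 by ring, h1]
    simp only [Complex.real_smul]
    ring
  next_dir j := by
    have h1 := β.next_dir (k - (j + 1))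
    rw [show k - (j + 1) + 1 = k - j by ring] at h1
    rw [reflectDir_pent] at h1
    rw [show k + 1 - (j + 1) = k - j by ring, reflectDir_pent, h1]
    have h2 : zp (2 * cz (foldSide 0 (-κ) (β.side (k - j))) + 1) *
        (zp κ * zp (-(2 * cz (β.side (k - j)) + 1))) = zp (-κ) := by
      rw [← zp_add, ← zp_add]
      congr 1
      generalize β.side (k - j) = s
      revert s κ; decide
    simp only [map_neg, map_mul, conj_zp, Complex.conj_conj, neg_neg]
    linear_combination (β.dir (k - (j + 1))) * h2

theorem zero_notMem_pentSide (i : Fin 5) : (0 : ℂ) ∉ pentSide i := by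
  rintro ⟨p, q, hp, hq, hpq, h⟩
  rw [pent_succ, pent_zp] at h
  simp only [Complex.real_smul] at h
  have h0 : (circumradius : ℂ) ≠ 0 := by exact_mod_cast circumradius_ne_zero
  have h1 : circumradius * Complex.I * zp (cz i) * (p + q * ζ) = 0 := by
    have : zp 1 = ζ := pow_one ζ
    rw [this] at h
    linear_combination h
  have h2 : (p : ℂ) + q * ζ = 0 :=
    (mul_eq_zero.1 h1).resolve_left (mul_ne_zero (mul_ne_zero h0 Complex.I_ne_zero) (zp_ne_zero _))
  have h3 := congrArg Complex.im h2
  rw [ζ_eq] at h3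
  have := sn_pos
  have := one_lt_φ
  simp at h3
  rcases h3 with h3 | h3 | h3 <;> linarith

/-- A symmetry of the path makes the image of the first segment overlap with some segment. -/
theorem exists_overlap {β : BilliardTrajectory} {κ : ZMod 5} {c : ℝ} (hc : 0 < c)
    (hβ : ∀ k, ‖β.dir k‖ = c) (h : fold 0 κ '' β.trace = β.trace) :
    ∃ (k : ℤ) (a b : ℝ), zp κ * (β.pt 0 + a • β.dir 0) = β.pt k + b • β.dir k ∧
      (zp κ * β.dir 0 = β.dir k ∨ zp κ * β.dir 0 = -β.dir k) := by
  have hmem : ∀ t : Set.Icc (0 : ℝ) 1, ∃ (k : ℤ) (b : ℝ),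
      zp κ * (β.pt 0 + (t * β.time 0) • β.dir 0) = β.pt k + b • β.dir k := by
    rintro ⟨t, ht0, ht1⟩
    have h1 : β.pt 0 + (t * β.time 0) • β.dir 0 ∈ β.trace := by
      refine Set.mem_iUnion.2 ⟨0, 1 - t, t, by linarith, ht0, by ring, ?_⟩
      rw [β.next_pt, sub_smul, one_smul, smul_add, smul_smul]
      ring
    have h2 : fold 0 κ (β.pt 0 + (t * β.time 0) • β.dir 0) ∈ β.trace := by
      rw [← h]; exact Set.mem_image_of_mem _ h1
    obtain ⟨k, p, q, hp, hq, hpq, h3⟩ := Set.mem_iUnion.1 h2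
    refine ⟨k, q * β.time k, ?_⟩
    rw [show fold 0 κ (β.pt 0 + (t * β.time 0) • β.dir 0) =
      zp κ * (β.pt 0 + (t * β.time 0) • β.dir 0) by simp [fold]] at h3
    rw [← h3, β.next_pt, smul_add, smul_smul, ← add_assoc, ← add_smul, hpq, one_smul]
  choose k b hkb using hmem
  -- The first segment has uncountably many points and the path has countably many segments, so two
  -- image points lie on the line of one segment; this fixes its direction up to sign.
  have hninj : ¬ Function.Injective k := by
    intro hinj
    have h1 : Countable (Set.Icc (0 : ℝ) 1) := hinj.countable
    have h2 := Cardinal.mk_le_aleph0 (α := Set.Icc (0 : ℝ) 1)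
    rw [Cardinal.mk_Icc_real one_pos] at h2
    exact absurd h2 (not_le.2 Cardinal.aleph0_lt_continuum)
  simp only [Function.Injective, not_forall] at hninj
  obtain ⟨t, t', hk, hne⟩ := hninj
  refine ⟨k t, t * β.time 0, b t, hkb t, ?_⟩
  have h1 := hkb t
  have h2 := hkb t'
  rw [← hk] at h2
  have hs : ((t : ℝ) - t') * β.time 0 ≠ 0 :=
    mul_ne_zero (sub_ne_zero.2 fun e => hne (Subtype.ext e)) (β.time_pos 0).ne'
  have h3 : (((t : ℝ) - t') * β.time 0) • (zp κ * β.dir 0) = (b t - b t') • β.dir (k t) := by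
    simp only [Complex.real_smul] at h1 h2 ⊢
    push_cast at h1 h2 ⊢
    linear_combination h1 - h2
  have h4 := congrArg norm h3
  rw [norm_smul, norm_smul, norm_mul (zp κ), norm_zp, one_mul, hβ, hβ] at h4
  have h5 := mul_right_cancel₀ hc.ne' h4
  rw [Real.norm_eq_abs, Real.norm_eq_abs] at h5
  rcases abs_eq_abs.1 h5 with h6 | h6
  · left
    rw [← h6] at h3
    exact smul_right_injective ℂ hs h3
  · right
    rw [h6, neg_smul, ← smul_neg] at h3
    rw [h6] at hs
    rw [← neg_eq_iff_eq_neg]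
    exact smul_right_injective ℂ (neg_ne_zero.1 hs) h3

theorem face_two_mul {θ : ℂ} (τ : doublePentagon.Trajectory θ) (m : ℤ) :
    τ.face (2 * m) = τ.face 0 := by
  have h2 : ∀ k, τ.face (k + 2) = τ.face k := by
    intro k
    rw [show k + 2 = k + 1 + 1 by ring, face_succ, face_succ]
    generalize τ.face k = f
    revert f; decide
  induction m using Int.induction_on with
  | zero => rfl
  | succ m ih => rw [mul_add, mul_one, h2, ih]
  | pred m ih => rw [← ih, ← h2, mul_sub, mul_one, sub_add_cancel]

/-- A rotation preserving the path makes the image of the first segment overlap with some segment k.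
If the orientations agree, `τ` is in the same state at 0 and k, and since r N = 0 the rotation is
trivial. If they are opposite, the rotated reversed path is also associated with `τ`, hence
coincides with the original bounce by bounce, and its middle bounce is fixed by the rotation. -/
theorem IsFolding.noRotationSymmetry {τ : doublePentagon.Trajectory (pl x y)}
    {β : BilliardTrajectory} {r : ℤ → ZMod 5} (h : IsFolding τ β r) (hx : 0 < x) (hy : 0 ≤ y)
    (hy' : y ≠ 0) (h0 : τ.face 0 = 0) {N : ℕ} (hN : τ.HasCombPeriod N) (hr : r N = 0) :
    NoRotationSymmetry β.trace := by
  intro κ hκ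
  rw [d5_r] at hκ
  have hst := dSeq_st hx hy τ
  have hN' := (hasCombPeriod_iff hx hy τ N).1 hN
  have hθ := pl_ne_zero (y := y) hx
  have hA := h.isAssociated h0
  obtain ⟨-, hpt, hside, hdir⟩ := hA
  obtain ⟨k, a, b, h1, h2⟩ := exists_overlap (norm_pos_iff.2 hθ) h.norm_dir hκ
  rw [hpt, hdir] at h1
  rw [hdir] at h2
  rw [h.pt k, h.dir k, ← fold_add_smul] at h1
  rw [h.dir k] at h2
  have hz0 : τ.pt 0 = turn (τ.face 0) (τ.pt 0) := by simp [turn, h0]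
  rcases h2 with h2 | h2
  · have h3 : fold 0 κ (turn 0 (pl x y)) = fold (τ.face k) (r k) (turn (τ.face k) (pl x y)) := by
      rw [← h2]; simp [fold, turn]
    rcases fold_eq_fold hx hy h3 with h4 | ⟨h4, h5⟩
    · exact absurd h4 hy'
    rw [h5, ← h4] at h1
    have h6 : τ.pt 0 + a • pl x y = turn 0 (τ.pt k) + b • pl x y := by
      apply fold_injective 0 (r k)
      simpa [fold, turn] using h1
    have h7 := congrArg (ell x y) h6
    rw [ell_add_smul, ell_add_smul] at h7
    have h8 : τ.st x y 0 = τ.st x y k := by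
      refine DStep.side_unique hx hy (hst 0) (hst k) (h0.trans h4) ?_
      simp only [GluedPolygons.Trajectory.st]
      rw [← hz0, h7, h4]
    rw [h5]
    obtain ⟨n, rfl | rfl⟩ := k.eq_nat_or_neg
    · obtain ⟨q, rfl⟩ := period_dvd hN' (hst.periodic hx hy (k := 0) (by rw [zero_add, h8]))
      have := (h.r_add_mul hN'.1.2 0 q).2
      rw [zero_add, hr, h.zero] at this
      simpa using this
    · obtain ⟨q, rfl⟩ := period_dvd hN' (hst.periodic hx hy (k := -n) (by rw [neg_add_cancel, h8]))
      have := (h.r_add_mul hN'.1.2 (-((N * q : ℕ) : ℤ)) q).2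
      rw [neg_add_cancel, hr, h.zero] at this
      simpa using this.symm
  · rcases fin_two (τ.face k) with hf | hf
    -- In the face 0 a fifth root of unity would have to be -1.
    · exfalso
      rw [hf] at h2
      have h3 : zp (κ - r k) * pl x y = -1 * pl x y := by
        have h4 := zp_mul_neg (r k)
        simp only [fold, turn, if_true] at h2
        rw [sub_eq_add_neg, zp_add]
        linear_combination zp (-r k) * h2 - pl x y * h4
      exact zp_ne_neg_one _ (mul_right_cancel₀ hθ h3)
    -- Q folds the segment k and undoes the rotation by κ, so that its image is an oppositely
    -- oriented chord on the line of the first segment; it has to be the same chord.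
    · set Q := fold 1 (r k - κ) with hQ
      have hκQ : ∀ z, zp κ * Q z = fold 1 (r k) z := by
        intro z
        have := zp_mul_neg κ
        simp only [hQ, fold, sub_eq_add_neg, zp_add, one_ne_zero, if_false]
        linear_combination (zp (r k) * -starRingEnd ℂ z) * this
      rw [hf] at h1 h2
      have hQθ : Q (turn 1 (pl x y)) = -pl x y := by
        apply mul_left_cancel₀ (zp_ne_zero κ)
        rw [hκQ, mul_neg, h2, neg_neg]
      have hQadd : ∀ (z : ℂ) (t : ℝ), Q (z + t • turn 1 (pl x y)) = Q z - t • pl x y := by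
        intro z t
        rw [hQ, fold_add_smul, ← hQ, hQθ, smul_neg, sub_eq_add_neg]
      have hz := turn_mem.2 (τ.pt_mem k)
      have hw := turn_mem.2 (τ.exit_mem k)
      rw [turn_add_smul] at hw
      rw [hf] at hz hw
      have hz' := fold_mem (f := 1) (a := r k - κ) hz
      have hw' := fold_mem (f := 1) (a := r k - κ) hw
      have hz1 : Q (turn 1 (τ.pt k)) =
          Q (turn 1 (τ.pt k) + τ.time k • turn 1 (pl x y)) + τ.time k • pl x y := by
        rw [hQadd]; ring
      rw [← hQ] at hz' hw'
      have hc1 := dCross_of_mem hx hy hw' (hz1 ▸ hz') (τ.time_pos k) fun e =>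
        τ.side_ne k (foldSide_injective _ _ e).symm
      have hc0 := dCross_of_mem hx hy (turn_mem.2 (τ.pt_mem 0)) (by
        have := turn_mem.2 (τ.exit_mem 0)
        rw [turn_add_smul] at this
        rwa [show turn (τ.face 0) (pl x y) = pl x y by simp [turn, h0]] at this)
        (τ.time_pos 0) (τ.side_ne 0)
      have hell : ell x y (Q (turn 1 (τ.pt k) + τ.time k • turn 1 (pl x y))) =
          ell x y (turn (τ.face 0) (τ.pt 0)) := by
        have h3 : τ.pt 0 + a • pl x y = Q (turn 1 (τ.pt k)) + (-b) • pl x y := by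
          apply mul_left_cancel₀ (zp_ne_zero κ)
          rw [h1, neg_smul, ← sub_eq_add_neg, ← hQadd, hκQ]
        have h4 := congrArg (ell x y) h3
        rw [ell_add_smul, ell_add_smul, hz1, ell_add_smul] at h4
        rw [← hz0, h4]
      rw [hell] at hc1
      have hs := hc1.entry_unique hx hy hc0
      rw [hs] at hw'
      have hlt := (hst 0).lo_lt
      have hpt0 := eq_of_ell_eq (hlt.1.trans hlt.2) hw' (turn_mem.2 (τ.pt_mem 0)) hell
      have hptk : β.pt (k + 1) = zp κ * τ.pt 0 := by
        rw [β.next_pt, h.pt, h.dir, h.time, ← fold_add_smul, hf, ← hκQ, hpt0, ← hz0]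
      have hsidek : foldSide 0 (-κ) (β.side (k + 1)) = τ.sideIn 0 := by
        have h3 : β.side (k + 1) = foldSide 1 (r k) (τ.sideOut k) := by
          rw [h.side, face_succ, h.succ, sideIn_succ, foldSide_next, hf]
        rw [h3, ← hs]
        generalize τ.sideOut k = j
        generalize r k = c
        clear hκ h1 h2 hκQ hQθ hz' hw' hc1 hs hQ hQadd hz1 hell hpt0 hptk
        revert κ j c
        decide
      have hA' : IsAssociated τ (rotatedReverse β κ k) := by
        refine ⟨h0, ?_, ?_, ?_⟩
        · simp only [rotatedReverse, sub_zero]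
          rw [hptk, ← mul_assoc, mul_comm (zp (-κ)), zp_mul_neg, one_mul]
        · simpa only [rotatedReverse, sub_zero] using hsidek
        · simp only [rotatedReverse, sub_zero]
          rw [h.dir, hf, ← mul_neg, ← h2, ← mul_assoc, mul_comm (zp (-κ)), zp_mul_neg, one_mul]
      -- Step k is in the face 1, so k = 2m + 1 is odd and the reversal fixes the index m + 1. The
      -- bounce there is not the centre of the table, so the rotation is trivial.
      obtain ⟨m, hm | hm⟩ := Int.even_or_odd' k
      · rw [hm, face_two_mul, h0] at hf
        exact absurd hf (by decide)
      · have h3 := (h.isAssociated h0).pt_eq hx hy hA' (m + 1)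
        have h4 : (rotatedReverse β κ k).pt (m + 1) = zp (-κ) * β.pt (k + 1 - (m + 1)) := rfl
        rw [h4, show k + 1 - (m + 1) = m + 1 by rw [hm]; ring] at h3
        have h5 : β.pt (m + 1) ≠ 0 := fun e =>
          zero_notMem_pentSide _ (e ▸ β.pt_mem (m + 1))
        have h6 : zp (-κ) = 1 := mul_right_cancel₀ h5 (by rw [← h3, one_mul])
        exact neg_eq_zero.1 (eq_zero_of_zp h6)

/-! ### Short and long trajectories -/

theorem HasLength.unique {X : GluedPolygons (Fin 2) 5} {θ : ℂ} {τ : X.Trajectory θ} {ℓ ℓ' : ℝ}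
    (h : τ.HasLength ℓ) (h' : τ.HasLength ℓ') : ℓ = ℓ' := by
  obtain ⟨N, hN, rfl⟩ := h
  obtain ⟨N', hN', rfl⟩ := h'
  rw [IsLeast.unique hN hN']

theorem hasLength_of_sum {x y c : ℝ} (hx : 0 < x) {τ : doublePentagon.Trajectory (pl x y)} {N : ℕ}
    (hN : τ.HasCombPeriod N) (ha : ∑ i ∈ Finset.range N, da (τ.st x y (i + 1)) = c * x) :
    τ.HasLength (c * ‖pl x y‖) := by
  refine ⟨N, hN, ?_⟩
  have hpt : τ.pt N = τ.pt 0 := by simpa using (hN.1.2 0).2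
  rw [← Finset.sum_mul, sum_time_eq hx τ hpt ha]

/-- The invariants of an arbitrary trajectory in the direction of a tree word: the cylinder type `c`
fixes length and number of crossings, and the end node decides whether one period produces a
rotation. -/
theorem exists_length (u : List (Fin 4)) (τ : doublePentagon.Trajectory (pl (vec u 1).1 (vec u 1).2)) :
    ∃ (N : ℕ) (c : ℝ), (c = 1 ∨ c = φ) ∧ τ.HasCombPeriod N ∧
      τ.HasLength (c * ‖pl (vec u 1).1 (vec u 1).2‖) ∧
      (∀ a b c' d : ℕ, vec u 1 = (a + b * φ, c' + d * φ) →
        (c = 1 → N = 2 * (a + b + c' + d)) ∧ (c = φ → N = 2 * (a + 2 * b + c' + 2 * d))) ∧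
      ∀ (β : BilliardTrajectory) (r : ℤ → ZMod 5), IsFolding τ β r →
        (r N = 0 ↔ endNode u = .F) := by
  obtain ⟨hx, hy⟩ := vec_pos u one_pos
  obtain ⟨N, c, hc, hN, ha, -, n₃, n₄, m₀, m₁, m₂, rfl, hn, hF, h1, h2⟩ :=
    DSeq.exists_period u (dSeq_st hx hy τ)
  have hN' := (hasCombPeriod_iff hx hy τ _).2 hN
  refine ⟨_, c, hc, hN', hasLength_of_sum hx hN' ha, fun a b c' d hv => ?_, fun β r h => ?_⟩
  · obtain ⟨e1, e2, -⟩ := counts_of_holonomy hc hv hn h1 h2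
    exact ⟨fun e => by rw [e1 e], fun e => by rw [e2 e]⟩
  · obtain ⟨a, b, c', d, hv, -⟩ := exists_coef u
    obtain ⟨-, -, e3⟩ := counts_of_holonomy hc hv hn h1 h2
    rw [h.r_eq_sum (vec u 1).1 (vec u 1).2, hF fun f j => turning (f + 1) j,
      endNode_eq_F_iff hv, ← e3]
    rfl

theorem exists_core_trajectory (u : List (Fin 4)) {c : ℝ} (hc : c = 1 ∨ c = φ) :
    ∃ τ : doublePentagon.Trajectory (pl (vec u 1).1 (vec u 1).2),
      τ.HasLength (c * ‖pl (vec u 1).1 (vec u 1).2‖) ∧ τ.face 0 = 0 ∧ τ.ThroughMidpoint := by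
  obtain ⟨hx, hy⟩ := vec_pos u one_pos
  obtain ⟨st, N, hst, hN, ha, h0, hm⟩ := exists_core_dSeq u hc
  obtain ⟨τ, rfl⟩ := hst.exists_trajectory hx hy
  exact ⟨τ, hasLength_of_sum hx ((hasCombPeriod_iff hx hy τ N).2 hN) ha, h0,
    (throughMidpoint_iff hx hy τ).2 hm⟩

theorem length_cases {u : List (Fin 4)} {τ : doublePentagon.Trajectory (pl (vec u 1).1 (vec u 1).2)}
    {ℓ : ℝ} (h : τ.HasLength ℓ) : ℓ = ‖pl (vec u 1).1 (vec u 1).2‖ ∨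
      ℓ = φ * ‖pl (vec u 1).1 (vec u 1).2‖ := by
  obtain ⟨N, c, rfl | rfl, -, h1, -⟩ := exists_length u τ
  · exact .inl (by rw [HasLength.unique h h1, one_mul])
  · exact .inr (HasLength.unique h h1)

theorem norm_lt_φ_mul_norm (u : List (Fin 4)) :
    ‖pl (vec u 1).1 (vec u 1).2‖ < φ * ‖pl (vec u 1).1 (vec u 1).2‖ :=
  lt_mul_of_one_lt_left (norm_pos_iff.2 (pl_ne_zero (vec_pos u one_pos).1)) one_lt_φ

/-- Only two lengths are possible, and the core trajectories show that both occur, so the extremal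
lengths are these two. -/
theorem isShort_iff {u : List (Fin 4)} (τ : doublePentagon.Trajectory (pl (vec u 1).1 (vec u 1).2)) :
    τ.IsShort ↔ τ.HasLength ‖pl (vec u 1).1 (vec u 1).2‖ := by
  have hlt := norm_lt_φ_mul_norm u
  constructor
  · rintro ⟨ℓ, h, hmin⟩
    obtain ⟨τ', h', -⟩ := exists_core_trajectory u (.inl rfl)
    rcases length_cases h with rfl | rfl
    · exact h
    · have := hmin τ' _ h'
      linarith
  · refine fun h => ⟨_, h, fun τ' ℓ' h' => ?_⟩
    rcases length_cases h' with rfl | rfl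
    · exact le_rfl
    · exact hlt.le

theorem isLong_iff {u : List (Fin 4)} (τ : doublePentagon.Trajectory (pl (vec u 1).1 (vec u 1).2)) :
    τ.IsLong ↔ τ.HasLength (φ * ‖pl (vec u 1).1 (vec u 1).2‖) := by
  have hlt := norm_lt_φ_mul_norm u
  constructor
  · rintro ⟨ℓ, h, hmax⟩
    obtain ⟨τ', h', -⟩ := exists_core_trajectory u (.inr rfl)
    rcases length_cases h with rfl | rfl
    · have := hmax τ' _ h'
      linarith
    · exact h
  · refine fun h => ⟨_, h, fun τ' ℓ' h' => ?_⟩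
    rcases length_cases h' with rfl | rfl
    · exact hlt.le
    · exact le_rfl

theorem isShort_or_isLong {u : List (Fin 4)}
    (τ : doublePentagon.Trajectory (pl (vec u 1).1 (vec u 1).2)) : τ.IsShort ∨ τ.IsLong := by
  rw [isShort_iff, isLong_iff]
  obtain ⟨N, c, rfl | rfl, -, h, -⟩ := exists_length u τ
  · exact .inl (by rwa [one_mul] at h)
  · exact .inr h

theorem IsShort.hasCombPeriod {u : List (Fin 4)}
    {τ : doublePentagon.Trajectory (pl (vec u 1).1 (vec u 1).2)} (h : τ.IsShort) {a b c d : ℕ}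
    (hv : vec u 1 = (a + b * φ, c + d * φ)) : τ.HasCombPeriod (2 * (a + b + c + d)) := by
  rw [isShort_iff] at h
  obtain ⟨N, e, rfl | rfl, hN, h1, h2, -⟩ := exists_length u τ
  · rwa [← (h2 a b c d hv).1 rfl]
  · exact absurd (HasLength.unique h h1) (norm_lt_φ_mul_norm u).ne

theorem IsLong.hasCombPeriod {u : List (Fin 4)}
    {τ : doublePentagon.Trajectory (pl (vec u 1).1 (vec u 1).2)} (h : τ.IsLong) {a b c d : ℕ}
    (hv : vec u 1 = (a + b * φ, c + d * φ)) : τ.HasCombPeriod (2 * (a + 2 * b + c + 2 * d)) := by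
  rw [isLong_iff] at h
  obtain ⟨N, e, rfl | rfl, hN, h1, h2, -⟩ := exists_length u τ
  · rw [one_mul] at h1
    exact absurd (HasLength.unique h1 h) (norm_lt_φ_mul_norm u).ne
  · rwa [← (h2 a b c d hv).2 rfl]

/-! ### The associated billiard trajectories -/

theorem parallelToSide_iff {x y : ℝ} (hx : 0 < x) (hy : 0 ≤ y) :
    ParallelToSide (pl x y) ↔ y = 0 := by
  have h1 := one_lt_φ
  have h2 := φ_lt
  constructor
  · rintro ⟨i, r, h⟩
    rw [pent_eq, pent_eq, ← pl_sub, ← pl_smul] at h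
    obtain ⟨ex, ey⟩ := pl_injective h
    fin_cases i <;> simp at ex ey <;> nlinarith
  · rintro rfl
    -- Side 2 is the bottom side, of length φ - 1.
    refine ⟨2, x / (φ - 1), ?_⟩
    rw [pent_eq, pent_eq, ← pl_sub, ← pl_smul]
    have h3 : φ - 1 ≠ 0 := by linarith
    congr 1
    · simp; field_simp; ring
    · simp

theorem hasCombPeriod_two {N : ℕ} {τ : doublePentagon.Trajectory (pl 1 0)}
    (hN : τ.HasCombPeriod N) : N = 2 := by
  obtain ⟨N', c, hc, hN', -, h, -⟩ := exists_length [] τ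
  obtain rfl := IsLeast.unique hN hN'
  have h1 := h 1 0 0 0 (by simp [vec_nil])
  rcases hc with hc | hc
  · exact h1.1 hc
  · exact h1.2 hc

/-- The order of the rotation gives five periods as soon as odd periods are excluded. Outside the
horizontal direction they are impossible, and in it they would make `τ` a core trajectory. -/
theorem IsFolding.hasCombPeriod_five {u : List (Fin 4)} (hu : u.head? ≠ some 0)
    {τ : doublePentagon.Trajectory (pl (vec u 1).1 (vec u 1).2)} {β : BilliardTrajectory}
    {r : ℤ → ZMod 5} (h : IsFolding τ β r) {N : ℕ} (hN : τ.HasCombPeriod N) (hr : r N ≠ 0)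
    (hpar : ¬ ((vec u 1).2 = 0 ∧ τ.ThroughMidpoint)) : β.HasCombPeriod (N * 5) := by
  obtain ⟨hx, hy⟩ := vec_pos u one_pos
  refine h.hasCombPeriod hx hy hN (isLeast_five hr) fun p hp => ?_
  by_cases hy' : (vec u 1).2 = 0
  · by_contra hodd
    refine hpar ⟨hy', ?_⟩
    obtain rfl : u = [] := by
      by_contra hu'
      exact (vec_snd_pos hu hu' one_pos).ne' hy'
    obtain rfl := hasCombPeriod_two hN
    exact IsFolding.throughMidpoint_of_odd (x := 1) h one_pos
      ((hasCombPeriod_iff hx hy τ 2).1 hN).1.2 hp hodd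
  · exact h.even_of_ne hx hy hy' hp

/-- The billiard trajectories associated with a trajectory of nonzero total turning. -/
theorem IsFolding.of_ne {u : List (Fin 4)} (hu : u.head? ≠ some 0)
    {τ : doublePentagon.Trajectory (pl (vec u 1).1 (vec u 1).2)} {β : BilliardTrajectory}
    {r : ℤ → ZMod 5} (h : IsFolding τ β r) {N : ℕ} {ℓ : ℝ} (hN : τ.HasCombPeriod N)
    (hℓ : τ.HasLength ℓ) (hr : r N ≠ 0) :
    RotationSymmetry β.trace ∧
    (τ.ThroughMidpoint → FullSymmetry β.trace) ∧
    (¬ (ParallelToSide (pl (vec u 1).1 (vec u 1).2) ∧ τ.ThroughMidpoint) →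
      β.HasCombPeriod (5 * N) ∧ β.HasLength (5 * ℓ)) ∧
    (ParallelToSide (pl (vec u 1).1 (vec u 1).2) ∧ τ.ThroughMidpoint →
      (∃ M : ℕ, 2 * M = 5 * N ∧ β.HasCombPeriod M) ∧ β.HasLength (5 / 2 * ℓ)) := by
  obtain ⟨hx, hy⟩ := vec_pos u one_pos
  rw [parallelToSide_iff hx hy]
  have hrot := h.rotationSymmetry hx hy hN hr
  refine ⟨hrot, fun hm => ?_, fun hpar => ?_, ?_⟩
  · obtain ⟨a, ha⟩ := h.exists_reflection_trace hx hy hm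
    exact fullSymmetry_of hrot ha
  · have hβ := h.hasCombPeriod_five hu hN hr hpar
    exact ⟨mul_comm N 5 ▸ hβ, h.hasLength hx hy hN hℓ hβ⟩
  · rintro ⟨hy', hm⟩
    obtain rfl : u = [] := by
      by_contra hu'
      exact (vec_snd_pos hu hu' one_pos).ne' hy'
    obtain rfl := hasCombPeriod_two hN
    have hβ := IsFolding.horizontal_core (x := 1) h one_pos hN hm hℓ
    exact ⟨⟨5, rfl, hβ.1⟩, hβ.2⟩

/-- The billiard trajectories associated with a trajectory of total turning zero. -/
theorem IsFolding.of_eq_zero {u : List (Fin 4)}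
    {τ : doublePentagon.Trajectory (pl (vec u 1).1 (vec u 1).2)} {β : BilliardTrajectory}
    {r : ℤ → ZMod 5} (h : IsFolding τ β r) {N : ℕ} {ℓ : ℝ} (hN : τ.HasCombPeriod N)
    (hℓ : τ.HasLength ℓ) (hr : r N = 0) (hy' : (vec u 1).2 ≠ 0) (h0 : τ.face 0 = 0) :
    NoRotationSymmetry β.trace ∧
    (τ.ThroughMidpoint → OnlyBilateralSymmetry β.trace) ∧
    β.HasCombPeriod N ∧ β.HasLength ℓ := by
  obtain ⟨hx, hy⟩ := vec_pos u one_pos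
  have hrot := h.noRotationSymmetry hx hy hy' h0 hN hr
  have hβ := h.hasCombPeriod hx hy hN (isLeast_one hr) fun p hp => h.even_of_ne hx hy hy' hp
  refine ⟨hrot, fun hm => ?_, mul_one N ▸ hβ, ?_⟩
  · obtain ⟨a, ha⟩ := h.exists_reflection_trace hx hy hm
    exact onlyBilateralSymmetry_of hrot ha
  · simpa using h.hasLength hx hy hN hℓ hβ

end PentBilliard

end

/-! ### Assembly of the theorem -/

theorem mainTheorem12 (w : Fin 2 → ℝ) (hw₀ : 0 < w 0) (hw₁ : 0 ≤ w 1)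
    (hw : goldenL.IsPeriodicDirection (toPlane w)) :
    (∃ v : Fin 2 → ℝ, goldenL.IsLongSaddleVector (toPlane w) (toPlane v)) ∧
    ∀ v : Fin 2 → ℝ, goldenL.IsLongSaddleVector (toPlane w) (toPlane v) →
      (∃ a b c d : ℕ, v = ![a + b * Real.goldenRatio, c + d * Real.goldenRatio]) ∧
      (∃! u : List (Fin 4), IsTreeWord u v) ∧
      (∀ τ : doublePentagon.Trajectory (toPlane (P *ᵥ v)), τ.IsShort ∨ τ.IsLong) ∧
      (∃ τ : doublePentagon.Trajectory (toPlane (P *ᵥ v)),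
        τ.IsShort ∧ τ.face 0 = 0 ∧ τ.ThroughMidpoint) ∧
      (∃ τ : doublePentagon.Trajectory (toPlane (P *ᵥ v)),
        τ.IsLong ∧ τ.face 0 = 0 ∧ τ.ThroughMidpoint) ∧
      (∀ a b c d : ℕ, v = ![a + b * Real.goldenRatio, c + d * Real.goldenRatio] →
        ∀ τ : doublePentagon.Trajectory (toPlane (P *ᵥ v)),
          (τ.IsShort → τ.HasCombPeriod (2 * (a + b + c + d)) ∧
            τ.HasLength ‖toPlane (P *ᵥ v)‖) ∧
          (τ.IsLong → τ.HasCombPeriod (2 * (a + 2 * b + c + 2 * d)) ∧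
            τ.HasLength (Real.goldenRatio * ‖toPlane (P *ᵥ v)‖))) ∧
      ∀ u : List (Fin 4), IsTreeWord u v →
        ∀ (τ : doublePentagon.Trajectory (toPlane (P *ᵥ v))) (N : ℕ) (ℓ : ℝ),
          τ.face 0 = 0 → τ.HasCombPeriod N → τ.HasLength ℓ →
          (∃ β : BilliardTrajectory, IsAssociated τ β) ∧
          ∀ β : BilliardTrajectory, IsAssociated τ β →
            (endNode u ≠ .F →
              RotationSymmetry β.trace ∧
              (τ.ThroughMidpoint → FullSymmetry β.trace) ∧
              (¬ (ParallelToSide (toPlane (P *ᵥ v)) ∧ τ.ThroughMidpoint) →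
                β.HasCombPeriod (5 * N) ∧ β.HasLength (5 * ℓ)) ∧
              (ParallelToSide (toPlane (P *ᵥ v)) ∧ τ.ThroughMidpoint →
                (∃ M : ℕ, 2 * M = 5 * N ∧ β.HasCombPeriod M) ∧ β.HasLength (5 / 2 * ℓ))) ∧
            (endNode u = .F →
              NoRotationSymmetry β.trace ∧
              (τ.ThroughMidpoint → OnlyBilateralSymmetry β.trace) ∧
              β.HasCombPeriod N ∧ β.HasLength ℓ) := by
  obtain ⟨u, r, hr, hu, hur⟩ := exists_word_of_periodic hw₀ hw₁ hw
  have hw' : toPlane w = vecC u r := by rw [toPlane, vecC, hur]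
  have hlong : ∀ v : Fin 2 → ℝ, goldenL.IsLongSaddleVector (toPlane w) (toPlane v) ↔
      v = ![(vec u 1).1, (vec u 1).2] := by
    intro v
    rw [hw', isLongSaddleVector_iff hu hr]
    constructor
    · intro h
      have h1 := congrArg Complex.re h
      have h2 := congrArg Complex.im h
      funext i
      fin_cases i
      · exact h1
      · exact h2
    · rintro rfl; rfl
  refine ⟨⟨_, (hlong _).2 rfl⟩, fun v hv => ?_⟩
  obtain rfl := (hlong v).1 hv
  have hθ : toPlane (P *ᵥ ![(vec u 1).1, (vec u 1).2]) = pl (vec u 1).1 (vec u 1).2 := toPlane_P _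
  have htree : ∀ u', IsTreeWord u' ![(vec u 1).1, (vec u 1).2] → u' = u := by
    intro u' h'
    obtain ⟨hu', h⟩ := (isTreeWord_iff _ _).1 h'
    exact vec_injective hu' hu (Prod.ext (congrFun h 0).symm (congrFun h 1).symm)
  rw [hθ]
  refine ⟨?_, ⟨u, (isTreeWord_iff _ _).2 ⟨hu, rfl⟩, htree⟩, isShort_or_isLong, ?_, ?_, ?_, ?_⟩
  · obtain ⟨a, b, c, d, h, -⟩ := exists_coef u
    exact ⟨a, b, c, d, by rw [h]; rfl⟩
  · obtain ⟨τ, h, h'⟩ := exists_core_trajectory u (.inl rfl)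
    exact ⟨τ, (isShort_iff τ).2 (by rwa [one_mul] at h), h'⟩
  · obtain ⟨τ, h, h'⟩ := exists_core_trajectory u (.inr rfl)
    exact ⟨τ, (isLong_iff τ).2 h, h'⟩
  · intro a b c d h τ
    have hv : vec u 1 = (a + b * φ, c + d * φ) := Prod.ext (congrFun h 0) (congrFun h 1)
    exact ⟨fun hs => ⟨IsShort.hasCombPeriod hs hv, (isShort_iff τ).1 hs⟩,
      fun hl => ⟨IsLong.hasCombPeriod hl hv, (isLong_iff τ).1 hl⟩⟩
  · intro u' h' τ N ℓ h0 hN hℓ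
    obtain rfl := htree u' h'
    obtain ⟨hx, hy⟩ := vec_pos u' one_pos
    obtain ⟨N', -, -, hN', -, -, hF⟩ := exists_length u' τ
    obtain rfl := IsLeast.unique hN hN'
    refine ⟨?_, fun β hβ => ?_⟩
    · obtain ⟨β, s, hs⟩ := exists_isFolding τ
      exact ⟨β, hs.isAssociated h0⟩
    · obtain ⟨s, hs⟩ := hβ.exists_isFolding hx hy
      refine ⟨fun hne => hs.of_ne hu hN hℓ fun e => hne ((hF β s hs).1 e), fun he => ?_⟩
      refine hs.of_eq_zero hN hℓ ((hF β s hs).2 he) ?_ h0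
      -- The empty word ends at A, so the end node F excludes the horizontal direction.
      refine (vec_snd_pos hu ?_ one_pos).ne'
      rintro rfl
      exact absurd he (by decide)
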